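/- Let $\kappa^*>0$, $\kappa\ge\min(\kappa^*,1)$, and let $\nu^*$ be a probability measure on $\mathbb R$ supported on $[t_0,\infty)$ for some $t_0>0$, with finite second moment. Let $\mu^*=(1-\min(\kappa^*,1))\,\delta_0+\min(\kappa^*,1)\,\nu^*$ and $Q_*=\int x^2\,d\mu^*(x)$. Let $\sigma$ be the semicircle law with density $\frac{1}{2\pi}\sqrt{4-x^2}$ on $[-2,2]$. For $\xi>0$ let $\mu_\xi$ be the free additive convolution of $\mu^*$ with the semicircle law of variance $\xi$, and let $h_\xi(x)=\mathrm{p.v.}\!\int\frac{d\mu_\xi(y)}{x-y}$ be its Hilbert transform. For $\alpha,\lambda>0$ (and label noise $\Delta=0$) consider the system, with unknowns $\xi,q>0$ and $\omega\in\mathbb R$, $$\min(\kappa,1)=\int_\omega^\infty d\mu_\xi,\qquad 1=\frac{\lambda}{q}+\frac1\alpha\int_{\max(q,\omega)}^\infty (x-q)h_\xi(x)\,d\mu_\xi(x),$$ $$2\alpha\xi=Q_*+\int_{\max(q,\omega)}^\infty(q^2-x^2)\,d\mu_\xi(x)+4\xi\int_{\max(q,\omega)}^\infty (x-q)h_\xi(x)\,d\mu_\xi(x),$$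 and set $\mathrm{MSE}=2\alpha\xi$. A number $\alpha_{\mathrm{PR}}^+>0$ is the perfect recovery threshold in the small regularization limit if: for every $\alpha>\alpha_{\mathrm{PR}}^+$ the system has, for all sufficiently small $\lambda>0$, a solution whose MSE tends to $0$ as $\lambda\to0^+$ (so the MSE vanishes in the limit whenever the solution is unique); and for every $0<\alpha<\alpha_{\mathrm{PR}}^+$ there is $\varepsilon>0$ such that for all sufficiently small $\lambda>0$ every solution has $\mathrm{MSE}\ge\varepsilon$. There is at most one such number. (1) If $\kappa^*<1$, there exist real numbers $h,\tilde\omega$ with $$\frac{\min(\kappa,1)-\kappa^*}{1-\kappa^*}=\int_{\tilde\omega}^\infty d\sigma(x),\qquad \frac{\kappa^*}{1-\kappa^*}\,h=\int_{\max(h,\tilde\omega)}^\infty(x-h)\,d\sigma(x),$$ and for all such $h,\tilde\omega$ the perfect recovery threshold exists and equals $$\alpha_{\mathrm{PR}}^+=\kappa^*-\frac{\kappa^{*2}}2+\frac{(1-\kappa^*)^2}{2}\int_{\max(h,\tilde\omega)}^\infty x(x-h)\,d\sigma(x).$$ (2) If $\kappa^*\ge1$ (hence $\kappa\ge1$), the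 perfect recovery threshold exists and equals $\alpha_{\mathrm{PR}}^+=\tfrac12$. -/

import Mathlib

open MeasureTheory Filter Topology Set

noncomputable section

namespace MatrixSensing

/-- The semicircle law on `[-2, 2]` (unit variance), with density `√(4 - x²) / (2π)`. -/
def semicircle : Measure ℝ :=
  volume.withDensity fun x => ENNReal.ofReal (√(4 - x ^ 2) / (2 * Real.pi))

/-- The asymptotic spectral law of the teacher, `(1 - κ*) δ₀ + κ* ν` when `κ* ≤ 1`
(rank fraction `κ*`), and `ν` when `κ* ≥ 1` (full rank). -/
def teacherLaw (κs : ℝ) (ν : Measure ℝ) : Measure ℝ :=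
  ENNReal.ofReal (1 - min κs 1) • Measure.dirac 0 + ENNReal.ofReal (min κs 1) • ν

/-- `ρ` is the free additive convolution of `μ` with the semicircle law of variance `ξ`, i.e. the
limiting spectral law of `Z + √ξ G` with `G` a GOE matrix independent of `Z` and `μ` the limiting
spectral law of `Z`. It is the unique probability measure whose Stieltjes transform
`m(z) = ∫ (x - z)⁻¹ dρ(x)` satisfies `m(z) = m_μ(z + ξ m(z))` on the upper half-plane. -/
def IsFreeSemicircleConv (μ : Measure ℝ) (ξ : ℝ) (ρ : Measure ℝ) : Prop :=
  IsProbabilityMeasure ρ ∧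
    ∀ z : ℂ, 0 < z.im →
      resolventTransform ρ z = resolventTransform μ (z + (ξ : ℂ) * resolventTransform ρ z)

/-- The Hilbert transform `p.v. ∫ (x - y)⁻¹ dρ(y)`. -/
def hilbertTransform (ρ : Measure ℝ) (x : ℝ) : ℝ :=
  limUnder (𝓝[>] (0 : ℝ)) fun ε => ∫ y in {y : ℝ | ε < |x - y|}, (x - y)⁻¹ ∂ρ

/-- The order parameters `(ξ, q)` solve the long-time equations at regularization `lam`,
for the teacher law `μ`, the student width `κ`, the sample complexity `α` and the label noise `Δ`.
Here `ρ` is the law `μ_ξ`, and `ω` is the level which selects the upper mass `min(κ, 1)`. -/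
def SolvesLongTimeEquations (μ : Measure ℝ) (κ α Δ lam ξ q : ℝ) : Prop :=
  0 < ξ ∧ 0 < q ∧ ∃ (ρ : Measure ℝ) (ω : ℝ), IsFreeSemicircleConv μ ξ ρ ∧
    min κ 1 = ρ.real (Ici ω) ∧
    1 = lam / q + 1 / α * ∫ x in Ici (max q ω), (x - q) * hilbertTransform ρ x ∂ρ ∧
    2 * α * ξ - Δ / 2 =
      (∫ x, x ^ 2 ∂μ) + (∫ x in Ici (max q ω), (q ^ 2 - x ^ 2) ∂ρ)
        + 4 * ξ * ∫ x in Ici (max q ω), (x - q) * hilbertTransform ρ x ∂ρ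

/-- The mean squared error of the long-time estimator with order parameter `ξ`. -/
def mse (α Δ ξ : ℝ) : ℝ := 2 * α * ξ - Δ / 2

/-- The long-time equations have, for all small `lam > 0`, a solution whose MSE tends to `0` as
`lam → 0⁺`. When the solution `(ξ, q)` is unique for small `lam`, this says that the MSE of the
estimator vanishes in the small regularization limit. -/
def PerfectRecovery (μ : Measure ℝ) (κ Δ α : ℝ) : Prop :=
  ∃ ξ q : ℝ → ℝ,
    (∀ᶠ lam in 𝓝[>] (0 : ℝ), SolvesLongTimeEquations μ κ α Δ lam (ξ lam) (q lam)) ∧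
    Tendsto (fun lam => mse α Δ (ξ lam)) (𝓝[>] (0 : ℝ)) (𝓝 0)

/-- The MSE stays away from `0` as `lam → 0⁺`, along all solutions of the long-time equations. -/
def MSEBoundedBelow (μ : Measure ℝ) (κ Δ α : ℝ) : Prop :=
  ∃ ε : ℝ, 0 < ε ∧ ∀ᶠ lam in 𝓝[>] (0 : ℝ), ∀ ξ q : ℝ,
    SolvesLongTimeEquations μ κ α Δ lam ξ q → ε ≤ mse α Δ ξ

/-- `a` is the perfect recovery threshold in the small regularization limit: perfect recovery
holds above `a`, while the MSE remains bounded away from zero below `a`. -/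
def IsPerfectRecoveryThreshold (μ : Measure ℝ) (κ Δ a : ℝ) : Prop :=
  0 < a ∧ (∀ α, a < α → PerfectRecovery μ κ Δ α) ∧
    ∀ α, 0 < α → α < a → MSEBoundedBelow μ κ Δ α

theorem PerfectRecovery.not_mseBoundedBelow {μ : Measure ℝ} {κ Δ α : ℝ}
    (h : PerfectRecovery μ κ Δ α) : ¬ MSEBoundedBelow μ κ Δ α := by
  rintro ⟨ε, hε, hb⟩
  obtain ⟨ξ, q, hs, ht⟩ := h
  obtain ⟨lam, h1, h2, h3⟩ := (hs.and (hb.and (ht.eventually_lt_const hε))).exists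
  exact absurd h3 (not_lt.mpr (h2 _ _ h1))

/-- There is at most one perfect recovery threshold. -/
theorem IsPerfectRecoveryThreshold.unique {μ : Measure ℝ} {κ Δ a b : ℝ}
    (ha : IsPerfectRecoveryThreshold μ κ Δ a) (hb : IsPerfectRecoveryThreshold μ κ Δ b) :
    a = b := by
  have key : ∀ {a b : ℝ}, IsPerfectRecoveryThreshold μ κ Δ a →
      IsPerfectRecoveryThreshold μ κ Δ b → ¬ a < b := by
    intro a b ha hb hab
    obtain ⟨c, hac, hcb⟩ := exists_between hab
    exact (ha.2.1 c hac).not_mseBoundedBelow (hb.2.2 c (ha.1.trans hac) hcb)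
  exact le_antisymm (not_lt.mp (key hb ha)) (not_lt.mp (key ha hb))

/-- The equations for the auxiliary levels `h` and `w` (`= ω̃`). The second one is
`κ* / (1 - κ*) = (1/h) ∫_{max(h, w)} (x - h) dσ`, multiplied by `h`. -/
def ThresholdEquations (κ κs h w : ℝ) : Prop :=
  (min κ 1 - κs) / (1 - κs) = semicircle.real (Ici w) ∧
    κs / (1 - κs) * h = ∫ x in Ici (max h w), (x - h) ∂semicircle

end MatrixSensing

end

/-! MSE = 2αξ is small exactly when ξ is, so the theorem is about solutions with ξ → 0, and there
only the part of μ_ξ created by the kernel of the teacher matters.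

Explicit μ_ξ. Its Stieltjes transform is m = m_μ ∘ ω, where ω inverts H(w) = w - ξ m_μ(w). Where Im
H ≥ 0, one has |H(z) - H(w)| ≥ c |z - w|³ with c locally independent of the distance to the real
axis (`subInv_stability`). Hence ω and m extend continuously to the real line, the Poisson formula
gives μ_ξ the bounded continuous density Im m / π, and h_ξ = -Re m. Symmetrising the Hilbert kernel
yields ∫ h_ξ dμ_ξ = 0 and ∫ x h_ξ dμ_ξ = 1/2; expanding m at infinity yields the second moment Q_* +
ξ. These identities trade the integrals over x ≥ max(q, ω) for integrals over x < max(q, ω), and Q_*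
cancels (`solvesLongTimeEquations_iff`).

Spectral gap. For ξ ≤ t₀²/64 the law μ_ξ has no density between 3√ξ and t₀/2 and mass exactly
min(κ*, 1) above t₀/2 (`im_resolventExt_eq_zero`, `real_Ici_bulk`). In the full rank case nothing
lies below t₀/2, so for q ≤ t₀/2 the equations become 1 = λ/q + 1/(2α) and 2αξ = ξ + q², whence the
threshold 1/2.

Low rank, k = κ* < 1. The remaining mass 1 - k lives at scale s = √(ξ(1-k)). With x = sζ and q = sh
the equations read A(ξ, h) = 2α and s h Γ(ξ, h) = 2αλ, an energy and a gap. As ξ → 0 the rescaled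
transform converges to that of the semicircle, A tends to E(h) = 1 + (1-k)h² - (1-k)² ∫_{ζ < max(h,
w)} (ζ-h)² dσ, and Γ tends to (1-k) h Φ(h) with E' = 2(1-k)Φ. The function E is strongly convex, Φ =
0 is the second threshold equation, and min E is twice the claimed threshold.

If 2α < min E, no solution has small ξ; the regime of large q/s is excluded by
`SolvesLongTimeEquations.lower_bound`. If 2α > min E, the root h₀ of E = 2α to the right of the
minimiser has Φ > 0. It persists for small ξ as a continuous branch along which λ is comparable to
√ξ, and the intermediate value theorem in ξ gives a solution for each small λ, with ξ → 0
(`exists_solution_branch`). -/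

namespace MatrixSensing

/-! ### Stieltjes transforms and the cubic stability of w ↦ w - ξ m_μ(w). -/

section Stieltjes

lemma resolventTransform_eq (μ : Measure ℝ) (z : ℂ) :
    resolventTransform μ z = ∫ x : ℝ, ((x : ℂ) - z)⁻¹ ∂μ := by
  simp [resolventTransform_apply, resolvent]

lemma ofReal_sub_ne_zero {z : ℂ} (hz : 0 < z.im) (x : ℝ) : (x : ℂ) - z ≠ 0 := by
  intro h
  have := congrArg Complex.im h
  simp at this
  exact hz.ne' this

lemma norm_inv_ofReal_sub_le {z : ℂ} (hz : 0 < z.im) (x : ℝ) :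
    ‖((x : ℂ) - z)⁻¹‖ ≤ (z.im)⁻¹ := by
  rw [norm_inv]
  gcongr
  have := Complex.abs_im_le_norm ((x : ℂ) - z)
  simp only [Complex.sub_im, Complex.ofReal_im, zero_sub, abs_neg] at this
  exact (le_abs_self _).trans this

lemma continuous_inv_ofReal_sub {z : ℂ} (hz : 0 < z.im) :
    Continuous fun x : ℝ => ((x : ℂ) - z)⁻¹ :=
  Continuous.inv₀ (by fun_prop) (ofReal_sub_ne_zero hz)

lemma integrable_inv_ofReal_sub (μ : Measure ℝ) [IsFiniteMeasure μ] {z : ℂ} (hz : 0 < z.im) :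
    Integrable (fun x : ℝ => ((x : ℂ) - z)⁻¹) μ :=
  Integrable.of_bound (continuous_inv_ofReal_sub hz).aestronglyMeasurable (z.im)⁻¹
    (ae_of_all _ (norm_inv_ofReal_sub_le hz))

lemma integrable_norm_inv_sq (μ : Measure ℝ) [IsFiniteMeasure μ] {z : ℂ} (hz : 0 < z.im) :
    Integrable (fun x : ℝ => ‖((x : ℂ) - z)⁻¹‖ ^ 2) μ := by
  refine Integrable.of_bound
    ((continuous_inv_ofReal_sub hz).norm.pow 2).aestronglyMeasurable ((z.im)⁻¹ ^ 2)
    (ae_of_all _ fun x => ?_)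
  rw [norm_pow, norm_norm]
  gcongr
  exact norm_inv_ofReal_sub_le hz x

/-- `∫ |x - z|⁻² dμ(x)`. -/
noncomputable def sqResolvent (μ : Measure ℝ) (z : ℂ) : ℝ := ∫ x : ℝ, ‖((x : ℂ) - z)⁻¹‖ ^ 2 ∂μ

lemma sqResolvent_nonneg (μ : Measure ℝ) (z : ℂ) : 0 ≤ sqResolvent μ z :=
  integral_nonneg fun _ => by positivity

lemma im_inv_ofReal_sub (z : ℂ) (x : ℝ) :
    (((x : ℂ) - z)⁻¹).im = z.im * ‖((x : ℂ) - z)⁻¹‖ ^ 2 := by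
  rw [Complex.inv_im, norm_inv, inv_pow, ← Complex.normSq_eq_norm_sq]
  simp [div_eq_mul_inv]

lemma im_resolventTransform (μ : Measure ℝ) [IsFiniteMeasure μ] {z : ℂ} (hz : 0 < z.im) :
    (resolventTransform μ z).im = z.im * sqResolvent μ z := by
  rw [resolventTransform_eq, sqResolvent, ← integral_const_mul]
  have := integral_im (integrable_inv_ofReal_sub μ hz)
  simp only [RCLike.im_to_complex] at this
  rw [← this]
  exact integral_congr_ae (ae_of_all _ fun x => im_inv_ofReal_sub z x)

lemma sqResolvent_pos (μ : Measure ℝ) [IsProbabilityMeasure μ] {z : ℂ} (hz : 0 < z.im) :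
    0 < sqResolvent μ z := by
  rw [sqResolvent, integral_pos_iff_support_of_nonneg (fun _ => by positivity)
    (integrable_norm_inv_sq μ hz)]
  have : Function.support (fun x : ℝ => ‖((x : ℂ) - z)⁻¹‖ ^ 2) = univ := by
    ext x
    simp [ofReal_sub_ne_zero hz x]
  rw [this]
  simp

lemma im_resolventTransform_pos (μ : Measure ℝ) [IsProbabilityMeasure μ] {z : ℂ}
    (hz : 0 < z.im) : 0 < (resolventTransform μ z).im := by
  rw [im_resolventTransform μ hz]
  exact mul_pos hz (sqResolvent_pos μ hz)

/-- Jensen's inequality for the square. Together with ξ · `sqResolvent` ≤ 1 it bounds ξ|m| by √ξ,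
the maximal displacement under subordination. -/
lemma norm_resolventTransform_sq_le (μ : Measure ℝ) [IsProbabilityMeasure μ] {z : ℂ}
    (hz : 0 < z.im) : ‖resolventTransform μ z‖ ^ 2 ≤ sqResolvent μ z := by
  have h1 : ‖resolventTransform μ z‖ ≤ ∫ x : ℝ, ‖((x : ℂ) - z)⁻¹‖ ∂μ := by
    rw [resolventTransform_eq]; exact norm_integral_le_integral_norm _
  have h2 := (ConvexOn.map_integral_le (μ := μ) (s := Set.univ) (g := fun x : ℝ => x ^ 2)
    (f := fun x : ℝ => ‖((x : ℂ) - z)⁻¹‖) (even_two.convexOn_pow)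
    (by fun_prop) isClosed_univ (by simp) (integrable_inv_ofReal_sub μ hz).norm
    (integrable_norm_inv_sq μ hz))
  calc _ ≤ (∫ x : ℝ, ‖((x : ℂ) - z)⁻¹‖ ∂μ) ^ 2 := by gcongr
    _ ≤ _ := h2

lemma differentiableAt_resolventTransform (μ : Measure ℝ) [IsFiniteMeasure μ] {z : ℂ}
    (hz : 0 < z.im) : DifferentiableAt ℂ (resolventTransform μ) z := by
  refine (hasDerivAt_resolventTransform z ?_).differentiableAt
  rintro ⟨x, -, rfl⟩
  simp at hz

lemma integrable_inv_mul_inv (μ : Measure ℝ) [IsFiniteMeasure μ] {z w : ℂ} (hz : 0 < z.im)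
    (hw : 0 < w.im) : Integrable (fun x : ℝ => ((x : ℂ) - z)⁻¹ * ((x : ℂ) - w)⁻¹) μ := by
  refine Integrable.of_bound ((continuous_inv_ofReal_sub hz).mul
    (continuous_inv_ofReal_sub hw)).aestronglyMeasurable ((z.im)⁻¹ * (w.im)⁻¹)
    (ae_of_all _ fun x => ?_)
  rw [norm_mul]
  gcongr
  · exact norm_inv_ofReal_sub_le hz x
  · exact norm_inv_ofReal_sub_le hw x

lemma resolventTransform_sub (μ : Measure ℝ) [IsFiniteMeasure μ] {z w : ℂ} (hz : 0 < z.im)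
    (hw : 0 < w.im) : resolventTransform μ z - resolventTransform μ w =
      (z - w) * ∫ x : ℝ, ((x : ℂ) - z)⁻¹ * ((x : ℂ) - w)⁻¹ ∂μ := by
  rw [resolventTransform_eq, resolventTransform_eq,
    ← integral_sub (integrable_inv_ofReal_sub μ hz) (integrable_inv_ofReal_sub μ hw),
    ← integral_const_mul]
  refine integral_congr_ae (ae_of_all _ fun x => ?_)
  have h1 := ofReal_sub_ne_zero hz x
  have h2 := ofReal_sub_ne_zero hw x
  field_simp
  ring

/-- A point of the closed upper half-plane is at least as close to another such point as to its
mirror image. -/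
lemma norm_sub_le_norm_sub_conj {a b : ℂ} (ha : 0 ≤ a.im) (hb : 0 ≤ b.im) :
    ‖a - b‖ ≤ ‖a - (starRingEnd ℂ) b‖ := by
  rw [← sq_le_sq₀ (norm_nonneg _) (norm_nonneg _), ← Complex.normSq_eq_norm_sq,
    ← Complex.normSq_eq_norm_sq, Complex.normSq_apply, Complex.normSq_apply]
  simp
  nlinarith [mul_nonneg ha hb]

lemma re_mul_eq (a b : ℂ) : (a * b).re =
    (‖a‖ ^ 2 + ‖b‖ ^ 2 - ‖a - (starRingEnd ℂ) b‖ ^ 2) / 2 := by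
  rw [← Complex.normSq_eq_norm_sq, ← Complex.normSq_eq_norm_sq, ← Complex.normSq_eq_norm_sq,
    Complex.normSq_apply, Complex.normSq_apply, Complex.normSq_apply]
  simp
  ring

/-- The pointwise inequality behind the stability of the subordination function. -/
lemma re_inv_mul_inv_le {a b : ℂ} (ha : a ≠ 0) (hb : b ≠ 0)
    (hab : ‖a - b‖ ≤ ‖a - (starRingEnd ℂ) b‖) :
    (a⁻¹ * b⁻¹).re ≤
      (‖a⁻¹‖ ^ 2 + ‖b⁻¹‖ ^ 2 - ‖a - b‖ ^ 2 * (‖a⁻¹‖ ^ 2 * ‖b⁻¹‖ ^ 2)) / 2 := by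
  rw [re_mul_eq]
  have hb' : (starRingEnd ℂ) b ≠ 0 := by simpa using hb
  -- The subtracted square in `re_mul_eq` factors through |a - conj b|, which dominates |a - b| by
  -- hypothesis.
  have : a⁻¹ - (starRingEnd ℂ) b⁻¹ = -((a - (starRingEnd ℂ) b) * (a⁻¹ * (starRingEnd ℂ) b⁻¹)) := by
    rw [map_inv₀]; field_simp; ring
  rw [this, norm_neg, norm_mul, norm_mul, RCLike.norm_conj, mul_pow, mul_pow]
  have : ‖a - b‖ ^ 2 ≤ ‖a - (starRingEnd ℂ) b‖ ^ 2 := by gcongr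
  have := mul_le_mul_of_nonneg_right this (by positivity : 0 ≤ ‖a⁻¹‖ ^ 2 * ‖b⁻¹‖ ^ 2)
  linarith

lemma integrable_norm_sq_mul (μ : Measure ℝ) [IsFiniteMeasure μ] {z w : ℂ} (hz : 0 < z.im)
    (hw : 0 < w.im) :
    Integrable (fun x : ℝ => ‖((x : ℂ) - z)⁻¹‖ ^ 2 * ‖((x : ℂ) - w)⁻¹‖ ^ 2) μ := by
  refine Integrable.of_bound (((continuous_inv_ofReal_sub hz).norm.pow 2).mul
    ((continuous_inv_ofReal_sub hw).norm.pow 2)).aestronglyMeasurable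
    ((z.im)⁻¹ ^ 2 * (w.im)⁻¹ ^ 2) (ae_of_all _ fun x => ?_)
  rw [norm_mul, norm_pow, norm_pow, norm_norm, norm_norm]
  gcongr
  · exact norm_inv_ofReal_sub_le hz x
  · exact norm_inv_ofReal_sub_le hw x

/-- The inverse `w ↦ w - ξ m_μ(w)` of the subordination function. -/
noncomputable def subInv (μ : Measure ℝ) (ξ : ℝ) (w : ℂ) : ℂ := w - ξ * resolventTransform μ w

/-- The sign of the last factor describes the relevant domain: `subInv` lands in the upper
half-plane exactly where ξ · `sqResolvent` < 1. -/
lemma im_subInv (μ : Measure ℝ) [IsFiniteMeasure μ] (ξ : ℝ) {w : ℂ} (hw : 0 < w.im) :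
    (subInv μ ξ w).im = w.im * (1 - ξ * sqResolvent μ w) := by
  simp only [subInv, Complex.sub_im, Complex.im_ofReal_mul,
    im_resolventTransform μ hw]
  ring

/-- The divided difference of `subInv` is 1 - ξK, with K the integral of the product of the two
kernels. Cauchy–Schwarz alone gives only Re ξK ≤ 1; the pointwise deficit in `re_inv_mul_inv_le`
improves this by ξ|z-w|²J/2. The estimate does not degenerate near the real axis. -/
lemma subInv_stability (μ : Measure ℝ) [IsProbabilityMeasure μ] {ξ : ℝ} (hξ : 0 ≤ ξ) {z w : ℂ}
    (hz : 0 < z.im) (hw : 0 < w.im) (hz1 : ξ * sqResolvent μ z ≤ 1)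
    (hw1 : ξ * sqResolvent μ w ≤ 1) :
    ξ / 2 * ‖z - w‖ ^ 3 * ∫ x : ℝ, ‖((x : ℂ) - z)⁻¹‖ ^ 2 * ‖((x : ℂ) - w)⁻¹‖ ^ 2 ∂μ ≤
      ‖subInv μ ξ z - subInv μ ξ w‖ := by
  set J := ∫ x : ℝ, ‖((x : ℂ) - z)⁻¹‖ ^ 2 * ‖((x : ℂ) - w)⁻¹‖ ^ 2 ∂μ with hJ
  set K := ∫ x : ℝ, ((x : ℂ) - z)⁻¹ * ((x : ℂ) - w)⁻¹ ∂μ with hK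
  have h1 : subInv μ ξ z - subInv μ ξ w = (z - w) * (1 - ξ * K) := by
    have := resolventTransform_sub μ hz hw
    simp only [subInv]
    linear_combination (-(ξ : ℂ)) * this
  have h2 : K.re ≤ (sqResolvent μ z + sqResolvent μ w - ‖z - w‖ ^ 2 * J) / 2 := by
    have := integral_re (integrable_inv_mul_inv μ hz hw)
    simp only [RCLike.re_to_complex] at this
    rw [hK, ← this, sqResolvent, sqResolvent, hJ,
      ← integral_add (integrable_norm_inv_sq μ hz) (integrable_norm_inv_sq μ hw),
      ← integral_const_mul, ← integral_sub, ← integral_div]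
    · refine integral_mono (integrable_inv_mul_inv μ hz hw).re ?_ fun x => ?_
      · exact (((integrable_norm_inv_sq μ hz).add (integrable_norm_inv_sq μ hw)).sub
          ((integrable_norm_sq_mul μ hz hw).const_mul _)).div_const _
      · have e1 : ((x : ℂ) - z) - (x - w) = w - z := by ring
        have e2 : ((x : ℂ) - z) - (starRingEnd ℂ) (x - w) = (starRingEnd ℂ) w - z := by
          simp
        have := re_inv_mul_inv_le (ofReal_sub_ne_zero hz x) (ofReal_sub_ne_zero hw x) (by
          rw [e1, e2, norm_sub_rev, norm_sub_rev _ z]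
          exact norm_sub_le_norm_sub_conj hz.le hw.le)
        rw [e1, norm_sub_rev] at this
        exact this
    · exact (integrable_norm_inv_sq μ hz).add (integrable_norm_inv_sq μ hw)
    · exact (integrable_norm_sq_mul μ hz hw).const_mul _
  have h3 : ξ / 2 * ‖z - w‖ ^ 2 * J ≤ ‖1 - ξ * K‖ := by
    refine le_trans ?_ (Complex.re_le_norm _)
    simp only [Complex.sub_re, Complex.one_re, Complex.re_ofReal_mul]
    have := mul_le_mul_of_nonneg_left h2 hξ
    nlinarith
  rw [h1, norm_mul]
  calc _ = ‖z - w‖ * (ξ / 2 * ‖z - w‖ ^ 2 * J) := by ring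
    _ ≤ _ := by gcongr

/-- Bounds the factor J of `subInv_stability` below using only the half of the mass in [-T, T],
where |x - z| and |x - w| are at most T + r. Imaginary parts play no role. -/
lemma integral_norm_sq_mul_ge (μ : Measure ℝ) [IsProbabilityMeasure μ] {T r : ℝ}
    (hT : 1 / 2 ≤ μ.real (Icc (-T) T)) (hT0 : 0 < T) {z w : ℂ} (hz : 0 < z.im) (hw : 0 < w.im)
    (hzr : ‖z‖ ≤ r) (hwr : ‖w‖ ≤ r) :
    1 / 2 * ((T + r) ^ 4)⁻¹ ≤
      ∫ x : ℝ, ‖((x : ℂ) - z)⁻¹‖ ^ 2 * ‖((x : ℂ) - w)⁻¹‖ ^ 2 ∂μ := by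
  have hr : 0 ≤ r := (norm_nonneg _).trans hzr
  have key : ∀ x ∈ Icc (-T) T, ∀ u : ℂ, 0 < u.im → ‖u‖ ≤ r →
      (T + r)⁻¹ ≤ ‖((x : ℂ) - u)⁻¹‖ := by
    intro x hx u hu hur
    rw [norm_inv]
    have : ‖(x : ℂ) - u‖ ≤ T + r := by
      refine (norm_sub_le _ _).trans (add_le_add ?_ hur)
      rw [Complex.norm_real]
      exact abs_le.2 hx
    have h0 : 0 < ‖(x : ℂ) - u‖ := norm_pos_iff.2 (ofReal_sub_ne_zero hu x)
    gcongr
  calc _ ≤ μ.real (Icc (-T) T) * ((T + r) ^ 4)⁻¹ := by gcongr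
    _ = ∫ x in Icc (-T) T, ((T + r) ^ 4)⁻¹ ∂μ := by simp
    _ ≤ ∫ x in Icc (-T) T, ‖((x : ℂ) - z)⁻¹‖ ^ 2 * ‖((x : ℂ) - w)⁻¹‖ ^ 2 ∂μ := by
        refine setIntegral_mono_on (by simp) (integrable_norm_sq_mul μ hz hw).integrableOn
          measurableSet_Icc fun x hx => ?_
        have h1 := key x hx z hz hzr
        have h2 := key x hx w hw hwr
        calc ((T + r) ^ 4)⁻¹ = (T + r)⁻¹ ^ 2 * (T + r)⁻¹ ^ 2 := by
              rw [← inv_pow]; ring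
          _ ≤ _ := by gcongr
    _ ≤ _ := setIntegral_le_integral (integrable_norm_sq_mul μ hz hw)
        (ae_of_all _ fun x => by positivity)

lemma exists_half_le_real_Icc (μ : Measure ℝ) [IsProbabilityMeasure μ] :
    ∃ T : ℝ, 0 < T ∧ 1 / 2 ≤ μ.real (Icc (-T) T) := by
  have h1 : Tendsto (fun n : ℕ => μ (Icc (-(n : ℝ)) n)) atTop (𝓝 (μ univ)) := by
    have : (⋃ n : ℕ, Icc (-(n : ℝ)) n) = univ := by
      ext x
      obtain ⟨n, hn⟩ := exists_nat_ge |x|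
      simpa using ⟨n, by simpa using abs_le.1 hn⟩
    rw [← this]
    refine tendsto_measure_iUnion_atTop fun a b hab => ?_
    have : (a : ℝ) ≤ b := by exact_mod_cast hab
    exact Icc_subset_Icc (by linarith) this
  have h2 : Tendsto (fun n : ℕ => μ.real (Icc (-(n : ℝ)) n)) atTop (𝓝 1) := by
    have := (ENNReal.tendsto_toReal (measure_ne_top μ univ)).comp h1
    simpa [Measure.real, Function.comp_def] using this
  obtain ⟨n, hn, hn0⟩ := ((h2.eventually_const_le (by norm_num : (1 / 2 : ℝ) < 1)).and
    (eventually_gt_atTop 0)).exists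
  exact ⟨n, by exact_mod_cast hn0, hn⟩

end Stieltjes

/-! ### The subordination function: existence, uniqueness, Hölder continuity, holomorphy. -/

section Subordination

/-- The open upper half-plane. -/
def upper : Set ℂ := {z | 0 < z.im}

lemma isOpen_upper : IsOpen upper := isOpen_lt continuous_const Complex.continuous_im

lemma convex_upper : Convex ℝ upper := convex_halfSpace_im_gt 0

lemma differentiableOn_subInv (μ : Measure ℝ) [IsFiniteMeasure μ] (ξ : ℝ) :
    DifferentiableOn ℂ (subInv μ ξ) upper := fun _ hz =>
  (differentiableAt_id.sub
    ((differentiableAt_resolventTransform μ hz).const_mul _)).differentiableWithinAt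

lemma sqResolvent_le (μ : Measure ℝ) [IsProbabilityMeasure μ] {z : ℂ} (hz : 0 < z.im) :
    sqResolvent μ z ≤ (z.im)⁻¹ ^ 2 := by
  have : ∫ _ : ℝ, (z.im)⁻¹ ^ 2 ∂μ = (z.im)⁻¹ ^ 2 := by simp
  rw [← this]
  refine integral_mono (integrable_norm_inv_sq μ hz) (by simp) fun x => ?_
  have := norm_inv_ofReal_sub_le hz x
  dsimp only
  gcongr

lemma mul_sqResolvent_lt_one (μ : Measure ℝ) [IsFiniteMeasure μ] {ξ : ℝ} {w : ℂ}
    (hw : 0 < w.im) (h : 0 < (subInv μ ξ w).im) : ξ * sqResolvent μ w < 1 := by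
  rw [im_subInv μ ξ hw] at h
  have := (mul_pos_iff_of_pos_left hw).1 h
  linarith

lemma mul_norm_resolventTransform_le (μ : Measure ℝ) [IsProbabilityMeasure μ] {ξ : ℝ}
    (hξ : 0 < ξ) {w : ℂ} (hw : 0 < w.im) (h : ξ * sqResolvent μ w ≤ 1) :
    ξ * ‖resolventTransform μ w‖ ≤ √ξ := by
  apply Real.le_sqrt_of_sq_le
  have := norm_resolventTransform_sq_le μ hw
  have h2 : ξ * ‖resolventTransform μ w‖ ^ 2 ≤ 1 :=
    (mul_le_mul_of_nonneg_left this hξ.le).trans h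
  calc (ξ * ‖resolventTransform μ w‖) ^ 2 = ξ * (ξ * ‖resolventTransform μ w‖ ^ 2) := by ring
    _ ≤ ξ * 1 := by gcongr
    _ = ξ := mul_one _

lemma im_subInv_ge (μ : Measure ℝ) [IsProbabilityMeasure μ] {ξ : ℝ} (hξ : 0 ≤ ξ) {y : ℝ}
    (hy : 0 < y) : y - ξ / y ≤ (subInv μ ξ (y * Complex.I)).im := by
  have hy' : 0 < ((y : ℂ) * Complex.I).im := by simpa
  rw [im_subInv μ ξ hy']
  have h := sqResolvent_le μ hy'
  simp only [Complex.mul_im, Complex.ofReal_re, Complex.I_im, mul_one, Complex.ofReal_im,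
    Complex.I_re, mul_zero, add_zero] at h ⊢
  have := mul_le_mul_of_nonneg_left h (mul_nonneg hy.le hξ)
  have e : y * ξ * y⁻¹ ^ 2 = ξ / y := by field_simp
  rw [e] at this
  linarith

/-- A connectedness argument: the part of the image inside the half-plane is nonempty, open by the
open mapping theorem, and relatively closed because preimages stay within √ξ of their images. -/
lemma upper_subset_image_subInv (μ : Measure ℝ) [IsProbabilityMeasure μ] {ξ : ℝ} (hξ : 0 < ξ) :
    upper ⊆ subInv μ ξ '' upper := by
  -- Unboundedness of Im `subInv` along the imaginary axis gives a point of the image and rules out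
  -- the constant case of the open mapping theorem.
  have hbig : ∀ C : ℝ, ∃ w ∈ upper, C < (subInv μ ξ w).im := by
    intro C
    have hp : 0 < |C| + ξ + 1 := by positivity
    refine ⟨((|C| + ξ + 1 : ℝ) : ℂ) * Complex.I, by simpa [upper] using hp, ?_⟩
    refine lt_of_lt_of_le ?_ (im_subInv_ge μ hξ.le hp)
    have : ξ / (|C| + ξ + 1) ≤ ξ := by
      refine div_le_self hξ.le ?_
      linarith [abs_nonneg C]
    linarith [le_abs_self C]
  refine (convex_upper.isPreconnected.subset_of_closure_inter_subset
    (u := upper ∩ subInv μ ξ '' upper) ?_ ?_ ?_).trans inter_subset_right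
  · refine isOpen_upper.inter ?_
    have han : AnalyticOnNhd ℂ (subInv μ ξ) upper :=
      (differentiableOn_subInv μ ξ).analyticOnNhd isOpen_upper
    rcases han.is_constant_or_isOpen convex_upper.isPreconnected with ⟨c, hc⟩ | h
    · obtain ⟨w, hw, hw2⟩ := hbig c.im
      rw [hc w hw] at hw2
      exact absurd hw2 (lt_irrefl _)
    · exact h upper subset_rfl isOpen_upper
  · obtain ⟨w, hw, hw2⟩ := hbig 0
    exact ⟨_, hw2, hw2, w, hw, rfl⟩
  · rintro z ⟨hz, hzu⟩
    refine ⟨hzu, ?_⟩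
    obtain ⟨u, hu, hlim⟩ := mem_closure_iff_seq_limit.1 hz
    choose hu1 w hw hwu using hu
    have hq : ∀ n, ξ * sqResolvent μ (w n) < 1 := fun n =>
      mul_sqResolvent_lt_one μ (hw n) (by rw [hwu n]; exact hu1 n)
    have hdist : ∀ n, ‖w n - u n‖ ≤ √ξ := by
      intro n
      have := mul_norm_resolventTransform_le μ hξ (hw n) (hq n).le
      rw [← hwu n, subInv, sub_sub_cancel, norm_mul, Complex.norm_real, Real.norm_of_nonneg hξ.le]
      exact this
    -- The preimages lie higher than their images, so their limit cannot fall on the real axis.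
    have him : ∀ n, (u n).im ≤ (w n).im := by
      intro n
      rw [← hwu n, im_subInv μ ξ (hw n)]
      have h1 : 0 ≤ ξ * sqResolvent μ (w n) := mul_nonneg hξ.le (sqResolvent_nonneg _ _)
      have h2 : 0 < (w n).im := hw n
      nlinarith
    have hbd : Bornology.IsBounded (range w) := by
      obtain ⟨C, hC⟩ := isBounded_iff_forall_norm_le.1 (Metric.isBounded_range_of_tendsto u hlim)
      refine isBounded_iff_forall_norm_le.2 ⟨C + √ξ, ?_⟩
      rintro _ ⟨n, rfl⟩
      calc ‖w n‖ = ‖u n + (w n - u n)‖ := by ring_nf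
        _ ≤ _ := (norm_add_le _ _).trans (add_le_add (hC _ ⟨n, rfl⟩) (hdist n))
    obtain ⟨a, -, φ, hφ, ha⟩ := tendsto_subseq_of_bounded hbd (fun n => mem_range_self n)
    have hua : Tendsto (fun n => u (φ n)) atTop (𝓝 z) := hlim.comp hφ.tendsto_atTop
    have hau : a ∈ upper := by
      have h1 := (Complex.continuous_im.tendsto z).comp hua
      have h2 := (Complex.continuous_im.tendsto a).comp ha
      have : z.im ≤ a.im := le_of_tendsto_of_tendsto' h1 h2 fun n => him (φ n)
      exact lt_of_lt_of_le hzu this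
    refine ⟨a, hau, ?_⟩
    have hc : ContinuousAt (subInv μ ξ) a :=
      ((differentiableOn_subInv μ ξ).differentiableAt (isOpen_upper.mem_nhds hau)).continuousAt
    refine tendsto_nhds_unique (hc.tendsto.comp ha) ?_
    refine hua.congr fun n => ?_
    simp [hwu]

open Classical in
/-- The subordination function `ω(z) = z + ξ m(z)` of the free convolution with a semicircle. -/
noncomputable def subord (μ : Measure ℝ) (ξ : ℝ) (z : ℂ) : ℂ :=
  if h : ∃ w ∈ upper, subInv μ ξ w = z then h.choose else 0

/-- The Stieltjes transform of the free convolution with a semicircle. -/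
noncomputable def freeResolvent (μ : Measure ℝ) (ξ : ℝ) (z : ℂ) : ℂ :=
  resolventTransform μ (subord μ ξ z)

variable (μ : Measure ℝ) [IsProbabilityMeasure μ] {ξ : ℝ} {z : ℂ}

lemma subord_spec (hξ : 0 < ξ) (hz : 0 < z.im) :
    subord μ ξ z ∈ upper ∧ subInv μ ξ (subord μ ξ z) = z := by
  have h : ∃ w ∈ upper, subInv μ ξ w = z := upper_subset_image_subInv μ hξ hz
  rw [subord, dif_pos h]
  exact h.choose_spec

lemma im_subord_pos (hξ : 0 < ξ) (hz : 0 < z.im) : 0 < (subord μ ξ z).im :=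
  (subord_spec μ hξ hz).1

lemma subord_eq (hξ : 0 < ξ) (hz : 0 < z.im) :
    subord μ ξ z = z + ξ * freeResolvent μ ξ z := by
  have h := (subord_spec μ hξ hz).2
  rw [subInv, ← freeResolvent] at h
  linear_combination h

lemma mul_sqResolvent_subord_lt (hξ : 0 < ξ) (hz : 0 < z.im) :
    ξ * sqResolvent μ (subord μ ξ z) < 1 :=
  mul_sqResolvent_lt_one μ (im_subord_pos μ hξ hz) (by rw [(subord_spec μ hξ hz).2]; exact hz)

lemma mul_norm_freeResolvent_le (hξ : 0 < ξ) (hz : 0 < z.im) :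
    ξ * ‖freeResolvent μ ξ z‖ ≤ √ξ :=
  mul_norm_resolventTransform_le μ hξ (im_subord_pos μ hξ hz)
    (mul_sqResolvent_subord_lt μ hξ hz).le

lemma norm_freeResolvent_le (hξ : 0 < ξ) (hz : 0 < z.im) :
    ‖freeResolvent μ ξ z‖ ≤ (√ξ)⁻¹ := by
  have h := mul_norm_freeResolvent_le μ hξ hz
  have hs : 0 < √ξ := Real.sqrt_pos.2 hξ
  rw [← mul_le_mul_iff_right₀ hs, mul_inv_cancel₀ hs.ne', ← mul_le_mul_iff_right₀ hs]
  calc _ = ξ * ‖freeResolvent μ ξ z‖ := by rw [← mul_assoc, Real.mul_self_sqrt hξ.le]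
    _ ≤ _ := by rwa [mul_one]

lemma im_freeResolvent_pos (hξ : 0 < ξ) (hz : 0 < z.im) : 0 < (freeResolvent μ ξ z).im :=
  im_resolventTransform_pos μ (im_subord_pos μ hξ hz)

lemma norm_subord_sub_le (hξ : 0 < ξ) (hz : 0 < z.im) : ‖subord μ ξ z - z‖ ≤ √ξ := by
  rw [subord_eq μ hξ hz, add_sub_cancel_left, norm_mul, Complex.norm_real,
    Real.norm_of_nonneg hξ.le]
  exact mul_norm_freeResolvent_le μ hξ hz

lemma norm_subord_le (hξ : 0 < ξ) (hz : 0 < z.im) : ‖subord μ ξ z‖ ≤ ‖z‖ + √ξ := by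
  have := norm_subord_sub_le μ hξ hz
  have h2 := norm_add_le z (subord μ ξ z - z)
  rw [add_sub_cancel] at h2
  linarith

lemma im_le_im_subord (hξ : 0 < ξ) (hz : 0 < z.im) : z.im ≤ (subord μ ξ z).im := by
  rw [subord_eq μ hξ hz, Complex.add_im, Complex.im_ofReal_mul]
  have := mul_pos hξ (im_freeResolvent_pos μ hξ hz)
  linarith

/-- Joint stability of the subordination function in the point and in the variance. -/
lemma subord_stability {T r ξ' : ℝ} (hT : 1 / 2 ≤ μ.real (Icc (-T) T)) (hT0 : 0 < T)
    (hξ : 0 < ξ) (hξ' : ξ ≤ ξ') {z' : ℂ} (hz : 0 < z.im) (hz' : 0 < z'.im)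
    (hzr : ‖z‖ + √ξ' ≤ r) (hzr' : ‖z'‖ + √ξ' ≤ r) :
    ‖subord μ ξ z - subord μ ξ' z'‖ ^ 3 ≤
      4 * (T + r) ^ 4 / ξ * (‖z - z'‖ + (ξ' - ξ) * (√ξ')⁻¹) := by
  have h0 : 0 < ξ' := hξ.trans_le hξ'
  have hr : 0 ≤ r := le_trans (by positivity) hzr
  have hw := im_subord_pos μ hξ hz
  have hw' := im_subord_pos μ h0 hz'
  have hq := mul_sqResolvent_subord_lt μ hξ hz
  -- Since ξ ≤ ξ', the point belonging to ξ' also satisfies the constraint for ξ, and both points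
  -- can be compared through the single map `subInv μ ξ`. The price is the term in ξ' - ξ below.
  have hq' : ξ * sqResolvent μ (subord μ ξ' z') ≤ 1 :=
    (mul_le_mul_of_nonneg_right hξ' (sqResolvent_nonneg _ _)).trans
      (mul_sqResolvent_subord_lt μ h0 hz').le
  have h1 := subInv_stability μ hξ.le hw hw' hq.le hq'
  have h2 := integral_norm_sq_mul_ge μ hT hT0 hw hw' (r := r)
    ((norm_subord_le μ hξ hz).trans (le_trans (by gcongr) hzr))
    ((norm_subord_le μ h0 hz').trans hzr')
  have e : subInv μ ξ (subord μ ξ z) - subInv μ ξ (subord μ ξ' z') =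
      (z - z') - ((ξ' - ξ : ℝ) : ℂ) * freeResolvent μ ξ' z' := by
    rw [(subord_spec μ hξ hz).2, subInv]
    have := subord_eq μ h0 hz'
    rw [← freeResolvent, this]
    push_cast
    ring
  have h3 : ‖subInv μ ξ (subord μ ξ z) - subInv μ ξ (subord μ ξ' z')‖ ≤
      ‖z - z'‖ + (ξ' - ξ) * (√ξ')⁻¹ := by
    rw [e]
    refine (norm_sub_le _ _).trans ?_
    rw [norm_mul, Complex.norm_real, Real.norm_of_nonneg (by linarith)]
    have := norm_freeResolvent_le μ h0 hz'
    gcongr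
  have h4 : ξ / 2 * ‖subord μ ξ z - subord μ ξ' z'‖ ^ 3 * (1 / 2 * ((T + r) ^ 4)⁻¹) ≤
      ‖z - z'‖ + (ξ' - ξ) * (√ξ')⁻¹ := by
    refine le_trans ?_ (h1.trans h3)
    gcongr
  have hTr : 0 < T + r := by linarith
  calc ‖subord μ ξ z - subord μ ξ' z'‖ ^ 3 = 4 * (T + r) ^ 4 / ξ *
        (ξ / 2 * ‖subord μ ξ z - subord μ ξ' z'‖ ^ 3 * (1 / 2 * ((T + r) ^ 4)⁻¹)) := by
        field_simp
        norm_num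
    _ ≤ _ := by gcongr

/-- Two preimages of the same point have stability bound zero on the right, while the factor J is
positive. -/
lemma eq_subord (hξ : 0 < ξ) (hz : 0 < z.im) {w : ℂ} (hw : 0 < w.im)
    (h : subInv μ ξ w = z) : w = subord μ ξ z := by
  obtain ⟨T, hT0, hT⟩ := exists_half_le_real_Icc μ
  have hw' := im_subord_pos μ hξ hz
  have h1 := subInv_stability μ hξ.le hw hw'
    (mul_sqResolvent_lt_one μ hw (by rw [h]; exact hz)).le (mul_sqResolvent_subord_lt μ hξ hz).le
  have h2 := integral_norm_sq_mul_ge μ hT hT0 hw hw' (r := max ‖w‖ ‖subord μ ξ z‖)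
    (le_max_left _ _) (le_max_right _ _)
  rw [h, (subord_spec μ hξ hz).2, sub_self, norm_zero] at h1
  have hp : 0 < 1 / 2 * ((T + max ‖w‖ ‖subord μ ξ z‖) ^ 4)⁻¹ := by positivity
  have hJ := hp.trans_le h2
  by_contra hne
  have : 0 < ‖w - subord μ ξ z‖ := norm_pos_iff.2 (sub_ne_zero.2 hne)
  have := mul_pos (mul_pos (half_pos hξ) (pow_pos this 3)) hJ
  linarith

/-- The fixed-point equation says that z + ξ m_ρ(z) is a preimage of z under `subInv`, and that
preimage is unique. -/
lemma IsFreeSemicircleConv.resolventTransform_eq {μ ρ : Measure ℝ} [IsProbabilityMeasure μ]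
    (h : IsFreeSemicircleConv μ ξ ρ) (hξ : 0 < ξ) (hz : 0 < z.im) :
    resolventTransform ρ z = freeResolvent μ ξ z := by
  have := h.1
  have hpos := im_resolventTransform_pos ρ hz
  have hz2 : 0 < (z + ξ * resolventTransform ρ z).im := by
    rw [Complex.add_im, Complex.im_ofReal_mul]
    have := mul_pos hξ hpos
    linarith
  have := eq_subord μ hξ hz hz2 (by rw [subInv, ← h.2 z hz]; ring)
  rw [h.2 z hz, this, freeResolvent]

/-- A modulus of continuity at a point of the closed half-plane. -/
lemma exists_subord_modulus (hξ : 0 < ξ) (z₀ : ℂ) : ∃ C : ℝ, 0 < C ∧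
    ∀ z z' : ℂ, 0 < z.im → 0 < z'.im → ‖z - z₀‖ < 1 → ‖z' - z₀‖ < 1 →
      ‖subord μ ξ z - subord μ ξ z'‖ ^ 3 ≤ C * ‖z - z'‖ := by
  obtain ⟨T, hT0, hT⟩ := exists_half_le_real_Icc μ
  refine ⟨4 * (T + (‖z₀‖ + 1 + √ξ)) ^ 4 / ξ, by positivity, fun z z' hz hz' h h' => ?_⟩
  have key : ∀ u : ℂ, ‖u - z₀‖ < 1 → ‖u‖ ≤ ‖z₀‖ + 1 := by
    intro u hu
    have := norm_add_le z₀ (u - z₀)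
    rw [add_sub_cancel] at this
    linarith
  have := subord_stability μ hT hT0 hξ le_rfl hz hz' (r := ‖z₀‖ + 1 + √ξ)
    (by gcongr; exact key z h) (by gcongr; exact key z' h')
  simpa using this

/-- The cubic modulus is uniform up to the real axis, so the image filter is Cauchy also at boundary
points; this is the source of every boundary value below. -/
lemma cauchy_map_subord (hξ : 0 < ξ) {z₀ : ℂ} (hz₀ : z₀ ∈ closure upper) :
    ∃ w, Tendsto (subord μ ξ) (𝓝[upper] z₀) (𝓝 w) := by
  have := mem_closure_iff_nhdsWithin_neBot.1 hz₀
  rw [← cauchy_map_iff_exists_tendsto, Metric.cauchy_iff]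
  refine ⟨inferInstance, fun ε hε => ?_⟩
  obtain ⟨C, hC, h⟩ := exists_subord_modulus μ hξ z₀
  set δ := min 1 (ε ^ 3 / (4 * C)) with hδ
  have hδ0 : 0 < δ := by positivity
  refine ⟨subord μ ξ '' (upper ∩ Metric.ball z₀ δ), image_mem_map
    (inter_mem self_mem_nhdsWithin (mem_nhdsWithin_of_mem_nhds (Metric.ball_mem_nhds _ hδ0))), ?_⟩
  rintro _ ⟨z, ⟨hz, hz1⟩, rfl⟩ _ ⟨z', ⟨hz', hz1'⟩, rfl⟩
  rw [Metric.mem_ball, dist_eq_norm] at hz1 hz1'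
  have h1 := h z z' hz hz' (hz1.trans_le (min_le_left _ _)) (hz1'.trans_le (min_le_left _ _))
  have h2 : ‖z - z'‖ < 2 * δ := by
    calc ‖z - z'‖ = ‖(z - z₀) - (z' - z₀)‖ := by ring_nf
      _ ≤ _ := norm_sub_le _ _
      _ < _ := by linarith
  rw [dist_eq_norm]
  have h3 : δ ≤ ε ^ 3 / (4 * C) := min_le_right _ _
  refine lt_of_pow_lt_pow_left₀ 3 hε.le ?_
  calc _ ≤ C * ‖z - z'‖ := h1
    _ < C * (2 * δ) := by gcongr
    _ ≤ C * (2 * (ε ^ 3 / (4 * C))) := by gcongr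
    _ = ε ^ 3 / 2 := by field_simp; norm_num
    _ < ε ^ 3 := by have : 0 < ε ^ 3 := by positivity
                    linarith

lemma continuousAt_subord (hξ : 0 < ξ) (hz : 0 < z.im) : ContinuousAt (subord μ ξ) z := by
  obtain ⟨w, hw⟩ := cauchy_map_subord μ hξ (subset_closure (show z ∈ upper from hz))
  rw [(isOpen_upper.nhdsWithin_eq (show z ∈ upper from hz))] at hw
  exact continuousAt_of_tendsto_nhds hw

/-- Inverse function theorem: the derivative 1 - ξ∫(x-w)⁻² dμ does not vanish, because the integral
has norm at most `sqResolvent` and ξ · `sqResolvent` < 1 at w = `subord μ ξ z`. -/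
lemma hasDerivAt_subord (hξ : 0 < ξ) (hz : 0 < z.im) :
    ∃ d, HasDerivAt (subord μ ξ) d z := by
  have hw := im_subord_pos μ hξ hz
  set w := subord μ ξ z with hwdef
  have hd : HasDerivAt (resolventTransform μ) (∫ x : ℝ, resolvent w x ^ 2 ∂μ) w := by
    refine hasDerivAt_resolventTransform w ?_
    rintro ⟨x, -, h⟩
    rw [← h] at hw
    simp at hw
  have hH : HasDerivAt (subInv μ ξ) (1 - ξ * ∫ x : ℝ, resolvent w x ^ 2 ∂μ) w :=
    (hasDerivAt_id w).sub (hd.const_mul _)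
  have hle : ‖∫ x : ℝ, resolvent w x ^ 2 ∂μ‖ ≤ sqResolvent μ w := by
    refine (norm_integral_le_integral_norm _).trans (le_of_eq ?_)
    simp [sqResolvent, resolvent]
  refine ⟨_, HasDerivAt.of_local_left_inverse (continuousAt_subord μ hξ hz) hH ?_ ?_⟩
  · intro h0
    have h1 : (ξ : ℂ) * ∫ x : ℝ, resolvent w x ^ 2 ∂μ = 1 := (sub_eq_zero.1 h0).symm
    have h2 := congrArg norm h1
    rw [norm_mul, Complex.norm_real, Real.norm_of_nonneg hξ.le, norm_one] at h2
    have h3 := mul_sqResolvent_subord_lt μ hξ hz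
    have := mul_le_mul_of_nonneg_left hle hξ.le
    rw [← hwdef] at h3
    linarith
  · filter_upwards [isOpen_upper.mem_nhds (show z ∈ upper from hz)] with u hu
    exact (subord_spec μ hξ hu).2

lemma differentiableAt_freeResolvent (hξ : 0 < ξ) (hz : 0 < z.im) :
    DifferentiableAt ℂ (freeResolvent μ ξ) z := by
  obtain ⟨d, hd⟩ := hasDerivAt_subord μ hξ hz
  exact (differentiableAt_resolventTransform μ (im_subord_pos μ hξ hz)).comp z
    hd.differentiableAt

end Subordination

/-! ### The Poisson formula on the half-plane. -/

section Poisson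

lemma norm_inv_ofReal_sub_sq (z : ℂ) (t : ℝ) :
    ‖((t : ℂ) - z)⁻¹‖ ^ 2 = ((t - z.re) ^ 2 + z.im ^ 2)⁻¹ := by
  rw [norm_inv, inv_pow, ← Complex.normSq_eq_norm_sq, Complex.normSq_apply]
  simp
  ring

lemma norm_inv_ofReal_sub_sq' {z : ℂ} (hz : 0 < z.im) (t : ℝ) :
    ‖((t : ℂ) - z)⁻¹‖ ^ 2 = (z.im)⁻¹ ^ 2 * (1 + ((t - z.re) * (z.im)⁻¹) ^ 2)⁻¹ := by
  rw [norm_inv_ofReal_sub_sq, inv_pow, ← mul_inv]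
  congr 1
  field_simp
  ring

lemma integrable_norm_inv_sq_volume {z : ℂ} (hz : 0 < z.im) :
    Integrable fun t : ℝ => ‖((t : ℂ) - z)⁻¹‖ ^ 2 := by
  simp_rw [norm_inv_ofReal_sub_sq' hz]
  exact (((integrable_inv_one_add_sq.comp_mul_right' (inv_ne_zero hz.ne')).comp_sub_right
    z.re)).const_mul _

lemma integral_norm_inv_sq_volume {z : ℂ} (hz : 0 < z.im) :
    ∫ t : ℝ, ‖((t : ℂ) - z)⁻¹‖ ^ 2 = Real.pi / z.im := by
  simp_rw [norm_inv_ofReal_sub_sq' hz]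
  rw [integral_const_mul,
    integral_sub_right_eq_self (fun t : ℝ => (1 + (t * (z.im)⁻¹) ^ 2)⁻¹) z.re,
    Measure.integral_comp_mul_right (fun t : ℝ => (1 + t ^ 2)⁻¹), integral_univ_inv_one_add_sq]
  rw [inv_inv, abs_of_pos hz, smul_eq_mul]
  field_simp

/-- The Poisson formula for bounded holomorphic functions on the upper half-plane. -/
theorem poisson_upper {f : ℂ → ℂ} (hc : ContinuousOn f {z | 0 ≤ z.im})
    (hd : ∀ z : ℂ, 0 < z.im → DifferentiableAt ℂ f z) {K : ℝ}
    (hK : ∀ z : ℂ, 0 ≤ z.im → ‖f z‖ ≤ K) {z : ℂ} (hz : 0 < z.im) :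
    f z = ((z.im / Real.pi : ℝ) : ℂ) *
      ∫ t : ℝ, ((‖((t : ℂ) - z)⁻¹‖ ^ 2 : ℝ) : ℂ) * f t := by
  set zc := (starRingEnd ℂ) z with hzc
  have hK0 : 0 ≤ K := (norm_nonneg _).trans (hK z hz.le)
  -- This function is holomorphic at z as well, decays like ζ⁻², and on the real line equals the
  -- Poisson kernel times f t - f z. Its integral over ℝ therefore vanishes by Cauchy's theorem.
  set g : ℂ → ℂ := fun ζ => dslope f z ζ * (ζ - zc)⁻¹ with hg
  have hne : ∀ ζ : ℂ, 0 ≤ ζ.im → ζ - zc ≠ 0 := by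
    intro ζ hζ h
    have := congrArg Complex.im h
    simp [hzc] at this
    linarith
  have hnhds : {z : ℂ | 0 ≤ z.im} ∈ 𝓝 z :=
    mem_of_superset (isOpen_upper.mem_nhds hz) fun w hw => le_of_lt (show 0 < w.im from hw)
  have hgc : ContinuousOn g {z | 0 ≤ z.im} := by
    refine ((continuousOn_dslope hnhds).2 ⟨hc, hd z hz⟩).mul ?_
    exact ContinuousOn.inv₀ (by fun_prop) fun ζ hζ => hne ζ hζ
  have hgd : DifferentiableOn ℂ g upper := by
    refine DifferentiableOn.mul ?_ ?_
    · refine (Complex.differentiableOn_dslope (isOpen_upper.mem_nhds hz)).2 fun w hw =>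
        (hd w hw).differentiableWithinAt
    · exact DifferentiableOn.inv (by fun_prop) fun ζ hζ => hne ζ (le_of_lt hζ)
  have hgt : ∀ t : ℝ, g t = ((‖((t : ℂ) - z)⁻¹‖ ^ 2 : ℝ) : ℂ) * (f t - f z) := by
    intro t
    have h1 := ofReal_sub_ne_zero hz t
    have h2 : ((t : ℂ) - zc) = (starRingEnd ℂ) ((t : ℂ) - z) := by simp [hzc]
    rw [hg]
    dsimp only
    rw [dslope_of_ne _ (sub_ne_zero.1 h1), slope_def_field, h2, norm_inv, inv_pow,
      ← Complex.normSq_eq_norm_sq, Complex.ofReal_inv, ← Complex.mul_conj]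
    rw [mul_inv]
    ring
  have hgbound : ∀ ζ : ℂ, 0 ≤ ζ.im → ∀ R : ℝ, 2 * ‖z‖ + 1 ≤ R → R ≤ ‖ζ‖ →
      ‖g ζ‖ ≤ 8 * K / R ^ 2 := by
    intro ζ hζ R hR hRζ
    have hR0 : 0 < R := lt_of_lt_of_le (by positivity) hR
    have h1 : R / 2 ≤ ‖ζ - z‖ := by
      have := norm_sub_norm_le ζ z
      linarith
    have h2 : R / 2 ≤ ‖ζ - zc‖ := by
      have := norm_sub_norm_le ζ zc
      rw [hzc, RCLike.norm_conj] at this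
      rw [hzc]
      linarith
    have h3 : ζ ≠ z := by
      rintro rfl
      simp at h1
      linarith
    rw [hg]
    dsimp only
    rw [dslope_of_ne _ h3, slope_def_field, norm_mul, norm_div, norm_inv]
    have h4 : ‖f ζ - f z‖ ≤ 2 * K := by
      refine (norm_sub_le _ _).trans ?_
      linarith [hK ζ hζ, hK z hz.le]
    calc _ ≤ 2 * K / (R / 2) * (R / 2)⁻¹ := by gcongr
      _ = _ := by field_simp; ring
  have hgint : Integrable fun t : ℝ => g t := by
    have hcont : Continuous fun t : ℝ => g t :=
      hgc.comp_continuous Complex.continuous_ofReal fun t => by simp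
    refine ((integrable_norm_inv_sq_volume hz).mul_const (2 * K)).mono'
      hcont.aestronglyMeasurable (ae_of_all _ fun t => ?_)
    rw [hgt, norm_mul, Complex.norm_real, Real.norm_of_nonneg (by positivity)]
    gcongr
    refine (norm_sub_le _ _).trans ?_
    linarith [hK t (by simp), hK z hz.le]
  have hlim : Tendsto (fun R : ℝ => ∫ t in (-R)..R, g (t : ℂ)) atTop (𝓝 (∫ t : ℝ, g t)) :=
    intervalIntegral_tendsto_integral hgint tendsto_neg_atTop_atBot tendsto_id
  have hzero : Tendsto (fun R : ℝ => ∫ t in (-R)..R, g (t : ℂ)) atTop (𝓝 0) := by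
    have hb : Tendsto (fun R : ℝ => 32 * K / R) atTop (𝓝 0) :=
      tendsto_const_nhds.div_atTop tendsto_id
    refine squeeze_zero_norm' ?_ hb
    filter_upwards [eventually_ge_atTop (2 * ‖z‖ + 1)] with R hR
    have hR0 : 0 < R := lt_of_lt_of_le (by positivity) hR
    -- Cauchy on the rectangle [-R, R] × [0, R]; the three upper sides have total length 4R and
    -- carry a function of size 8K/R².
    have hrect := Complex.integral_boundary_rect_eq_zero_of_continuousOn_of_differentiableOn g
      (-R : ℝ) ((R : ℝ) + (R : ℝ) * Complex.I) (by
        refine hgc.mono fun ζ hζ => ?_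
        have := hζ.2
        simp only [Complex.ofReal_im, Complex.add_im, Complex.mul_im, Complex.ofReal_re,
          Complex.I_im, mul_one, Complex.I_re, mul_zero, add_zero, zero_add, uIcc_of_le hR0.le]
          at this
        exact this.1) (by
        refine hgd.mono fun ζ hζ => ?_
        have := hζ.2
        simp only [Complex.ofReal_im, Complex.add_im, Complex.mul_im, Complex.ofReal_re,
          Complex.I_im, mul_one, Complex.I_re, mul_zero, add_zero, zero_add,
          min_eq_left hR0.le] at this
        exact this.1)
    simp only [Complex.ofReal_im, Complex.add_im, Complex.mul_im, Complex.ofReal_re,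
      Complex.I_im, mul_one, Complex.I_re, mul_zero, add_zero, zero_add, Complex.ofReal_zero,
      zero_mul, Complex.add_re, Complex.mul_re, sub_zero, smul_eq_mul] at hrect
    have e1 : ‖∫ x in (-R)..R, g (x + R * Complex.I)‖ ≤ 8 * K / R ^ 2 * |R - -R| := by
      refine intervalIntegral.norm_integral_le_of_norm_le_const fun x _ => ?_
      refine hgbound _ (by simp [hR0.le]) R hR ?_
      have := Complex.abs_im_le_norm ((x : ℂ) + R * Complex.I)
      simp only [Complex.add_im, Complex.ofReal_im, Complex.mul_im, Complex.ofReal_re,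
        Complex.I_im, mul_one, Complex.I_re, mul_zero, add_zero, zero_add] at this
      exact (le_abs_self R).trans this
    have e2 : ∀ a : ℝ, |a| = R → ‖∫ y in (0 : ℝ)..R, g ((a : ℂ) + y * Complex.I)‖ ≤
        8 * K / R ^ 2 * |R - 0| := by
      intro a ha
      refine intervalIntegral.norm_integral_le_of_norm_le_const fun y hy => ?_
      rw [uIoc_of_le hR0.le] at hy
      refine hgbound _ (by simp [hy.1.le]) R hR ?_
      have := Complex.abs_re_le_norm ((a : ℂ) + y * Complex.I)
      simp only [Complex.add_re, Complex.ofReal_re, Complex.mul_re, Complex.ofReal_im,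
        Complex.I_im, mul_one, Complex.I_re, mul_zero, sub_zero, add_zero] at this
      rwa [ha] at this
    have e3 := e2 R (abs_of_pos hR0)
    have e4 := e2 (-R) (by rw [abs_neg, abs_of_pos hR0])
    have e5 : ∫ t in (-R)..R, g (t : ℂ) = (∫ x in (-R)..R, g (x + R * Complex.I))
        - Complex.I * (∫ y in (0 : ℝ)..R, g ((R : ℂ) + y * Complex.I))
        + Complex.I * ∫ y in (0 : ℝ)..R, g (((-R : ℝ) : ℂ) + y * Complex.I) := by
      linear_combination hrect
    rw [e5]
    refine (norm_add_le _ _).trans ((add_le_add_left (norm_sub_le _ _) _).trans ?_)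
    rw [norm_mul, norm_mul, Complex.norm_I, one_mul, one_mul]
    rw [sub_neg_eq_add, abs_of_pos (by linarith)] at e1
    rw [sub_zero, abs_of_pos hR0] at e3 e4
    calc _ ≤ 8 * K / R ^ 2 * (R + R) + 8 * K / R ^ 2 * R + 8 * K / R ^ 2 * R := by gcongr
      _ = 32 * K / R := by field_simp; ring
  have h0 : ∫ t : ℝ, g t = 0 := tendsto_nhds_unique hlim hzero
  simp_rw [hgt, mul_sub] at h0
  have hfint : Integrable fun t : ℝ => ((‖((t : ℂ) - z)⁻¹‖ ^ 2 : ℝ) : ℂ) * f t := by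
    have hcont : Continuous fun t : ℝ => f t :=
      hc.comp_continuous Complex.continuous_ofReal fun t => by simp
    refine ((integrable_norm_inv_sq_volume hz).mul_const K).mono'
      ((Complex.continuous_ofReal.comp ((continuous_inv_ofReal_sub hz).norm.pow 2)).mul
        hcont).aestronglyMeasurable (ae_of_all _ fun t => ?_)
    rw [norm_mul, Complex.norm_real, Real.norm_of_nonneg (by positivity)]
    gcongr
    exact hK t (by simp)
  have hfint' : Integrable fun t : ℝ => ((‖((t : ℂ) - z)⁻¹‖ ^ 2 : ℝ) : ℂ) * f z :=
    (integrable_norm_inv_sq_volume hz).ofReal.mul_const _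
  rw [integral_sub hfint hfint',
    integral_mul_const, show ∫ t : ℝ, ((‖((t : ℂ) - z)⁻¹‖ ^ 2 : ℝ) : ℂ) = ((Real.pi / z.im : ℝ) : ℂ)
      by rw [← integral_norm_inv_sq_volume hz]; exact integral_ofReal, sub_eq_zero] at h0
  rw [h0, ← mul_assoc, ← Complex.ofReal_mul]
  have hpi := Real.pi_ne_zero
  rw [show z.im / Real.pi * (Real.pi / z.im) = 1 by field_simp]
  simp

end Poisson

/-! ### Boundary values and construction of the free convolution through its density. -/

section Boundary

/-- The Stieltjes transform of the free convolution, extended to the closed half-plane. -/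
noncomputable def resolventExt (μ : Measure ℝ) (ξ : ℝ) : ℂ → ℂ := extendFrom upper (freeResolvent μ ξ)

lemma closure_upper : closure upper = {z : ℂ | 0 ≤ z.im} := Complex.closure_setOfPred_lt_im 0

lemma ofReal_mem_closure_upper (x : ℝ) : (x : ℂ) ∈ closure upper := by
  rw [closure_upper]; simp

variable (μ : Measure ℝ) [IsProbabilityMeasure μ] {ξ : ℝ} {z : ℂ}

lemma exists_tendsto_freeResolvent (hξ : 0 < ξ) (hz : z ∈ closure upper) :
    ∃ m, Tendsto (freeResolvent μ ξ) (𝓝[upper] z) (𝓝 m) := by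
  obtain ⟨w, hw⟩ := cauchy_map_subord μ hξ hz
  have hξ' : (ξ : ℂ) ≠ 0 := by exact_mod_cast hξ.ne'
  refine ⟨(w - z) / ξ, ?_⟩
  have h1 : Tendsto (fun u => (subord μ ξ u - u) / ξ) (𝓝[upper] z) (𝓝 ((w - z) / ξ)) :=
    (hw.sub (tendsto_id.mono_left nhdsWithin_le_nhds)).div_const _
  refine h1.congr' ?_
  filter_upwards [self_mem_nhdsWithin] with u hu
  rw [subord_eq μ hξ hu]
  field_simp
  ring

lemma tendsto_resolventExt (hξ : 0 < ξ) (hz : z ∈ closure upper) :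
    Tendsto (freeResolvent μ ξ) (𝓝[upper] z) (𝓝 (resolventExt μ ξ z)) :=
  tendsto_extendFrom (exists_tendsto_freeResolvent μ hξ hz)

lemma resolventExt_eq (hξ : 0 < ξ) (hz : 0 < z.im) :
    resolventExt μ ξ z = freeResolvent μ ξ z := by
  have hz' : z ∈ upper := hz
  have h1 := tendsto_resolventExt μ hξ (subset_closure hz')
  rw [isOpen_upper.nhdsWithin_eq hz'] at h1
  exact tendsto_nhds_unique h1 (differentiableAt_freeResolvent μ hξ hz).continuousAt

lemma continuousOn_resolventExt (hξ : 0 < ξ) :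
    ContinuousOn (resolventExt μ ξ) {z | 0 ≤ z.im} := by
  rw [← closure_upper]
  exact continuousOn_extendFrom subset_rfl fun z hz => exists_tendsto_freeResolvent μ hξ hz

lemma continuous_resolventExt_ofReal (hξ : 0 < ξ) :
    Continuous fun x : ℝ => resolventExt μ ξ x :=
  (continuousOn_resolventExt μ hξ).comp_continuous Complex.continuous_ofReal fun t => by simp

lemma tendsto_resolventExt_ofReal (hξ : 0 < ξ) (x : ℝ) :
    Tendsto (freeResolvent μ ξ) (𝓝[upper] (x : ℂ)) (𝓝 (resolventExt μ ξ x)) :=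
  tendsto_resolventExt μ hξ (ofReal_mem_closure_upper x)

lemma tendsto_subord_ofReal (hξ : 0 < ξ) (x : ℝ) :
    Tendsto (subord μ ξ) (𝓝[upper] (x : ℂ)) (𝓝 (x + ξ * resolventExt μ ξ x)) := by
  have h : Tendsto (fun u : ℂ => u + ξ * freeResolvent μ ξ u) (𝓝[upper] (x : ℂ))
      (𝓝 (x + ξ * resolventExt μ ξ x)) :=
    (tendsto_id.mono_left nhdsWithin_le_nhds).add
      ((tendsto_resolventExt_ofReal μ hξ x).const_mul _)
  refine h.congr' ?_
  filter_upwards [self_mem_nhdsWithin] with u hu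
  rw [subord_eq μ hξ hu]

lemma norm_resolventExt_le (hξ : 0 < ξ) (hz : 0 ≤ z.im) : ‖resolventExt μ ξ z‖ ≤ (√ξ)⁻¹ := by
  have hz' : z ∈ closure upper := by rwa [closure_upper]
  have := mem_closure_iff_nhdsWithin_neBot.1 hz'
  refine le_of_tendsto (tendsto_resolventExt μ hξ hz').norm ?_
  filter_upwards [self_mem_nhdsWithin] with u hu using norm_freeResolvent_le μ hξ hu

lemma im_resolventExt_nonneg (hξ : 0 < ξ) (hz : 0 ≤ z.im) : 0 ≤ (resolventExt μ ξ z).im := by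
  have hz' : z ∈ closure upper := by rwa [closure_upper]
  have := mem_closure_iff_nhdsWithin_neBot.1 hz'
  refine ge_of_tendsto ((Complex.continuous_im.tendsto _).comp (tendsto_resolventExt μ hξ hz')) ?_
  filter_upwards [self_mem_nhdsWithin] with u hu using (im_freeResolvent_pos μ hξ hu).le

/-- The density of the free convolution with a semicircle. -/
noncomputable def freeDensity (μ : Measure ℝ) (ξ : ℝ) (x : ℝ) : ℝ :=
  (resolventExt μ ξ x).im / Real.pi

/-- The free convolution with the semicircle of variance `ξ`. -/
noncomputable def freeConv (μ : Measure ℝ) (ξ : ℝ) : Measure ℝ :=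
  volume.withDensity fun x => ENNReal.ofReal (freeDensity μ ξ x)

lemma freeDensity_nonneg (hξ : 0 < ξ) (x : ℝ) : 0 ≤ freeDensity μ ξ x :=
  div_nonneg (im_resolventExt_nonneg μ hξ (by simp)) Real.pi_pos.le

lemma continuous_freeDensity (hξ : 0 < ξ) : Continuous (freeDensity μ ξ) :=
  (Complex.continuous_im.comp (continuous_resolventExt_ofReal μ hξ)).div_const _

lemma freeDensity_le (hξ : 0 < ξ) (x : ℝ) : freeDensity μ ξ x ≤ (√ξ)⁻¹ / Real.pi := by
  have := (le_abs_self _).trans (Complex.abs_im_le_norm (resolventExt μ ξ x))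
  have := this.trans (norm_resolventExt_le μ hξ (z := (x : ℂ)) (by simp))
  rw [freeDensity]
  gcongr

/-- `poisson_upper` applies because the extended transform is bounded by 1/√ξ and continuous up to
the real axis. -/
lemma im_freeResolvent_eq_integral (hξ : 0 < ξ) (hz : 0 < z.im) :
    (freeResolvent μ ξ z).im = z.im * ∫ t : ℝ, ‖((t : ℂ) - z)⁻¹‖ ^ 2 * freeDensity μ ξ t := by
  have h := poisson_upper (continuousOn_resolventExt μ hξ) (fun w hw => by
    refine (differentiableAt_freeResolvent μ hξ hw).congr_of_eventuallyEq ?_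
    filter_upwards [isOpen_upper.mem_nhds (show w ∈ upper from hw)] with u hu
    exact resolventExt_eq μ hξ hu) (fun w hw => norm_resolventExt_le μ hξ hw) hz
  rw [resolventExt_eq μ hξ hz] at h
  rw [h, Complex.im_ofReal_mul]
  have hfint : Integrable fun t : ℝ =>
      ((‖((t : ℂ) - z)⁻¹‖ ^ 2 : ℝ) : ℂ) * resolventExt μ ξ t := by
    refine ((integrable_norm_inv_sq_volume hz).mul_const (√ξ)⁻¹).mono'
      ((Complex.continuous_ofReal.comp ((continuous_inv_ofReal_sub hz).norm.pow 2)).mul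
        (continuous_resolventExt_ofReal μ hξ)).aestronglyMeasurable (ae_of_all _ fun t => ?_)
    rw [norm_mul, Complex.norm_real, Real.norm_of_nonneg (by positivity)]
    gcongr
    exact norm_resolventExt_le μ hξ (by simp)
  have := integral_im hfint
  simp only [RCLike.im_to_complex] at this
  rw [← this, div_mul_eq_mul_div, mul_div_assoc, ← integral_div]
  congr 1
  refine integral_congr_ae (ae_of_all _ fun t => ?_)
  simp only [Complex.im_ofReal_mul, freeDensity]
  ring

lemma integral_freeConv (hξ : 0 < ξ) {E : Type*} [NormedAddCommGroup E] [NormedSpace ℝ E]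
    (F : ℝ → E) : ∫ x, F x ∂(freeConv μ ξ) = ∫ x, freeDensity μ ξ x • F x := by
  rw [freeConv, integral_withDensity_eq_integral_toReal_smul
    (continuous_freeDensity μ hξ).measurable.ennreal_ofReal (by simp)]
  simp [ENNReal.toReal_ofReal (freeDensity_nonneg μ hξ _)]

lemma setIntegral_freeConv (hξ : 0 < ξ) {E : Type*} [NormedAddCommGroup E] [NormedSpace ℝ E]
    (F : ℝ → E) {s : Set ℝ} (hs : MeasurableSet s) :
    ∫ x in s, F x ∂(freeConv μ ξ) = ∫ x in s, freeDensity μ ξ x • F x := by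
  rw [freeConv, setIntegral_withDensity_eq_setIntegral_toReal_smul
    (continuous_freeDensity μ hξ).measurable.ennreal_ofReal (by simp) _ hs]
  simp [ENNReal.toReal_ofReal (freeDensity_nonneg μ hξ _)]

/-- Inside a cone around the imaginary axis |w/(t-w)| ≤ C uniformly in t, which is the domination
needed. -/
lemma tendsto_mul_resolventTransform {w : ℝ → ℂ} {C : ℝ}
    (hw : ∀ᶠ y in atTop, 0 < (w y).im ∧ ‖w y‖ ≤ C * (w y).im)
    (hlim : Tendsto (fun y => ‖w y‖) atTop atTop) :
    Tendsto (fun y => w y * resolventTransform μ (w y)) atTop (𝓝 (-1)) := by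
  have h : Tendsto (fun y => ∫ t : ℝ, w y * ((t : ℂ) - w y)⁻¹ ∂μ) atTop
      (𝓝 (∫ _ : ℝ, (-1 : ℂ) ∂μ)) := by
    refine tendsto_integral_filter_of_dominated_convergence (fun _ => C) ?_ ?_ (by simp) ?_
    · filter_upwards [hw] with y hy
      exact (continuous_const.mul (continuous_inv_ofReal_sub hy.1)).aestronglyMeasurable
    · filter_upwards [hw] with y hy
      refine ae_of_all _ fun t => ?_
      rw [norm_mul]
      calc _ ≤ (C * (w y).im) * ((w y).im)⁻¹ := by
            refine mul_le_mul hy.2 (norm_inv_ofReal_sub_le hy.1 t) (norm_nonneg _)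
              ((norm_nonneg _).trans hy.2)
        _ = C := by field_simp [hy.1.ne']
    · refine ae_of_all _ fun t => ?_
      have h0 : Tendsto (fun y => (w y)⁻¹) atTop (𝓝 0) :=
        tendsto_inv₀_cobounded.comp (tendsto_norm_atTop_iff_cobounded.1 hlim)
      have h1 : Tendsto (fun y => ((t : ℂ) * (w y)⁻¹ - 1)⁻¹) atTop (𝓝 (((t : ℂ) * 0 - 1)⁻¹)) :=
        ((h0.const_mul _).sub_const _).inv₀ (by simp)
      have h2 : ((t : ℂ) * 0 - 1)⁻¹ = -1 := by norm_num
      rw [h2] at h1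
      refine h1.congr' ?_
      filter_upwards [hw] with y hy
      have hy0 : w y ≠ 0 := by
        intro h; have := hy.1; simp [h] at this
      have hy1 := ofReal_sub_ne_zero hy.1 t
      have : (t : ℂ) * (w y)⁻¹ - 1 = (t - w y) * (w y)⁻¹ := by field_simp
      rw [this, mul_inv, inv_inv]
      ring
  simp only [integral_const, probReal_univ, one_smul] at h
  refine h.congr fun y => ?_
  rw [resolventTransform_eq, integral_const_mul]

lemma tendsto_norm_subord_mul_I (hξ : 0 < ξ) :
    (∀ᶠ y : ℝ in atTop, 0 < (subord μ ξ (y * Complex.I)).im ∧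
      ‖subord μ ξ (y * Complex.I)‖ ≤ 2 * (subord μ ξ (y * Complex.I)).im) ∧
    Tendsto (fun y : ℝ => ‖subord μ ξ (y * Complex.I)‖) atTop atTop ∧
    Tendsto (fun y : ℝ => (y * Complex.I) / subord μ ξ (y * Complex.I)) atTop (𝓝 1) := by
  have him : ∀ y : ℝ, ((y : ℂ) * Complex.I).im = y := by simp
  have h1 : ∀ᶠ y : ℝ in atTop, y ≤ (subord μ ξ (y * Complex.I)).im := by
    filter_upwards [eventually_gt_atTop 0] with y hy
    have := im_le_im_subord μ hξ (z := (y : ℂ) * Complex.I) (by rwa [him])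
    rwa [him] at this
  have h2 : Tendsto (fun y : ℝ => ‖subord μ ξ (y * Complex.I)‖) atTop atTop := by
    refine tendsto_atTop_mono' _ ?_ tendsto_id
    filter_upwards [h1] with y hy
    exact hy.trans ((le_abs_self _).trans (Complex.abs_im_le_norm _))
  refine ⟨?_, h2, ?_⟩
  · filter_upwards [h1, eventually_gt_atTop 0, eventually_ge_atTop (√ξ)] with y hy hy0 hy1
    refine ⟨hy0.trans_le hy, ?_⟩
    have := norm_subord_le μ hξ (z := (y : ℂ) * Complex.I) (by rwa [him])
    rw [norm_mul, Complex.norm_I, mul_one, Complex.norm_real, Real.norm_of_nonneg hy0.le] at this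
    linarith
  · rw [← tendsto_sub_nhds_zero_iff]
    refine squeeze_zero_norm' (a := fun y : ℝ => √ξ / ‖subord μ ξ (y * Complex.I)‖) ?_
      (tendsto_const_nhds.div_atTop h2)
    filter_upwards [h1, eventually_gt_atTop 0] with y hy hy0
    have hne : subord μ ξ (y * Complex.I) ≠ 0 := by
      intro h; rw [h] at hy; simp at hy; linarith
    have := norm_subord_sub_le μ hξ (z := (y : ℂ) * Complex.I) (by rwa [him])
    rw [div_sub_one hne, norm_div, norm_sub_rev]
    gcongr

lemma tendsto_mul_freeResolvent (hξ : 0 < ξ) :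
    Tendsto (fun y : ℝ => (y * Complex.I) * freeResolvent μ ξ (y * Complex.I)) atTop
      (𝓝 (-1)) := by
  obtain ⟨h1, h2, h3⟩ := tendsto_norm_subord_mul_I μ hξ
  have h4 := h3.mul (tendsto_mul_resolventTransform μ h1 h2)
  rw [one_mul] at h4
  refine h4.congr' ?_
  filter_upwards [h1] with y hy
  have hne : subord μ ξ (y * Complex.I) ≠ 0 := by
    intro h; have := hy.1; rw [h] at this; simp at this
  rw [freeResolvent]
  field_simp

lemma tendsto_freeResolvent_zero (hξ : 0 < ξ) :
    Tendsto (fun y : ℝ => freeResolvent μ ξ (y * Complex.I)) atTop (𝓝 0) := by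
  have h := (tendsto_mul_freeResolvent μ hξ).mul
    (tendsto_inv₀_cobounded.comp (tendsto_norm_atTop_iff_cobounded.1
      (show Tendsto (fun y : ℝ => ‖(y : ℂ) * Complex.I‖) atTop atTop by
        simpa using tendsto_abs_atTop_atTop)))
  rw [mul_zero] at h
  refine h.congr' ?_
  filter_upwards [eventually_gt_atTop 0] with y hy
  have : (y : ℂ) * Complex.I ≠ 0 := by simp [hy.ne']
  simp only [Function.comp]
  rw [mul_comm, inv_mul_cancel_left₀ this]

/-- The weights n²/(t²+n²) increase to 1, and by the Poisson formula their integrals are n · Im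
m(in), which tends to 1. -/
lemma isProbabilityMeasure_freeConv (hξ : 0 < ξ) : IsProbabilityMeasure (freeConv μ ξ) := by
  set φ : ℕ → ℝ → ℝ := fun n t =>
    (n : ℝ) ^ 2 * ‖((t : ℂ) - (n : ℝ) * Complex.I)⁻¹‖ ^ 2 * freeDensity μ ξ t with hφ
  have hform : ∀ (n : ℕ) (t : ℝ),
      (n : ℝ) ^ 2 * ‖((t : ℂ) - (n : ℝ) * Complex.I)⁻¹‖ ^ 2 = n ^ 2 / (t ^ 2 + n ^ 2) := by
    intro n t
    rw [norm_inv_ofReal_sub_sq]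
    simp [div_eq_mul_inv]
  have hlim : Tendsto (fun n : ℕ => ∫⁻ t, ENNReal.ofReal (φ n t)) atTop
      (𝓝 (∫⁻ t, ENNReal.ofReal (freeDensity μ ξ t))) := by
    refine lintegral_tendsto_of_tendsto_of_monotone ?_ ?_ ?_
    · intro n
      have : Measurable (φ n) := by
        have := (continuous_freeDensity μ hξ).measurable
        simp only [hφ, hform]
        fun_prop
      exact this.ennreal_ofReal.aemeasurable
    · refine ae_of_all _ fun t n m hnm => ENNReal.ofReal_le_ofReal ?_
      simp only [hφ, hform]
      refine mul_le_mul_of_nonneg_right ?_ (freeDensity_nonneg μ hξ t)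
      have hnm' : (n : ℝ) ≤ m := by exact_mod_cast hnm
      rcases Nat.eq_zero_or_pos n with rfl | hn
      · simp; positivity
      have hn' : (0 : ℝ) < n := by exact_mod_cast hn
      have hm' : (0 : ℝ) < m := hn'.trans_le hnm'
      rw [div_le_div_iff₀ (by positivity) (by positivity)]
      have : (n : ℝ) ^ 2 ≤ (m : ℝ) ^ 2 := by gcongr
      nlinarith [sq_nonneg t]
    · refine ae_of_all _ fun t => (ENNReal.continuous_ofReal.tendsto _).comp ?_
      have h1 : Tendsto (fun n : ℕ => (1 + t ^ 2 * ((n : ℝ) ^ 2)⁻¹)⁻¹) atTop (𝓝 1) := by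
        have h2 : Tendsto (fun n : ℕ => ((n : ℝ) ^ 2)⁻¹) atTop (𝓝 0) :=
          ((tendsto_pow_atTop two_ne_zero).comp tendsto_natCast_atTop_atTop).inv_tendsto_atTop
        have h3 := ((h2.const_mul (t ^ 2)).const_add 1).inv₀ (by simp)
        simpa using h3
      have h4 := h1.mul_const (freeDensity μ ξ t)
      rw [one_mul] at h4
      refine h4.congr' ?_
      filter_upwards [eventually_gt_atTop 0] with n hn
      have hn' : (n : ℝ) ≠ 0 := by exact_mod_cast hn.ne'
      simp only [hφ, hform]
      congr 1
      field_simp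
      ring
  have hval : ∀ᶠ n : ℕ in atTop, ∫⁻ t, ENNReal.ofReal (φ n t) =
      ENNReal.ofReal (-(((n : ℝ) : ℂ) * Complex.I *
        freeResolvent μ ξ ((n : ℝ) * Complex.I)).re) := by
    filter_upwards [eventually_gt_atTop 0] with n hn
    have hn' : 0 < (((n : ℝ) : ℂ) * Complex.I).im := by simpa using hn
    have him := im_freeResolvent_eq_integral μ hξ hn'
    rw [← ofReal_integral_eq_lintegral_ofReal]
    · congr 1
      have : (((n : ℝ) : ℂ) * Complex.I * freeResolvent μ ξ ((n : ℝ) * Complex.I)).re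
          = - (n * (freeResolvent μ ξ ((n : ℝ) * Complex.I)).im) := by
        simp [Complex.mul_re]
      rw [this, him, neg_neg, ← mul_assoc, ← integral_const_mul]
      refine integral_congr_ae (ae_of_all _ fun t => ?_)
      simp [hφ]
      ring
    · have h := ((integrable_norm_inv_sq_volume hn').const_mul ((n : ℝ) ^ 2)).mul_bdd
        (c := (√ξ)⁻¹ / Real.pi) (continuous_freeDensity μ hξ).aestronglyMeasurable
        (ae_of_all _ fun t => by
          rw [Real.norm_of_nonneg (freeDensity_nonneg μ hξ t)]; exact freeDensity_le μ hξ t)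
      exact h
    · exact ae_of_all _ fun t => mul_nonneg (by positivity) (freeDensity_nonneg μ hξ t)
  have hlim2 : Tendsto (fun n : ℕ => ∫⁻ t, ENNReal.ofReal (φ n t)) atTop (𝓝 1) := by
    have h1 := (Complex.continuous_re.tendsto _).comp
      ((tendsto_mul_freeResolvent μ hξ).comp tendsto_natCast_atTop_atTop)
    have h2 := (ENNReal.continuous_ofReal.tendsto _).comp h1.neg
    simp only [Complex.neg_re, Complex.one_re, neg_neg, ENNReal.ofReal_one] at h2
    exact h2.congr' (hval.mono fun n hn => hn.symm)
  refine ⟨?_⟩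
  rw [freeConv, withDensity_apply _ MeasurableSet.univ, Measure.restrict_univ]
  exact tendsto_nhds_unique hlim hlim2

/-- The imaginary parts agree by the Poisson formula. The difference is thus holomorphic and
real-valued, hence constant by the open mapping theorem, and it vanishes at i∞. -/
lemma resolventTransform_freeConv (hξ : 0 < ξ) (hz : 0 < z.im) :
    resolventTransform (freeConv μ ξ) z = freeResolvent μ ξ z := by
  have := isProbabilityMeasure_freeConv μ hξ
  have him : ∀ w : ℂ, 0 < w.im →
      (resolventTransform (freeConv μ ξ) w).im = (freeResolvent μ ξ w).im := by
    intro w hw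
    rw [im_resolventTransform _ hw, sqResolvent, integral_freeConv μ hξ,
      im_freeResolvent_eq_integral μ hξ hw]
    simp only [smul_eq_mul, mul_comm]
  set D : ℂ → ℂ := fun w => resolventTransform (freeConv μ ξ) w - freeResolvent μ ξ w with hD
  have hDd : DifferentiableOn ℂ D upper := fun w hw =>
    ((differentiableAt_resolventTransform _ hw).sub
      (differentiableAt_freeResolvent μ hξ hw)).differentiableWithinAt
  have hDim : ∀ w ∈ upper, (D w).im = 0 := fun w hw => by
    simp [hD, him w hw]
  rcases (hDd.analyticOnNhd isOpen_upper).is_constant_or_isOpen convex_upper.isPreconnected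
    with ⟨c, hc⟩ | h
  · have h1 : Tendsto (fun y : ℝ => resolventTransform (freeConv μ ξ) (y * Complex.I)) atTop
        (𝓝 0) := by
      have hn : Tendsto (fun y : ℝ => ‖(y : ℂ) * Complex.I‖) atTop atTop := by
        simpa using tendsto_abs_atTop_atTop
      have h := (tendsto_mul_resolventTransform (freeConv μ ξ) (w := fun y : ℝ => y * Complex.I)
        (C := 1) (by
          filter_upwards [eventually_gt_atTop 0] with y hy
          simp [hy, abs_of_pos hy]) hn).mul
        (tendsto_inv₀_cobounded.comp (tendsto_norm_atTop_iff_cobounded.1 hn))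
      rw [mul_zero] at h
      refine h.congr' ?_
      filter_upwards [eventually_gt_atTop 0] with y hy
      have : (y : ℂ) * Complex.I ≠ 0 := by simp [hy.ne']
      simp only [Function.comp]
      rw [mul_comm, inv_mul_cancel_left₀ this]
    have h2 := h1.sub (tendsto_freeResolvent_zero μ hξ)
    rw [sub_zero] at h2
    have h3 : Tendsto (fun _ : ℝ => c) atTop (𝓝 0) := by
      refine h2.congr' ?_
      filter_upwards [eventually_gt_atTop 0] with y hy
      exact hc _ (by simpa [upper] using hy)
    have h4 : c = 0 := tendsto_nhds_unique tendsto_const_nhds h3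
    have := hc z hz
    rw [h4] at this
    exact sub_eq_zero.1 this
  · exfalso
    have h1 := h upper subset_rfl isOpen_upper
    have hmem : D z ∈ D '' upper := ⟨z, hz, rfl⟩
    obtain ⟨ε, hε, hball⟩ := Metric.isOpen_iff.1 h1 _ hmem
    have : D z + (ε / 2 : ℝ) * Complex.I ∈ D '' upper := by
      apply hball
      rw [Metric.mem_ball, dist_eq_norm, add_sub_cancel_left, norm_mul, Complex.norm_I, mul_one,
        Complex.norm_real, Real.norm_of_nonneg (by positivity)]
      linarith
    obtain ⟨w, hw, hw2⟩ := this
    have h5 := congrArg Complex.im hw2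
    rw [hDim w hw, Complex.add_im, hDim z hz, Complex.im_ofReal_mul, Complex.I_im] at h5
    linarith

lemma isFreeSemicircleConv_freeConv (hξ : 0 < ξ) : IsFreeSemicircleConv μ ξ (freeConv μ ξ) := by
  refine ⟨isProbabilityMeasure_freeConv μ hξ, fun z hz => ?_⟩
  rw [resolventTransform_freeConv μ hξ hz, ← subord_eq μ hξ hz, freeResolvent]

end Boundary

/-! ### The Hilbert transform of the free convolution and its global identities. -/

section Hilbert

/-- The truncated Hilbert transform `∫_{|x - y| > ε} (x - y)⁻¹ dρ(y)`. -/
noncomputable def truncHilbert (ρ : Measure ℝ) (ε x : ℝ) : ℝ :=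
  ∫ y in {y : ℝ | ε < |x - y|}, (x - y)⁻¹ ∂ρ

/-- The difference of the conjugate Poisson kernel and the truncated Hilbert kernel. -/
noncomputable def hilbertDiffKernel (s : ℝ) : ℝ :=
  s * (1 + s ^ 2)⁻¹ - {s : ℝ | 1 < |s|}.indicator (fun s => s⁻¹) s

lemma measurableSet_one_lt_abs : MeasurableSet {s : ℝ | 1 < |s|} :=
  (isOpen_lt continuous_const continuous_abs).measurableSet

lemma measurable_hilbertDiffKernel : Measurable hilbertDiffKernel := by
  refine Measurable.sub (by fun_prop) (Measurable.indicator (by fun_prop) measurableSet_one_lt_abs)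

lemma abs_hilbertDiffKernel_le (s : ℝ) : |hilbertDiffKernel s| ≤ (1 + s ^ 2)⁻¹ := by
  have h0 : 0 < 1 + s ^ 2 := by positivity
  by_cases hs : 1 < |s|
  · have hs0 : s ≠ 0 := by rintro rfl; simp at hs; linarith
    have : hilbertDiffKernel s = -(s * (1 + s ^ 2))⁻¹ := by
      rw [hilbertDiffKernel, indicator_of_mem (show s ∈ {s : ℝ | 1 < |s|} from hs)]
      field_simp
      ring
    rw [this, abs_neg, abs_inv, abs_mul, abs_of_pos h0]
    refine inv_anti₀ h0 ?_
    nlinarith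
  · have : hilbertDiffKernel s = s * (1 + s ^ 2)⁻¹ := by
      rw [hilbertDiffKernel, indicator_of_notMem (show s ∉ {s : ℝ | 1 < |s|} from hs), sub_zero]
    rw [this, abs_mul, abs_inv, abs_of_pos h0]
    have : |s| ≤ 1 := not_lt.1 hs
    calc _ ≤ 1 * (1 + s ^ 2)⁻¹ := by gcongr
      _ = _ := one_mul _

lemma hilbertDiffKernel_neg (s : ℝ) : hilbertDiffKernel (-s) = -hilbertDiffKernel s := by
  by_cases hs : 1 < |s|
  · rw [hilbertDiffKernel, hilbertDiffKernel,
      indicator_of_mem (show s ∈ {s : ℝ | 1 < |s|} from hs),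
      indicator_of_mem (show -s ∈ {s : ℝ | 1 < |s|} by simpa using hs), inv_neg]
    ring
  · rw [hilbertDiffKernel, hilbertDiffKernel,
      indicator_of_notMem (show s ∉ {s : ℝ | 1 < |s|} from hs),
      indicator_of_notMem (show -s ∉ {s : ℝ | 1 < |s|} by simpa using hs)]
    ring

lemma integral_hilbertDiffKernel : ∫ s, hilbertDiffKernel s = 0 := by
  have h := integral_neg_eq_self hilbertDiffKernel volume
  simp_rw [hilbertDiffKernel_neg, integral_neg] at h
  linarith

lemma measurableSet_trunc (ε x : ℝ) : MeasurableSet {y : ℝ | ε < |x - y|} :=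
  (isOpen_lt continuous_const (by fun_prop)).measurableSet

lemma truncHilbert_eq_integral_indicator (ρ : Measure ℝ) (ε x : ℝ) : truncHilbert ρ ε x =
    ∫ y, {y : ℝ | ε < |x - y|}.indicator (fun y => (x - y)⁻¹) y ∂ρ := by
  rw [truncHilbert, integral_indicator (measurableSet_trunc ε x)]

lemma norm_trunc_le {ε : ℝ} (hε : 0 < ε) (x y : ℝ) :
    ‖{y : ℝ | ε < |x - y|}.indicator (fun y => (x - y)⁻¹) y‖ ≤ ε⁻¹ := by
  by_cases h : y ∈ {y : ℝ | ε < |x - y|}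
  · rw [indicator_of_mem h, norm_inv, Real.norm_eq_abs]
    exact inv_anti₀ hε (le_of_lt h)
  · rw [indicator_of_notMem h, norm_zero]; positivity

lemma integrable_trunc (ρ : Measure ℝ) [IsFiniteMeasure ρ] {ε : ℝ} (hε : 0 < ε) (x : ℝ) :
    Integrable ({y : ℝ | ε < |x - y|}.indicator fun y => (x - y)⁻¹) ρ := by
  refine Integrable.of_bound ?_ ε⁻¹ (ae_of_all _ fun y => norm_trunc_le hε x y)
  exact (Measurable.indicator (by fun_prop) (measurableSet_trunc ε x)).aestronglyMeasurable

/-- The truncated kernel is minus the real part of the resolvent at height ε, up to a rescaled odd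
kernel that is integrable on the line; only the resolvent part survives as ε → 0. -/
lemma kernel_identity {ε : ℝ} (hε : 0 < ε) (x y : ℝ) :
    {y : ℝ | ε < |x - y|}.indicator (fun y => (x - y)⁻¹) y =
      ε⁻¹ * hilbertDiffKernel (ε⁻¹ * (y - x)) - (((y : ℂ) - (x + ε * Complex.I))⁻¹).re := by
  have hre : (((y : ℂ) - (x + ε * Complex.I))⁻¹).re = (y - x) / ((y - x) ^ 2 + ε ^ 2) := by
    rw [Complex.inv_re, Complex.normSq_apply]
    simp
    ring_nf
  have h1 : ε⁻¹ * (ε⁻¹ * (y - x) * (1 + (ε⁻¹ * (y - x)) ^ 2)⁻¹) =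
      (y - x) / ((y - x) ^ 2 + ε ^ 2) := by
    field_simp
    ring
  rw [hre, hilbertDiffKernel, mul_sub, h1]
  have habs : |ε⁻¹ * (y - x)| = |x - y| / ε := by
    rw [abs_mul, abs_inv, abs_of_pos hε, abs_sub_comm]; field_simp
  by_cases h : ε < |x - y|
  · have hxy : x - y ≠ 0 := by intro h0; rw [h0, abs_zero] at h; linarith
    have hyx : y - x ≠ 0 := by intro h0; apply hxy; linarith
    rw [indicator_of_mem (show y ∈ {y : ℝ | ε < |x - y|} from h), indicator_of_mem]
    · have : (x - y)⁻¹ = -(y - x)⁻¹ := by rw [← inv_neg, neg_sub]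
      rw [this]
      field_simp
      ring
    · rw [mem_ofPred_eq, habs, lt_div_iff₀ hε, one_mul]; exact h
  · rw [indicator_of_notMem (show y ∉ {y : ℝ | ε < |x - y|} from h), indicator_of_notMem]
    · ring
    · rw [mem_ofPred_eq, habs, lt_div_iff₀ hε, one_mul]; exact h

variable (μ : Measure ℝ) [IsProbabilityMeasure μ] {ξ : ℝ}

lemma truncHilbert_freeConv (hξ : 0 < ξ) {ε : ℝ} (hε : 0 < ε) (x : ℝ) :
    truncHilbert (freeConv μ ξ) ε x = (∫ s, freeDensity μ ξ (x + ε * s) * hilbertDiffKernel s)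
      - (freeResolvent μ ξ (x + ε * Complex.I)).re := by
  have := isProbabilityMeasure_freeConv μ hξ
  have hz : 0 < ((x : ℂ) + ε * Complex.I).im := by simpa
  have hint := integrable_inv_ofReal_sub (freeConv μ ξ) hz
  have hk : Integrable (fun y => ε⁻¹ * hilbertDiffKernel (ε⁻¹ * (y - x))) (freeConv μ ξ) := by
    have := (integrable_trunc (freeConv μ ξ) hε x).add hint.re
    refine this.congr (ae_of_all _ fun y => ?_)
    simp only [Pi.add_apply, kernel_identity hε, RCLike.re_to_complex, sub_add_cancel]
  rw [truncHilbert_eq_integral_indicator]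
  simp_rw [kernel_identity hε]
  have hre : Integrable (fun y : ℝ => (((y : ℂ) - (x + ε * Complex.I))⁻¹).re) (freeConv μ ξ) :=
    hint.re
  rw [integral_sub hk hre]
  have h2 := integral_re hint
  simp only [RCLike.re_to_complex] at h2
  rw [h2, ← resolventTransform_eq, resolventTransform_freeConv μ hξ hz, integral_freeConv μ hξ]
  congr 1
  have h3 := Measure.integral_comp_mul_left
    (fun u => freeDensity μ ξ (x + u) * hilbertDiffKernel (ε⁻¹ * u)) ε
  have h4 := integral_add_left_eq_self (μ := volume)
    (fun y => freeDensity μ ξ y * hilbertDiffKernel (ε⁻¹ * (y - x))) x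
  simp only [add_sub_cancel_left, inv_mul_cancel_left₀ hε.ne'] at h3 h4
  rw [h3, h4, smul_eq_mul, abs_of_pos (inv_pos.2 hε), ← integral_const_mul]
  refine integral_congr_ae (ae_of_all _ fun y => ?_)
  simp only [smul_eq_mul]
  ring

lemma abs_freeDensity_mul_kernel_le (hξ : 0 < ξ) (u s : ℝ) :
    ‖freeDensity μ ξ u * hilbertDiffKernel s‖ ≤ (√ξ)⁻¹ / Real.pi * (1 + s ^ 2)⁻¹ := by
  rw [norm_mul, Real.norm_of_nonneg (freeDensity_nonneg μ hξ u)]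
  gcongr
  · exact freeDensity_le μ hξ u
  · exact abs_hilbertDiffKernel_le s

/-- Uniform in ε and x, hence a dominating bound for interchanging the principal value with
integration against the law. -/
lemma abs_truncHilbert_freeConv_le (hξ : 0 < ξ) {ε : ℝ} (hε : 0 < ε) (x : ℝ) :
    |truncHilbert (freeConv μ ξ) ε x| ≤ 2 * (√ξ)⁻¹ := by
  rw [truncHilbert_freeConv μ hξ hε]
  have h1 : |∫ s, freeDensity μ ξ (x + ε * s) * hilbertDiffKernel s| ≤ (√ξ)⁻¹ := by
    have h := norm_integral_le_of_norm_le
      (integrable_inv_one_add_sq.const_mul ((√ξ)⁻¹ / Real.pi))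
      (ae_of_all _ fun s => abs_freeDensity_mul_kernel_le μ hξ (x + ε * s) s)
    rw [integral_const_mul, integral_univ_inv_one_add_sq,
      div_mul_cancel₀ _ Real.pi_ne_zero] at h
    exact h
  have h2 := (Complex.abs_re_le_norm (freeResolvent μ ξ (x + ε * Complex.I))).trans
    (norm_freeResolvent_le μ hξ (by simpa))
  refine (abs_sub _ _).trans ?_
  linarith

lemma tendsto_add_mul_I (x : ℝ) :
    Tendsto (fun ε : ℝ => (x : ℂ) + ε * Complex.I) (𝓝[>] 0) (𝓝[upper] (x : ℂ)) := by
  refine tendsto_nhdsWithin_iff.2 ⟨?_, ?_⟩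
  · have : Continuous fun ε : ℝ => (x : ℂ) + ε * Complex.I := by fun_prop
    have h := this.tendsto 0
    simp only [Complex.ofReal_zero, zero_mul, add_zero] at h
    exact h.mono_left nhdsWithin_le_nhds
  · filter_upwards [self_mem_nhdsWithin] with ε hε
    simpa [upper] using hε

/-- By continuity of the density, the correction term tends to the density at x times the integral
of an odd kernel, which is zero. -/
lemma tendsto_truncHilbert (hξ : 0 < ξ) (x : ℝ) :
    Tendsto (fun ε => truncHilbert (freeConv μ ξ) ε x) (𝓝[>] 0)
      (𝓝 (-(resolventExt μ ξ x).re)) := by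
  have h1 : Tendsto (fun ε : ℝ => ∫ s, freeDensity μ ξ (x + ε * s) * hilbertDiffKernel s)
      (𝓝[>] 0) (𝓝 (∫ s, freeDensity μ ξ x * hilbertDiffKernel s)) := by
    refine tendsto_integral_filter_of_dominated_convergence
      (fun s => (√ξ)⁻¹ / Real.pi * (1 + s ^ 2)⁻¹) ?_ ?_
      (integrable_inv_one_add_sq.const_mul _) ?_
    · refine Eventually.of_forall fun ε => ?_
      have := (continuous_freeDensity μ hξ).measurable
      have := measurable_hilbertDiffKernel
      exact (by fun_prop : Measurable _).aestronglyMeasurable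
    · exact Eventually.of_forall fun ε => ae_of_all _ fun s =>
        abs_freeDensity_mul_kernel_le μ hξ _ s
    · refine ae_of_all _ fun s => Tendsto.mul_const _ ?_
      have : Continuous fun ε : ℝ => freeDensity μ ξ (x + ε * s) :=
        (continuous_freeDensity μ hξ).comp (by fun_prop)
      have h := this.tendsto 0
      simp only [zero_mul, add_zero] at h
      exact h.mono_left nhdsWithin_le_nhds
  rw [integral_const_mul, integral_hilbertDiffKernel, mul_zero] at h1
  have h2 := (Complex.continuous_re.tendsto _).comp
    ((tendsto_resolventExt_ofReal μ hξ x).comp (tendsto_add_mul_I x))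
  have h3 := h1.sub h2
  rw [zero_sub] at h3
  refine h3.congr' ?_
  filter_upwards [self_mem_nhdsWithin] with ε hε
  rw [truncHilbert_freeConv μ hξ hε]
  rfl

lemma hilbertTransform_freeConv (hξ : 0 < ξ) (x : ℝ) :
    hilbertTransform (freeConv μ ξ) x = -(resolventExt μ ξ x).re :=
  (tendsto_truncHilbert μ hξ x).limUnder_eq

lemma abs_hilbertTransform_freeConv_le (hξ : 0 < ξ) (x : ℝ) :
    |hilbertTransform (freeConv μ ξ) x| ≤ (√ξ)⁻¹ := by
  rw [hilbertTransform_freeConv μ hξ, abs_neg]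
  exact (Complex.abs_re_le_norm _).trans (norm_resolventExt_le μ hξ (by simp))

lemma continuous_hilbertTransform_freeConv (hξ : 0 < ξ) :
    Continuous (hilbertTransform (freeConv μ ξ)) := by
  have : hilbertTransform (freeConv μ ξ) = fun x : ℝ => -(resolventExt μ ξ x).re :=
    funext (hilbertTransform_freeConv μ hξ)
  rw [this]
  exact (Complex.continuous_re.comp (continuous_resolventExt_ofReal μ hξ)).neg

/-- The truncated kernel as a function on the plane. -/
noncomputable def truncKernel (ε : ℝ) (p : ℝ × ℝ) : ℝ :=
  {p : ℝ × ℝ | ε < |p.1 - p.2|}.indicator (fun p => (p.1 - p.2)⁻¹) p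

lemma measurableSet_truncKernel (ε : ℝ) : MeasurableSet {p : ℝ × ℝ | ε < |p.1 - p.2|} :=
  (isOpen_lt continuous_const (by fun_prop)).measurableSet

lemma measurable_truncKernel (ε : ℝ) : Measurable (truncKernel ε) :=
  Measurable.indicator (by fun_prop) (measurableSet_truncKernel ε)

lemma truncKernel_mk (ε x y : ℝ) : truncKernel ε (x, y) =
    {y : ℝ | ε < |x - y|}.indicator (fun y => (x - y)⁻¹) y := by
  simp only [truncKernel, indicator, mem_ofPred_eq]

lemma truncKernel_swap (ε : ℝ) (p : ℝ × ℝ) : truncKernel ε p.swap = -truncKernel ε p := by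
  simp only [truncKernel, indicator, mem_ofPred_eq, Prod.fst_swap, Prod.snd_swap,
    abs_sub_comm p.2 p.1]
  split_ifs
  · rw [← inv_neg, neg_sub]
  · simp

lemma integrable_mul_truncKernel (ρ : Measure ℝ) [IsProbabilityMeasure ρ] {F : ℝ → ℝ}
    (hF : Integrable F ρ) {ε : ℝ} (hε : 0 < ε) :
    Integrable (fun p : ℝ × ℝ => F p.1 * truncKernel ε p) (ρ.prod ρ) := by
  refine (hF.comp_fst ρ).mul_bdd (c := ε⁻¹) (measurable_truncKernel ε).aestronglyMeasurable
    (ae_of_all _ fun p => ?_)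
  rw [← Prod.mk.eta (p := p), truncKernel_mk]
  exact norm_trunc_le hε _ _

/-- Antisymmetry of the kernel under exchange of the variables. The choices F = 1, F = id and F
monotone give the three facts about h_ξ used in the equations. -/
lemma integral_mul_truncHilbert (ρ : Measure ℝ) [IsProbabilityMeasure ρ] {F : ℝ → ℝ}
    (hF : Integrable F ρ) {ε : ℝ} (hε : 0 < ε) :
    2 * ∫ x, F x * truncHilbert ρ ε x ∂ρ =
      ∫ p : ℝ × ℝ, (F p.1 - F p.2) * truncKernel ε p ∂(ρ.prod ρ) := by
  have hint := integrable_mul_truncKernel ρ hF hε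
  have h1 : ∫ x, F x * truncHilbert ρ ε x ∂ρ =
      ∫ p : ℝ × ℝ, F p.1 * truncKernel ε p ∂(ρ.prod ρ) := by
    rw [integral_prod _ hint]
    refine integral_congr_ae (ae_of_all _ fun x => ?_)
    simp only [integral_const_mul, truncKernel_mk, truncHilbert_eq_integral_indicator]
  have h2 : ∫ p : ℝ × ℝ, F p.1 * truncKernel ε p ∂(ρ.prod ρ) =
      -∫ p : ℝ × ℝ, F p.2 * truncKernel ε p ∂(ρ.prod ρ) := by
    rw [← integral_prod_swap, ← integral_neg]
    refine integral_congr_ae (ae_of_all _ fun p => ?_)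
    simp only [truncKernel_swap, Prod.fst_swap, mul_neg]
  have hint2 : Integrable (fun p : ℝ × ℝ => F p.2 * truncKernel ε p) (ρ.prod ρ) := by
    refine hint.swap.neg.congr (ae_of_all _ fun p => ?_)
    simp [Function.comp, truncKernel_swap]
  simp_rw [sub_mul]
  rw [integral_sub hint hint2, two_mul]
  nth_rewrite 1 [h1]
  rw [h1, h2]
  ring

lemma measurable_truncHilbert (ρ : Measure ℝ) [IsProbabilityMeasure ρ] (ε : ℝ) :
    Measurable (truncHilbert ρ ε) := by
  have h := (measurable_truncKernel ε).stronglyMeasurable.integral_prod_right' (ν := ρ)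
  have e : truncHilbert ρ ε = fun x => ∫ y, truncKernel ε (x, y) ∂ρ := by
    funext x
    simp only [truncKernel_mk, truncHilbert_eq_integral_indicator]
  rw [e]
  exact h.measurable

lemma tendsto_integral_mul_truncHilbert (hξ : 0 < ξ) {F : ℝ → ℝ}
    (hF : Integrable F (freeConv μ ξ)) :
    Tendsto (fun ε => ∫ x, F x * truncHilbert (freeConv μ ξ) ε x ∂(freeConv μ ξ)) (𝓝[>] 0)
      (𝓝 (∫ x, F x * hilbertTransform (freeConv μ ξ) x ∂(freeConv μ ξ))) := by
  have := isProbabilityMeasure_freeConv μ hξ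
  refine tendsto_integral_filter_of_dominated_convergence (fun x => ‖F x‖ * (2 * (√ξ)⁻¹))
    ?_ ?_ (hF.norm.mul_const _) ?_
  · exact Eventually.of_forall fun ε =>
      hF.aestronglyMeasurable.mul (measurable_truncHilbert _ ε).aestronglyMeasurable
  · filter_upwards [self_mem_nhdsWithin] with ε hε
    refine ae_of_all _ fun x => ?_
    rw [norm_mul]
    gcongr
    exact abs_truncHilbert_freeConv_le μ hξ hε x
  · refine ae_of_all _ fun x => Tendsto.const_mul _ ?_
    rw [hilbertTransform_freeConv μ hξ]
    exact tendsto_truncHilbert μ hξ x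

lemma integral_monotone_mul_hilbertTransform_nonneg (hξ : 0 < ξ) {F : ℝ → ℝ} (hm : Monotone F)
    (hF : Integrable F (freeConv μ ξ)) :
    0 ≤ ∫ x, F x * hilbertTransform (freeConv μ ξ) x ∂(freeConv μ ξ) := by
  have := isProbabilityMeasure_freeConv μ hξ
  refine ge_of_tendsto (tendsto_integral_mul_truncHilbert μ hξ hF) ?_
  filter_upwards [self_mem_nhdsWithin] with ε hε
  have h := integral_mul_truncHilbert (freeConv μ ξ) hF hε
  have h2 : 0 ≤ ∫ p : ℝ × ℝ, (F p.1 - F p.2) * truncKernel ε p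
      ∂((freeConv μ ξ).prod (freeConv μ ξ)) := by
    refine integral_nonneg fun p => ?_
    simp only [truncKernel, indicator, mem_ofPred_eq, Pi.zero_apply]
    split_ifs
    · rcases le_total p.1 p.2 with hp | hp
      · exact mul_nonneg_of_nonpos_of_nonpos (sub_nonpos.2 (hm hp))
          (inv_nonpos.2 (sub_nonpos.2 hp))
      · exact mul_nonneg (sub_nonneg.2 (hm hp)) (inv_nonneg.2 (sub_nonneg.2 hp))
    · simp
  linarith

lemma integral_hilbertTransform (hξ : 0 < ξ) :
    ∫ x, hilbertTransform (freeConv μ ξ) x ∂(freeConv μ ξ) = 0 := by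
  have := isProbabilityMeasure_freeConv μ hξ
  have h1 := tendsto_integral_mul_truncHilbert μ hξ (F := fun _ => 1) (integrable_const _)
  simp only [one_mul] at h1
  refine tendsto_nhds_unique h1 (tendsto_const_nhds.congr' ?_)
  filter_upwards [self_mem_nhdsWithin] with ε hε
  have h := integral_mul_truncHilbert (freeConv μ ξ) (F := fun _ => 1) (integrable_const _) hε
  simp only [one_mul, sub_self, zero_mul, integral_zero] at h
  linarith

lemma prod_diagonal_freeConv (hξ : 0 < ξ) :
    ∀ᵐ p ∂((freeConv μ ξ).prod (freeConv μ ξ)), p.1 ≠ p.2 := by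
  have := isProbabilityMeasure_freeConv μ hξ
  rw [ae_iff]
  simp only [ne_eq, not_not]
  have hs : MeasurableSet {p : ℝ × ℝ | p.1 = p.2} :=
    (isClosed_eq continuous_fst continuous_snd).measurableSet
  rw [Measure.measure_prod_null hs]
  refine ae_of_all _ fun x => ?_
  have : (Prod.mk x ⁻¹' {p : ℝ × ℝ | p.1 = p.2}) = {x} := by
    ext y; simp [eq_comm]
  dsimp only
  rw [this]
  exact withDensity_absolutelyContinuous _ _ (by simp)

/-- After symmetrisation the integrand is 1 off the diagonal, a null set since the law has a
density; the 1/2 is the symmetrisation factor. -/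
lemma integral_id_mul_hilbertTransform (hξ : 0 < ξ)
    (hint : Integrable (fun x => x) (freeConv μ ξ)) :
    ∫ x, x * hilbertTransform (freeConv μ ξ) x ∂(freeConv μ ξ) = 1 / 2 := by
  have := isProbabilityMeasure_freeConv μ hξ
  have h1 := (tendsto_integral_mul_truncHilbert μ hξ hint).const_mul 2
  have h2 : Tendsto (fun ε => ∫ p : ℝ × ℝ, (p.1 - p.2) * truncKernel ε p
      ∂((freeConv μ ξ).prod (freeConv μ ξ))) (𝓝[>] 0)
      (𝓝 (∫ p : ℝ × ℝ, (1 : ℝ) ∂((freeConv μ ξ).prod (freeConv μ ξ)))) := by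
    refine tendsto_integral_filter_of_dominated_convergence (fun _ => 1) ?_ ?_ (by simp) ?_
    · refine Eventually.of_forall fun ε => Measurable.aestronglyMeasurable ?_
      have := measurable_truncKernel ε
      fun_prop
    · filter_upwards [self_mem_nhdsWithin] with ε hε
      refine ae_of_all _ fun p => ?_
      simp only [truncKernel, indicator, mem_ofPred_eq]
      split_ifs with h
      · have : p.1 - p.2 ≠ 0 := by
          intro h0; rw [h0, abs_zero] at h; exact absurd h (not_lt.2 (le_of_lt hε))
        rw [mul_inv_cancel₀ this, norm_one]
      · simp
    · filter_upwards [prod_diagonal_freeConv μ hξ] with p hp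
      have hp0 : 0 < |p.1 - p.2| := abs_pos.2 (sub_ne_zero.2 hp)
      refine tendsto_const_nhds.congr' ?_
      filter_upwards [mem_nhdsWithin_of_mem_nhds (Iio_mem_nhds hp0)] with ε hε
      have hε' : p ∈ {p : ℝ × ℝ | ε < |p.1 - p.2|} := hε
      rw [truncKernel, indicator_of_mem hε', mul_inv_cancel₀ (sub_ne_zero.2 hp)]
  have h3 := tendsto_nhds_unique h1 (h2.congr' (by
    filter_upwards [self_mem_nhdsWithin] with ε hε
    exact (integral_mul_truncHilbert (freeConv μ ξ) hint hε).symm))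
  simp at h3
  linarith

end Hilbert

/-! ### The second moment of the free convolution. -/

section SecondMoment

variable (μ : Measure ℝ) [IsProbabilityMeasure μ] {ξ : ℝ}

lemma integrable_id_of_sq {μ : Measure ℝ} [IsFiniteMeasure μ]
    (h : Integrable (fun x : ℝ => x ^ 2) μ) : Integrable (fun x : ℝ => x) μ := by
  refine (h.add (integrable_const 1)).mono' (by fun_prop) (ae_of_all _ fun x => ?_)
  rw [Real.norm_eq_abs, Pi.add_apply, ← sq_abs]
  nlinarith [sq_nonneg (|x| - 1), abs_nonneg x]

/-- An exact second-order expansion at infinity whose remainder is again a resolvent integral, so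
that a finite second moment suffices. -/
lemma resolventTransform_expansion (hmom : Integrable (fun x : ℝ => x ^ 2) μ) {w : ℂ}
    (hw : 0 < w.im) : resolventTransform μ w =
      -w⁻¹ - (∫ x, x ∂μ : ℝ) * (w⁻¹) ^ 2 +
        (w⁻¹) ^ 2 * ∫ x : ℝ, ((x ^ 2 : ℝ) : ℂ) * ((x : ℂ) - w)⁻¹ ∂μ := by
  have hw0 : w ≠ 0 := by rintro rfl; simp at hw
  have h1 := integrable_id_of_sq hmom
  have h2 : Integrable (fun x : ℝ => ((x ^ 2 : ℝ) : ℂ) * ((x : ℂ) - w)⁻¹) μ :=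
    hmom.ofReal.mul_bdd (c := (w.im)⁻¹) (continuous_inv_ofReal_sub hw).aestronglyMeasurable
      (ae_of_all _ (norm_inv_ofReal_sub_le hw))
  have e : ∀ x : ℝ, ((x : ℂ) - w)⁻¹ =
      -w⁻¹ - (x : ℂ) * (w⁻¹) ^ 2 + (w⁻¹) ^ 2 * (((x ^ 2 : ℝ) : ℂ) * ((x : ℂ) - w)⁻¹) := by
    intro x
    have := ofReal_sub_ne_zero hw x
    push_cast
    field_simp
    ring
  have h1' : Integrable (fun x : ℝ => (x : ℂ) * (w⁻¹) ^ 2) μ := h1.ofReal.mul_const _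
  have h3 : Integrable (fun x : ℝ => -w⁻¹ - (x : ℂ) * (w⁻¹) ^ 2) μ :=
    (integrable_const _).sub h1'
  rw [resolventTransform_eq]
  conv_lhs => rw [integral_congr_ae (ae_of_all _ e)]
  rw [integral_add h3 (h2.const_mul _), integral_sub (integrable_const _) h1', integral_const_mul,
    integral_mul_const]
  have : ∫ x : ℝ, (x : ℂ) ∂μ = ((∫ x, x ∂μ : ℝ) : ℂ) := integral_ofReal
  rw [this]
  simp

lemma tendsto_mul_integral_sq {μ : Measure ℝ} (hmom : Integrable (fun x : ℝ => x ^ 2) μ) {w : ℝ → ℂ} {C : ℝ}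
    (hw : ∀ᶠ y in atTop, 0 < (w y).im ∧ ‖w y‖ ≤ C * (w y).im)
    (hlim : Tendsto (fun y => ‖w y‖) atTop atTop) :
    Tendsto (fun y => w y * ∫ x : ℝ, ((x ^ 2 : ℝ) : ℂ) * ((x : ℂ) - w y)⁻¹ ∂μ) atTop
      (𝓝 (-((∫ x, x ^ 2 ∂μ : ℝ) : ℂ))) := by
  have h : Tendsto (fun y => ∫ t : ℝ, ((t ^ 2 : ℝ) : ℂ) * (w y * ((t : ℂ) - w y)⁻¹) ∂μ) atTop
      (𝓝 (∫ t : ℝ, ((t ^ 2 : ℝ) : ℂ) * (-1) ∂μ)) := by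
    refine tendsto_integral_filter_of_dominated_convergence (fun t => t ^ 2 * C) ?_ ?_
      (hmom.mul_const _) ?_
    · filter_upwards [hw] with y hy
      have := continuous_inv_ofReal_sub hy.1
      exact (by fun_prop : Continuous _).aestronglyMeasurable
    · filter_upwards [hw] with y hy
      refine ae_of_all _ fun t => ?_
      rw [norm_mul, norm_mul, Complex.norm_real, Real.norm_of_nonneg (by positivity)]
      gcongr
      calc _ ≤ (C * (w y).im) * ((w y).im)⁻¹ := by
            refine mul_le_mul hy.2 (norm_inv_ofReal_sub_le hy.1 t) (norm_nonneg _)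
              ((norm_nonneg _).trans hy.2)
        _ = C := by field_simp [hy.1.ne']
    · refine ae_of_all _ fun t => Tendsto.const_mul _ ?_
      have := tendsto_mul_resolventTransform (Measure.dirac t) hw hlim
      simp only [resolventTransform_eq, integral_dirac] at this
      exact this
  rw [integral_mul_const, show ∫ t : ℝ, ((t ^ 2 : ℝ) : ℂ) ∂μ = ((∫ x, x ^ 2 ∂μ : ℝ) : ℂ) from
    integral_ofReal, mul_neg_one] at h
  refine h.congr fun y => ?_
  rw [← integral_const_mul]
  refine integral_congr_ae (ae_of_all _ fun t => ?_)
  ring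

lemma tendsto_sq_mul_one_sub (hξ : 0 < ξ) (hmom : Integrable (fun x : ℝ => x ^ 2) μ) :
    Tendsto (fun y : ℝ => y ^ 2 * (1 - y * (freeResolvent μ ξ (y * Complex.I)).im)) atTop
      (𝓝 ((∫ x, x ^ 2 ∂μ) + ξ)) := by
  obtain ⟨h1, h2, h3⟩ := tendsto_norm_subord_mul_I μ hξ
  have hT := tendsto_mul_integral_sq hmom h1 h2
  have hzm := tendsto_mul_freeResolvent μ hξ
  have hm := tendsto_freeResolvent_zero μ hξ
  set E := ∫ x, x ∂μ with hE
  set Q := ∫ x, x ^ 2 ∂μ with hQ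
  have hlim : Tendsto (fun y : ℝ =>
      -((E : ℂ) * (ξ * ((y * Complex.I) / subord μ ξ (y * Complex.I) *
          freeResolvent μ ξ (y * Complex.I))))
        - ((y * Complex.I) / subord μ ξ (y * Complex.I)) ^ 2 * (subord μ ξ (y * Complex.I) *
          ∫ x : ℝ, ((x ^ 2 : ℝ) : ℂ) * ((x : ℂ) - subord μ ξ (y * Complex.I))⁻¹ ∂μ)
        + ξ * ((y * Complex.I) * freeResolvent μ ξ (y * Complex.I)) ^ 2) atTop
      (𝓝 (-((E : ℂ) * (ξ * (1 * 0))) - 1 ^ 2 * (-(Q : ℂ)) + ξ * (-1) ^ 2)) :=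
    ((((h3.mul hm).const_mul _).const_mul _).neg.sub ((h3.pow 2).mul hT)).add
      ((hzm.pow 2).const_mul _)
  have hlim2 := (Complex.continuous_re.tendsto _).comp hlim
  have e : (-((E : ℂ) * (ξ * (1 * 0))) - 1 ^ 2 * (-(Q : ℂ)) + ξ * (-1) ^ 2).re = Q + ξ := by
    simp
  rw [e] at hlim2
  refine hlim2.congr' ?_
  filter_upwards [h1, eventually_gt_atTop 0] with y hy hy0
  have hz : 0 < ((y : ℂ) * Complex.I).im := by simpa
  have hexp := resolventTransform_expansion μ hmom hy.1
  rw [← freeResolvent, ← hE] at hexp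
  have hsub := subord_eq μ hξ hz
  set z : ℂ := (y : ℂ) * Complex.I with hzdef
  set w := subord μ ξ z with hw
  set m := freeResolvent μ ξ z with hmdef
  set T := ∫ x : ℝ, ((x ^ 2 : ℝ) : ℂ) * ((x : ℂ) - w)⁻¹ ∂μ with hTdef
  have hw0 : w ≠ 0 := by intro h; have := hy.1; rw [h] at this; simp at this
  have hz2 : z ^ 2 = -((y ^ 2 : ℝ) : ℂ) := by
    rw [hzdef, mul_pow, Complex.I_sq]; push_cast; ring
  have hre : ((z * m).re) = -(y * m.im) := by
    rw [hzdef]; simp [Complex.mul_re]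
  -- From w = z + ξm one gets zm = wm - ξm². The expansion of wm produces Q, the term ξ(zm)²
  -- produces ξ, and the first moment leaves only E z, which is purely imaginary on this axis.
  have key : -((E : ℂ) * (ξ * (z / w * m))) - (z / w) ^ 2 * (w * T) + ξ * (z * m) ^ 2 =
      ((y ^ 2 : ℝ) : ℂ) * (1 + z * m) - E * z := by
    have hy2 : ((y ^ 2 : ℝ) : ℂ) = -z ^ 2 := by rw [hz2, neg_neg]
    rw [hy2]
    have hwm : w * m = -1 - E * w⁻¹ + w⁻¹ * T := by
      rw [hexp]; field_simp
    have hzm' : z * m = w * m - ξ * m ^ 2 := by rw [hsub]; ring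
    have hξm : ξ * m = w - z := by rw [hsub]; ring
    have h5 : (E : ℂ) * (ξ * (z / w * m)) = E * z - E * z ^ 2 * w⁻¹ := by
      calc (E : ℂ) * (ξ * (z / w * m)) = E * (z / w * (ξ * m)) := by ring
        _ = _ := by rw [hξm]; field_simp
    have h6 : (z / w) ^ 2 * (w * T) = z ^ 2 * (w⁻¹ * T) := by field_simp
    rw [h5, h6]
    linear_combination z ^ 2 * hzm' + z ^ 2 * hwm
  simp only [Function.comp]
  rw [key]
  have : ((E : ℂ) * z).re = 0 := by rw [hzdef]; simp
  rw [Complex.sub_re, Complex.re_ofReal_mul, this, Complex.add_re, hre, Complex.one_re]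
  ring

/-- Monotone convergence for t² n²/(t²+n²), whose integral is n²(1 - n Im m(in)). The finite limit
gives integrability and the value at once. -/
lemma secondMoment_freeConv (hξ : 0 < ξ) (hmom : Integrable (fun x : ℝ => x ^ 2) μ) :
    Integrable (fun x : ℝ => x ^ 2) (freeConv μ ξ) ∧
      ∫ x, x ^ 2 ∂(freeConv μ ξ) = (∫ x, x ^ 2 ∂μ) + ξ := by
  have := isProbabilityMeasure_freeConv μ hξ
  set φ : ℕ → ℝ → ℝ := fun n t => t ^ 2 * ((n : ℝ) ^ 2 / (t ^ 2 + n ^ 2)) with hφ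
  have hφ0 : ∀ n t, 0 ≤ φ n t := fun n t => by simp only [hφ]; positivity
  have hlim : Tendsto (fun n : ℕ => ∫⁻ t, ENNReal.ofReal (φ n t) ∂(freeConv μ ξ)) atTop
      (𝓝 (∫⁻ t, ENNReal.ofReal (t ^ 2) ∂(freeConv μ ξ))) := by
    refine lintegral_tendsto_of_tendsto_of_monotone ?_ ?_ ?_
    · intro n
      simp only [hφ]
      fun_prop
    · refine ae_of_all _ fun t n m hnm => ENNReal.ofReal_le_ofReal ?_
      simp only [hφ]
      refine mul_le_mul_of_nonneg_left ?_ (sq_nonneg t)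
      have hnm' : (n : ℝ) ≤ m := by exact_mod_cast hnm
      rcases Nat.eq_zero_or_pos n with rfl | hn
      · simp; positivity
      have hn' : (0 : ℝ) < n := by exact_mod_cast hn
      have hm' : (0 : ℝ) < m := hn'.trans_le hnm'
      rw [div_le_div_iff₀ (by positivity) (by positivity)]
      have : (n : ℝ) ^ 2 ≤ (m : ℝ) ^ 2 := by gcongr
      nlinarith [sq_nonneg t]
    · refine ae_of_all _ fun t => (ENNReal.continuous_ofReal.tendsto _).comp ?_
      have h2 : Tendsto (fun n : ℕ => ((n : ℝ) ^ 2)⁻¹) atTop (𝓝 0) :=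
        ((tendsto_pow_atTop two_ne_zero).comp tendsto_natCast_atTop_atTop).inv_tendsto_atTop
      have h3 := (((h2.const_mul (t ^ 2)).const_add 1).inv₀ (by simp)).const_mul (t ^ 2)
      simp only [mul_zero, add_zero, inv_one, mul_one] at h3
      refine h3.congr' ?_
      filter_upwards [eventually_gt_atTop 0] with n hn
      have hn' : (n : ℝ) ≠ 0 := by exact_mod_cast hn.ne'
      simp only [hφ]
      congr 1
      field_simp
      ring
  have hval : ∀ᶠ n : ℕ in atTop, ENNReal.ofReal ((n : ℝ) ^ 2 * (1 - (n : ℝ) *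
      (freeResolvent μ ξ ((n : ℝ) * Complex.I)).im)) =
      ∫⁻ t, ENNReal.ofReal (φ n t) ∂(freeConv μ ξ) := by
    filter_upwards [eventually_gt_atTop 0] with n hn
    have hn0 : (0 : ℝ) < n := by exact_mod_cast hn
    have hn' : 0 < (((n : ℝ) : ℂ) * Complex.I).im := by simpa using hn
    have hsq := integrable_norm_inv_sq (freeConv μ ξ) hn'
    have e : ∀ t : ℝ, φ n t =
        (n : ℝ) ^ 2 * (1 - (n : ℝ) ^ 2 * ‖((t : ℂ) - (n : ℝ) * Complex.I)⁻¹‖ ^ 2) := by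
      intro t
      rw [norm_inv_ofReal_sub_sq]
      simp only [hφ, Complex.mul_re, Complex.ofReal_re, Complex.I_re, mul_zero, Complex.ofReal_im,
        Complex.I_im, mul_one, sub_self, sub_zero, Complex.mul_im, add_zero]
      field_simp
      ring
    have hi : Integrable (φ n) (freeConv μ ξ) := by
      refine (((integrable_const (1 : ℝ)).sub (hsq.const_mul ((n : ℝ) ^ 2))).const_mul
        ((n : ℝ) ^ 2)).congr (ae_of_all _ fun t => (e t).symm)
    rw [← ofReal_integral_eq_lintegral_ofReal hi (ae_of_all _ (hφ0 n))]
    congr 1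
    simp_rw [e]
    rw [integral_const_mul, integral_sub (integrable_const _) (hsq.const_mul _),
      integral_const_mul, ← sqResolvent, ← resolventTransform_freeConv μ hξ hn',
      im_resolventTransform _ hn', show (((n : ℝ) : ℂ) * Complex.I).im = n by simp]
    simp only [integral_const, probReal_univ, smul_eq_mul, mul_one]
    ring
  have hlim2 : Tendsto (fun n : ℕ => ∫⁻ t, ENNReal.ofReal (φ n t) ∂(freeConv μ ξ)) atTop
      (𝓝 (ENNReal.ofReal ((∫ x, x ^ 2 ∂μ) + ξ))) := by
    have h1 := (tendsto_sq_mul_one_sub μ hξ hmom).comp tendsto_natCast_atTop_atTop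
    exact ((ENNReal.continuous_ofReal.tendsto _).comp h1).congr' hval
  have heq := tendsto_nhds_unique hlim hlim2
  have hQ : 0 ≤ (∫ x, x ^ 2 ∂μ) + ξ := add_nonneg (integral_nonneg fun _ => sq_nonneg _) hξ.le
  have hint : Integrable (fun x : ℝ => x ^ 2) (freeConv μ ξ) := by
    refine (lintegral_ofReal_ne_top_iff_integrable (by fun_prop)
      (ae_of_all _ fun t => sq_nonneg t)).1 ?_
    rw [heq]; exact ENNReal.ofReal_ne_top
  refine ⟨hint, ?_⟩
  rw [← ofReal_integral_eq_lintegral_ofReal hint (ae_of_all _ fun t => sq_nonneg t)] at heq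
  exact (ENNReal.ofReal_eq_ofReal_iff (integral_nonneg fun _ => sq_nonneg _) hQ).1 heq

end SecondMoment

/-! ### A law is determined by its Stieltjes transform. -/

section Uniqueness

lemma norm_inv_sq_mul_I {y : ℝ} (x t : ℝ) :
    ‖((t : ℂ) - (x + y * Complex.I))⁻¹‖ ^ 2 = ((t - x) ^ 2 + y ^ 2)⁻¹ := by
  rw [norm_inv_ofReal_sub_sq]; simp

lemma integrable_cauchyKernel {y : ℝ} (hy : 0 < y) (t : ℝ) :
    Integrable fun x : ℝ => y * ((t - x) ^ 2 + y ^ 2)⁻¹ := by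
  have hz : 0 < ((t : ℂ) + y * Complex.I).im := by simpa
  have := (integrable_norm_inv_sq_volume hz).const_mul y
  refine this.congr (ae_of_all _ fun x => ?_)
  simp only [norm_inv_sq_mul_I]
  congr 3; ring

lemma integral_cauchyKernel {y : ℝ} (hy : 0 < y) (t : ℝ) :
    ∫ x : ℝ, y * ((t - x) ^ 2 + y ^ 2)⁻¹ = Real.pi := by
  have hz : 0 < ((t : ℂ) + y * Complex.I).im := by simpa
  have h := integral_norm_inv_sq_volume hz
  simp only [norm_inv_sq_mul_I, Complex.add_im, Complex.ofReal_im, Complex.mul_im,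
    Complex.ofReal_re, Complex.I_im, mul_one, Complex.I_re, mul_zero, add_zero, zero_add] at h
  rw [integral_const_mul]
  simp_rw [show ∀ x : ℝ, (t - x) ^ 2 = (x - t) ^ 2 from fun x => by ring]
  rw [h]
  field_simp

/-- Fubini moves the Poisson kernel from the test function to the measure, where it becomes Im of
the Stieltjes transform. -/
lemma integral_poisson_eq (ρ : Measure ℝ) [IsProbabilityMeasure ρ] (f : BoundedContinuousFunction ℝ ℝ)
    {y : ℝ} (hy : 0 < y) :
    ∫ t, (∫ x : ℝ, f x * (y * ((t - x) ^ 2 + y ^ 2)⁻¹)) ∂ρ =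
      ∫ x : ℝ, f x * (resolventTransform ρ (x + y * Complex.I)).im := by
  have hmeas : Measurable (Function.uncurry fun (t x : ℝ) =>
      f x * (y * ((t - x) ^ 2 + y ^ 2)⁻¹)) := by
    have := f.continuous.measurable
    unfold Function.uncurry
    fun_prop
  have hle : ∀ t x : ℝ, ‖f x * (y * ((t - x) ^ 2 + y ^ 2)⁻¹)‖ ≤
      ‖f‖ * (y * ((t - x) ^ 2 + y ^ 2)⁻¹) := by
    intro t x
    rw [norm_mul, Real.norm_of_nonneg (show 0 ≤ y * ((t - x) ^ 2 + y ^ 2)⁻¹ by positivity)]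
    gcongr
    exact f.norm_coe_le_norm x
  have hin : ∀ t : ℝ, Integrable fun x : ℝ => f x * (y * ((t - x) ^ 2 + y ^ 2)⁻¹) := fun t =>
    ((integrable_cauchyKernel hy t).const_mul ‖f‖).mono'
      (hmeas.comp measurable_prodMk_left).aestronglyMeasurable (ae_of_all _ (hle t))
  have hint : Integrable (Function.uncurry fun (t x : ℝ) =>
      f x * (y * ((t - x) ^ 2 + y ^ 2)⁻¹)) (ρ.prod volume) := by
    rw [integrable_prod_iff hmeas.aestronglyMeasurable]
    refine ⟨ae_of_all _ hin, ?_⟩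
    refine Integrable.of_bound
      (hmeas.norm.aestronglyMeasurable.integral_prod_right') (‖f‖ * Real.pi)
      (ae_of_all _ fun t => ?_)
    rw [Real.norm_of_nonneg (integral_nonneg fun _ => norm_nonneg _),
      ← integral_cauchyKernel hy t, ← integral_const_mul]
    exact integral_mono (hin t).norm ((integrable_cauchyKernel hy t).const_mul _) (hle t)
  rw [integral_integral_swap hint]
  refine integral_congr_ae (ae_of_all _ fun x => ?_)
  have hz : 0 < ((x : ℂ) + y * Complex.I).im := by simpa
  simp only [im_resolventTransform ρ hz, sqResolvent, norm_inv_sq_mul_I]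
  rw [integral_const_mul, integral_const_mul]
  simp

lemma tendsto_poisson (ρ : Measure ℝ) [IsProbabilityMeasure ρ]
    (f : BoundedContinuousFunction ℝ ℝ) :
    Tendsto (fun y : ℝ => ∫ t, (∫ x : ℝ, f x * (y * ((t - x) ^ 2 + y ^ 2)⁻¹)) ∂ρ) (𝓝[>] 0)
      (𝓝 (∫ t, f t * Real.pi ∂ρ)) := by
  have e : ∀ y : ℝ, 0 < y → ∀ t : ℝ, ∫ x : ℝ, f x * (y * ((t - x) ^ 2 + y ^ 2)⁻¹) =
      ∫ s : ℝ, f (t + y * s) * (1 + s ^ 2)⁻¹ := by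
    intro y hy t
    have h3 := Measure.integral_comp_mul_left
      (fun u => f (t + u) * (1 + (y⁻¹ * u) ^ 2)⁻¹) y
    have h4 := integral_add_left_eq_self (μ := volume)
      (fun x => f x * (1 + (y⁻¹ * (x - t)) ^ 2)⁻¹) t
    simp only [add_sub_cancel_left, inv_mul_cancel_left₀ hy.ne'] at h3 h4
    rw [h3, h4, smul_eq_mul, abs_of_pos (inv_pos.2 hy), ← integral_const_mul]
    refine integral_congr_ae (ae_of_all _ fun x => ?_)
    simp only
    have : y * ((t - x) ^ 2 + y ^ 2)⁻¹ = y⁻¹ * (1 + (y⁻¹ * (x - t)) ^ 2)⁻¹ := by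
      field_simp
      ring
    rw [this]; ring
  have hb : ∀ y t s : ℝ, ‖f (t + y * s) * (1 + s ^ 2)⁻¹‖ ≤ ‖f‖ * (1 + s ^ 2)⁻¹ := by
    intro y t s
    rw [norm_mul, Real.norm_of_nonneg (show 0 ≤ (1 + s ^ 2)⁻¹ by positivity)]
    gcongr
    exact f.norm_coe_le_norm _
  have hfm := f.continuous.measurable
  have hlim : Tendsto (fun y : ℝ => ∫ t, (∫ s : ℝ, f (t + y * s) * (1 + s ^ 2)⁻¹) ∂ρ) (𝓝[>] 0)
      (𝓝 (∫ t, f t * Real.pi ∂ρ)) := by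
    refine tendsto_integral_filter_of_dominated_convergence (fun _ => ‖f‖ * Real.pi) ?_ ?_
      (integrable_const _) ?_
    · refine Eventually.of_forall fun y => ?_
      have hm : Measurable fun p : ℝ × ℝ => f (p.1 + y * p.2) * (1 + p.2 ^ 2)⁻¹ := by fun_prop
      exact (hm.stronglyMeasurable.integral_prod_right' (ν := volume)).aestronglyMeasurable
    · refine Eventually.of_forall fun y => ae_of_all _ fun t => ?_
      have := norm_integral_le_of_norm_le (integrable_inv_one_add_sq.const_mul ‖f‖)
        (ae_of_all _ (hb y t))
      rwa [integral_const_mul, integral_univ_inv_one_add_sq] at this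
    · refine ae_of_all _ fun t => ?_
      rw [← integral_univ_inv_one_add_sq, ← integral_const_mul]
      refine tendsto_integral_filter_of_dominated_convergence (fun s => ‖f‖ * (1 + s ^ 2)⁻¹) ?_
        (Eventually.of_forall fun y => ae_of_all _ (hb y t))
        (integrable_inv_one_add_sq.const_mul ‖f‖) ?_
      · exact Eventually.of_forall fun y => (by fun_prop : Measurable _).aestronglyMeasurable
      · refine ae_of_all _ fun s => Tendsto.mul_const _ ?_
        have : Continuous fun y : ℝ => f (t + y * s) := by fun_prop
        have h := this.tendsto 0
        simp only [zero_mul, add_zero] at h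
        exact h.mono_left nhdsWithin_le_nhds
  refine hlim.congr' ?_
  filter_upwards [self_mem_nhdsWithin] with y hy
  simp_rw [e y hy]

/-- A probability measure is determined by its Stieltjes transform on the upper half-plane. -/
theorem ext_of_resolventTransform {ρ ρ' : Measure ℝ} [IsProbabilityMeasure ρ]
    [IsProbabilityMeasure ρ']
    (h : ∀ z : ℂ, 0 < z.im → resolventTransform ρ z = resolventTransform ρ' z) : ρ = ρ' := by
  refine ext_of_forall_integral_eq_of_IsFiniteMeasure fun f => ?_
  have h1 := tendsto_poisson ρ f
  have h2 := tendsto_poisson ρ' f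
  have h3 := tendsto_nhds_unique h1 (h2.congr' (by
    filter_upwards [self_mem_nhdsWithin] with y hy
    rw [integral_poisson_eq ρ f hy, integral_poisson_eq ρ' f hy]
    refine integral_congr_ae (ae_of_all _ fun x => ?_)
    have hy' : 0 < y := hy
    simp only [h _ (show 0 < ((x : ℂ) + y * Complex.I).im by simpa)]))
  rw [integral_mul_const, integral_mul_const] at h3
  exact mul_right_cancel₀ Real.pi_ne_zero h3

/-- Removes the quantifier over ρ from the long-time equations. -/
lemma isFreeSemicircleConv_iff (μ : Measure ℝ) [IsProbabilityMeasure μ] {ξ : ℝ} (hξ : 0 < ξ)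
    (ρ : Measure ℝ) : IsFreeSemicircleConv μ ξ ρ ↔ ρ = freeConv μ ξ := by
  refine ⟨fun h => ?_, fun h => h ▸ isFreeSemicircleConv_freeConv μ hξ⟩
  have := h.1
  have := isProbabilityMeasure_freeConv μ hξ
  exact ext_of_resolventTransform fun z hz => by
    rw [h.resolventTransform_eq hξ hz, resolventTransform_freeConv μ hξ hz]

end Uniqueness

/-! ### Logarithmic potentials: counting mass beyond a point of the spectral gap. -/

section LogPotential

/-- The logarithmic potential `∫ log(-i(z - t)) dμ(t)` on the upper half-plane. -/
noncomputable def logPotential (μ : Measure ℝ) (z : ℂ) : ℂ :=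
  ∫ t : ℝ, Complex.log (-Complex.I * (z - t)) ∂μ

/-- The factor -i places z - t in the right half-plane, where the principal logarithm is
holomorphic. -/
lemma neg_I_mul_re (z : ℂ) (t : ℝ) : (-Complex.I * (z - t)).re = z.im := by simp

lemma neg_I_mul_im (z : ℂ) (t : ℝ) : (-Complex.I * (z - t)).im = t - z.re := by simp

lemma norm_log_le {z : ℂ} (hz : 0 < z.im) (t : ℝ) :
    ‖Complex.log (-Complex.I * (z - t))‖ ≤ ‖z‖ + |t| + |Real.log z.im| + Real.pi := by
  set u := -Complex.I * (z - t) with hu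
  have hnorm : ‖u‖ = ‖z - t‖ := by rw [hu, norm_mul, norm_neg, Complex.norm_I, one_mul]
  have h1 : ‖Complex.log u‖ ≤ |Real.log ‖u‖| + |u.arg| := by
    refine (Complex.norm_le_abs_re_add_abs_im _).trans ?_
    rw [Complex.log_re, Complex.log_im]
  have h2 : |u.arg| ≤ Real.pi := Complex.abs_arg_le_pi u
  have h3 : z.im ≤ ‖u‖ := by
    have := Complex.re_le_norm u
    rwa [hu, neg_I_mul_re, ← hu] at this
  have h4 : ‖u‖ ≤ ‖z‖ + |t| := by
    rw [hnorm]
    refine (norm_sub_le _ _).trans ?_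
    rw [Complex.norm_real, Real.norm_eq_abs]
  have h5 : |Real.log ‖u‖| ≤ ‖z‖ + |t| + |Real.log z.im| := by
    have hu0 : 0 < ‖u‖ := hz.trans_le h3
    rw [abs_le]
    constructor
    · have := Real.log_le_log hz h3
      have := neg_abs_le (Real.log z.im)
      have : 0 ≤ ‖z‖ + |t| := by positivity
      linarith
    · have := Real.log_le_sub_one_of_pos hu0
      have := abs_nonneg (Real.log z.im)
      linarith
  linarith

variable (μ : Measure ℝ) [IsProbabilityMeasure μ]

lemma continuous_log_kernel {z : ℂ} (hz : 0 < z.im) :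
    Continuous fun t : ℝ => Complex.log (-Complex.I * (z - t)) := by
  refine Continuous.clog (by fun_prop) fun t => Or.inl ?_
  rwa [neg_I_mul_re]

lemma integrable_log_kernel (hint : Integrable (fun x : ℝ => x) μ) {z : ℂ} (hz : 0 < z.im) :
    Integrable (fun t : ℝ => Complex.log (-Complex.I * (z - t))) μ := by
  refine ((((integrable_const ‖z‖).add hint.norm).add (integrable_const |Real.log z.im|)).add
    (integrable_const Real.pi)).mono'
    (continuous_log_kernel hz).aestronglyMeasurable (ae_of_all _ fun t => norm_log_le hz t)

lemma hasDerivAt_logPotential (hint : Integrable (fun x : ℝ => x) μ) {z : ℂ} (hz : 0 < z.im) :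
    HasDerivAt (logPotential μ) (-resolventTransform μ z) z := by
  have hball : ∀ w ∈ Metric.ball z (z.im / 2), z.im / 2 < w.im := by
    intro w hw
    rw [Metric.mem_ball, dist_eq_norm] at hw
    have := (Complex.abs_im_le_norm (w - z)).trans_lt hw
    rw [Complex.sub_im, abs_lt] at this
    linarith
  have h := hasDerivAt_integral_of_dominated_loc_of_deriv_le (μ := μ) (𝕜 := ℂ)
    (F := fun (w : ℂ) (t : ℝ) => Complex.log (-Complex.I * (w - t)))
    (F' := fun (w : ℂ) (t : ℝ) => -((t : ℂ) - w)⁻¹)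
    (bound := fun _ => (z.im / 2)⁻¹) (x₀ := z)
    (Metric.ball_mem_nhds z (half_pos hz)) ?_ (integrable_log_kernel μ hint hz) ?_ ?_
    (integrable_const _) ?_
  · have h2 := h.2
    rw [integral_neg, ← resolventTransform_eq] at h2
    exact h2
  · filter_upwards [isOpen_upper.mem_nhds (show z ∈ upper from hz)] with w hw
    exact (continuous_log_kernel hw).aestronglyMeasurable
  · exact (continuous_inv_ofReal_sub hz).neg.aestronglyMeasurable
  · refine ae_of_all _ fun t w hw => ?_
    have hw' := hball w hw
    rw [norm_neg]
    refine (norm_inv_ofReal_sub_le ((half_pos hz).trans hw') t).trans ?_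
    exact inv_anti₀ (half_pos hz) hw'.le
  · refine ae_of_all _ fun t w hw => ?_
    have hw' : 0 < w.im := (half_pos hz).trans (hball w hw)
    have h1 : HasDerivAt (fun w : ℂ => -Complex.I * (w - t)) (-Complex.I * 1) w :=
      ((hasDerivAt_id w).sub_const _).const_mul _
    have h2 := h1.clog (Or.inl (by rwa [neg_I_mul_re]))
    have h4 : w - t ≠ 0 := by
      rw [← neg_sub]; exact neg_ne_zero.2 (ofReal_sub_ne_zero hw' t)
    have e : -Complex.I * 1 / (-Complex.I * (w - t)) = -((t : ℂ) - w)⁻¹ := by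
      rw [mul_div_mul_left _ _ (neg_ne_zero.2 Complex.I_ne_zero), one_div, ← inv_neg, neg_sub]
    rw [e] at h2
    exact h2

lemma im_logPotential (hint : Integrable (fun x : ℝ => x) μ) {z : ℂ} (hz : 0 < z.im) :
    (logPotential μ z).im = ∫ t : ℝ, (-Complex.I * (z - t)).arg ∂μ := by
  have := integral_im (integrable_log_kernel μ hint hz)
  simp only [RCLike.im_to_complex, Complex.log_im] at this
  rw [logPotential, ← this]

lemma tendsto_im_logPotential (hint : Integrable (fun x : ℝ => x) μ) {ι : Type*} {l : Filter ι}
    [l.IsCountablyGenerated] {w : ι → ℂ} (hw : ∀ᶠ i in l, 0 < (w i).im) {g : ℝ → ℝ}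
    (hg : ∀ᵐ t : ℝ ∂μ, Tendsto (fun i => (-Complex.I * (w i - t)).arg) l (𝓝 (g t))) :
    Tendsto (fun i => (logPotential μ (w i)).im) l (𝓝 (∫ t, g t ∂μ)) := by
  have h : Tendsto (fun i => ∫ t : ℝ, (-Complex.I * (w i - t)).arg ∂μ) l (𝓝 (∫ t, g t ∂μ)) := by
    refine tendsto_integral_filter_of_dominated_convergence (fun _ => Real.pi) ?_ ?_
      (integrable_const _) hg
    · filter_upwards [hw] with i hi
      have h := Complex.continuous_im.comp (continuous_log_kernel hi)
      have e : (fun t : ℝ => (-Complex.I * (w i - t)).arg) =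
          (Complex.im ∘ fun t : ℝ => Complex.log (-Complex.I * (w i - t))) := by
        funext t; simp [Complex.log_im]
      rw [e]
      exact h.aestronglyMeasurable
    · exact Eventually.of_forall fun i => ae_of_all _ fun t => Complex.abs_arg_le_pi _
  refine h.congr' ?_
  filter_upwards [hw] with i hi
  rw [im_logPotential μ hint hi]

lemma tendsto_arg_vertical {w : ℝ → ℂ} (him : ∀ᶠ y in atTop, y ≤ (w y).im) {C : ℝ}
    (hre : ∀ᶠ y in atTop, |(w y).re| ≤ C) (t : ℝ) :
    Tendsto (fun y => (-Complex.I * (w y - t)).arg) atTop (𝓝 0) := by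
  have hb : Tendsto (fun y : ℝ => Real.arcsin ((|t| + C) / y)) atTop (𝓝 0) := by
    have h1 : Tendsto (fun y : ℝ => (|t| + C) / y) atTop (𝓝 0) :=
      tendsto_const_nhds.div_atTop tendsto_id
    have := (Real.continuous_arcsin.tendsto 0).comp h1
    rwa [Real.arcsin_zero] at this
  refine squeeze_zero_norm' ?_ hb
  filter_upwards [him, hre, eventually_gt_atTop 0] with y h1 h2 hy
  set u := -Complex.I * (w y - t) with hu
  have hur : u.re = (w y).im := neg_I_mul_re _ _
  have hui : u.im = t - (w y).re := neg_I_mul_im _ _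
  rw [Real.norm_eq_abs, Complex.arg_of_re_nonneg (by rw [hur]; linarith)]
  have h3 : |u.im / ‖u‖| ≤ (|t| + C) / y := by
    rw [abs_div, abs_norm, hui]
    have : y ≤ ‖u‖ := h1.trans (hur ▸ Complex.re_le_norm u)
    have : |t - (w y).re| ≤ |t| + C := (abs_sub _ _).trans (by linarith)
    have := (abs_nonneg _).trans this
    gcongr
  rw [abs_le] at h3 ⊢
  constructor
  · rw [← Real.arcsin_neg]; exact Real.monotone_arcsin h3.1
  · exact Real.monotone_arcsin h3.2

variable {ξ : ℝ}

/-- The explicit formula for the logarithmic potential of the free convolution. -/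
lemma im_logPotential_freeConv (hξ : 0 < ξ) (hmom : Integrable (fun x : ℝ => x ^ 2) μ) {z : ℂ}
    (hz : 0 < z.im) : (logPotential (freeConv μ ξ) z).im =
      (logPotential μ (subord μ ξ z)).im + (ξ / 2 * freeResolvent μ ξ z ^ 2).im := by
  have := isProbabilityMeasure_freeConv μ hξ
  have hint := integrable_id_of_sq hmom
  have hint' := integrable_id_of_sq (secondMoment_freeConv μ hξ hmom).1
  -- Its derivative is -m + m(1 + ξm') - ξmm' = 0, since ω' = 1 + ξm'. The imaginary part of the
  -- constant is read off at i∞, where all arguments tend to 0.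
  set Φ : ℂ → ℂ := fun z => logPotential (freeConv μ ξ) z - logPotential μ (subord μ ξ z)
    - ξ / 2 * freeResolvent μ ξ z ^ 2 with hΦ
  have hd : ∀ w ∈ upper, HasDerivAt Φ 0 w := by
    intro w hw
    obtain ⟨d, hd⟩ := hasDerivAt_subord μ hξ hw
    obtain ⟨m', hm'⟩ : ∃ m', HasDerivAt (freeResolvent μ ξ) m' w :=
      ⟨_, (differentiableAt_freeResolvent μ hξ hw).hasDerivAt⟩
    have hdm : d = 1 + ξ * m' := by
      have h1 : HasDerivAt (fun u : ℂ => u + ξ * freeResolvent μ ξ u) (1 + ξ * m') w :=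
        (hasDerivAt_id w).add (hm'.const_mul _)
      refine hd.unique (h1.congr_of_eventuallyEq ?_)
      filter_upwards [isOpen_upper.mem_nhds hw] with u hu
      exact subord_eq μ hξ hu
    have h1 := hasDerivAt_logPotential (freeConv μ ξ) hint' hw
    have h2 := (hasDerivAt_logPotential μ hint (im_subord_pos μ hξ hw)).comp w hd
    have h3 := ((hm'.pow 2).const_mul ((ξ : ℂ) / 2))
    have h4 := (h1.sub h2).sub h3
    rw [resolventTransform_freeConv μ hξ hw, ← freeResolvent, hdm] at h4
    have e : ∀ a b : ℂ, -a - -a * (1 + ξ * b) - (ξ : ℂ) / 2 * (((2 : ℕ) : ℂ) * a ^ (2 - 1) * b) = 0 := by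
      intro a b
      push_cast
      ring
    rw [e] at h4
    exact h4
  have hconst : ∀ w ∈ upper, Φ w = Φ z := by
    intro w hw
    refine convex_upper.is_const_of_fderivWithin_eq_zero (𝕜 := ℂ)
      (fun u hu => (hd u hu).differentiableAt.differentiableWithinAt) ?_ hw hz
    intro u hu
    rw [fderivWithin_of_isOpen isOpen_upper hu]
    have := (hd u hu).hasFDerivAt.fderiv
    rw [this]
    ext
    simp
  have him : ∀ y : ℝ, ((y : ℂ) * Complex.I).im = y := by simp
  have hlim : Tendsto (fun y : ℝ => (Φ (y * Complex.I)).im) atTop (𝓝 0) := by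
    have hypos : ∀ᶠ y : ℝ in atTop, 0 < ((y : ℂ) * Complex.I).im := by
      filter_upwards [eventually_gt_atTop 0] with y hy
      rwa [him]
    have h1 : Tendsto (fun y : ℝ => (logPotential (freeConv μ ξ) (y * Complex.I)).im) atTop
        (𝓝 0) := by
      have := tendsto_im_logPotential (freeConv μ ξ) hint' (l := atTop)
        (w := fun y : ℝ => (y : ℂ) * Complex.I) (g := fun _ => 0) hypos
        (ae_of_all _ fun t => tendsto_arg_vertical (w := fun y : ℝ => (y : ℂ) * Complex.I) (C := 0)
          (Eventually.of_forall fun y => (him y).ge) (Eventually.of_forall fun y => by simp) t)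
      simpa using this
    have hre : ∀ᶠ y : ℝ in atTop, |(subord μ ξ (y * Complex.I)).re| ≤ √ξ := by
      filter_upwards [hypos] with y hy
      have h := (Complex.abs_re_le_norm _).trans (norm_subord_sub_le μ hξ hy)
      simpa using h
    have hle : ∀ᶠ y : ℝ in atTop, y ≤ (subord μ ξ (y * Complex.I)).im := by
      filter_upwards [hypos] with y hy
      have := im_le_im_subord μ hξ hy
      rwa [him] at this
    have h2 : Tendsto (fun y : ℝ => (logPotential μ (subord μ ξ (y * Complex.I))).im) atTop
        (𝓝 0) := by
      have := tendsto_im_logPotential μ hint (l := atTop)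
        (w := fun y : ℝ => subord μ ξ (y * Complex.I)) (g := fun _ => 0)
        (hypos.mono fun y hy => im_subord_pos μ hξ hy)
        (ae_of_all _ fun t => tendsto_arg_vertical hle hre t)
      simpa using this
    have h3 := (Complex.continuous_im.tendsto _).comp
      (((tendsto_freeResolvent_zero μ hξ).pow 2).const_mul ((ξ : ℂ) / 2))
    have h4 := (h1.sub h2).sub h3
    simp only [ne_eq, OfNat.ofNat_ne_zero, not_false_eq_true, zero_pow, mul_zero, Complex.zero_im,
      sub_zero] at h4
    exact h4
  have h0 : (Φ z).im = 0 := by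
    refine tendsto_nhds_unique (tendsto_const_nhds.congr' ?_) hlim
    filter_upwards [eventually_gt_atTop 0] with y hy
    rw [hconst _ (show ((y : ℂ) * Complex.I) ∈ upper by simpa [upper])]
  simp only [hΦ, Complex.sub_im] at h0
  linarith

/-- The limiting argument is a step function of t, so the imaginary part of the potential at a real
point counts the mass to its right. -/
lemma arg_of_tendsto_real {w : ℝ → ℂ} {l : Filter ℝ} {u t : ℝ} (hw : Tendsto w l (𝓝 (u : ℂ)))
    (hut : u ≠ t) : Tendsto (fun y => (-Complex.I * (w y - t)).arg) l
      (𝓝 (if t < u then -(Real.pi / 2) else Real.pi / 2)) := by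
  have h1 : Tendsto (fun y => -Complex.I * (w y - t)) l (𝓝 (-Complex.I * ((u : ℂ) - t))) :=
    (hw.sub_const _).const_mul _
  have hs : -Complex.I * ((u : ℂ) - t) ∈ Complex.slitPlane := by
    refine Or.inr ?_
    rw [neg_I_mul_im, Complex.ofReal_re]
    exact sub_ne_zero.2 hut.symm
  have h2 := (Complex.continuousAt_arg hs).tendsto.comp h1
  have h3 : (-Complex.I * ((u : ℂ) - t)).arg = if t < u then -(Real.pi / 2) else Real.pi / 2 := by
    split_ifs with h
    · have : -Complex.I * ((u : ℂ) - t) = ((u - t : ℝ) : ℂ) * (-Complex.I) := by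
        push_cast; ring
      rw [this, Complex.arg_real_mul _ (sub_pos.2 h), Complex.arg_neg_I]
    · have h' : 0 < t - u := sub_pos.2 (lt_of_le_of_ne (not_lt.1 h) hut)
      have : -Complex.I * ((u : ℂ) - t) = ((t - u : ℝ) : ℂ) * Complex.I := by
        push_cast; ring
      rw [this, Complex.arg_real_mul _ h', Complex.arg_I]
  rw [h3] at h2
  exact h2

/-- Outside the bulk, the mass on the right of `x` is transported by the subordination map. -/
lemma real_Ici_freeConv (hξ : 0 < ξ) (hmom : Integrable (fun x : ℝ => x ^ 2) μ) {x : ℝ}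
    (him : (resolventExt μ ξ x).im = 0)
    (hatom : μ {x + ξ * (resolventExt μ ξ x).re} = 0) :
    (freeConv μ ξ).real (Ici x) = μ.real (Ici (x + ξ * (resolventExt μ ξ x).re)) := by
  have := isProbabilityMeasure_freeConv μ hξ
  have hint := integrable_id_of_sq hmom
  have hint' := integrable_id_of_sq (secondMoment_freeConv μ hξ hmom).1
  set u := x + ξ * (resolventExt μ ξ x).re with hu
  have hreal : resolventExt μ ξ x = ((resolventExt μ ξ x).re : ℂ) := by
    apply Complex.ext <;> simp [him]
  have hpos : ∀ᶠ ε : ℝ in 𝓝[>] (0 : ℝ), 0 < ((x : ℂ) + ε * Complex.I).im := by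
    filter_upwards [self_mem_nhdsWithin] with ε hε
    simpa using hε
  have htx : Tendsto (fun ε : ℝ => (x : ℂ) + ε * Complex.I) (𝓝[>] 0) (𝓝 (x : ℂ)) :=
    (tendsto_add_mul_I x).mono_right nhdsWithin_le_nhds
  have hsub : Tendsto (fun ε : ℝ => subord μ ξ (x + ε * Complex.I)) (𝓝[>] 0) (𝓝 (u : ℂ)) := by
    have h := (tendsto_subord_ofReal μ hξ x).comp (tendsto_add_mul_I x)
    rw [hreal] at h
    rw [hu]; push_cast
    exact h
  have hval : ∀ (ρ : Measure ℝ) [IsProbabilityMeasure ρ] (v : ℝ),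
      ∫ t, (if t < v then -(Real.pi / 2) else Real.pi / 2) ∂ρ =
        Real.pi * ρ.real (Ici v) - Real.pi / 2 := by
    intro ρ _ v
    have e : (fun t : ℝ => if t < v then -(Real.pi / 2) else Real.pi / 2) =
        fun t => (Ici v).indicator (fun _ => Real.pi) t - Real.pi / 2 := by
      funext t
      by_cases h : t < v
      · rw [if_pos h, indicator_of_notMem (by simpa using h)]; ring
      · rw [if_neg h, indicator_of_mem (by simpa using h)]; ring
    rw [e, integral_sub ((integrable_const _).indicator measurableSet_Ici) (integrable_const _),
      integral_indicator measurableSet_Ici]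
    simp [mul_comm]
  have h1 := tendsto_im_logPotential (freeConv μ ξ) hint' hpos
    (g := fun t : ℝ => if t < x then -(Real.pi / 2) else Real.pi / 2) (by
      have : ∀ᵐ t : ℝ ∂(freeConv μ ξ), x ≠ t := by
        rw [ae_iff]
        have : {a : ℝ | ¬x ≠ a} = {x} := by ext; simp [eq_comm]
        rw [this]
        exact withDensity_absolutelyContinuous _ _ (by simp)
      filter_upwards [this] with t ht
      exact arg_of_tendsto_real htx ht)
  have h2 := tendsto_im_logPotential μ hint (hpos.mono fun ε hε => im_subord_pos μ hξ hε)
    (g := fun t : ℝ => if t < u then -(Real.pi / 2) else Real.pi / 2) (by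
      have : ∀ᵐ t : ℝ ∂μ, u ≠ t := by
        rw [ae_iff]
        have : {a : ℝ | ¬u ≠ a} = {u} := by ext; simp [eq_comm]
        rwa [this]
      filter_upwards [this] with t ht
      exact arg_of_tendsto_real hsub ht)
  have h3 := (Complex.continuous_im.tendsto _).comp
    ((((tendsto_resolventExt_ofReal μ hξ x).comp (tendsto_add_mul_I x)).pow 2).const_mul
      ((ξ : ℂ) / 2))
  -- Where m is real the quadratic term in `im_logPotential_freeConv` is real, so only the two
  -- counting functions remain.
  have h4 : ((ξ : ℂ) / 2 * resolventExt μ ξ x ^ 2).im = 0 := by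
    rw [hreal]
    have : (ξ : ℂ) / 2 * ((resolventExt μ ξ x).re : ℂ) ^ 2 =
      ((ξ / 2 * (resolventExt μ ξ x).re ^ 2 : ℝ) : ℂ) := by push_cast; ring
    rw [this, Complex.ofReal_im]
  rw [h4] at h3
  have h5 := tendsto_nhds_unique h1 ((h2.add h3).congr' (by
    filter_upwards [hpos] with ε hε
    exact (im_logPotential_freeConv μ hξ hmom hε).symm))
  rw [hval, hval, add_zero] at h5
  have := mul_left_cancel₀ Real.pi_ne_zero (show Real.pi * (freeConv μ ξ).real (Ici x) =
    Real.pi * μ.real (Ici u) by linarith)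
  exact this

end LogPotential

/-! ### The teacher law with an atom at 0: spectral gap and mass of the bulk. -/

section Mixture

/-- The mixture `(1 - k) δ₀ + k ν`. -/
noncomputable def atomMix (k : ℝ) (ν : Measure ℝ) : Measure ℝ :=
  ENNReal.ofReal (1 - k) • Measure.dirac 0 + ENNReal.ofReal k • ν

variable {k : ℝ} {ν : Measure ℝ} [IsProbabilityMeasure ν]

lemma isProbabilityMeasure_atomMix (hk0 : 0 ≤ k) (hk1 : k ≤ 1) :
    IsProbabilityMeasure (atomMix k ν) := by
  refine ⟨?_⟩
  simp only [atomMix, Measure.add_apply, Measure.smul_apply, measure_univ, smul_eq_mul, mul_one]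
  rw [← ENNReal.ofReal_add (by linarith) hk0]
  simp

lemma integrable_atomMix {ν : Measure ℝ} {E : Type*} [NormedAddCommGroup E] {F : ℝ → E}
    (hF : Integrable F ν) : Integrable F (atomMix k ν) :=
  ((integrable_dirac (by simp)).smul_measure ENNReal.ofReal_ne_top).add_measure
    (hF.smul_measure ENNReal.ofReal_ne_top)

lemma integral_atomMix {ν : Measure ℝ} (hk0 : 0 ≤ k) (hk1 : k ≤ 1) {E : Type*} [NormedAddCommGroup E]
    [NormedSpace ℝ E] [CompleteSpace E] {F : ℝ → E} (hF : Integrable F ν) :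
    ∫ x, F x ∂(atomMix k ν) = (1 - k) • F 0 + k • ∫ x, F x ∂ν := by
  rw [atomMix, integral_add_measure ((integrable_dirac (by simp)).smul_measure ENNReal.ofReal_ne_top)
    (hF.smul_measure ENNReal.ofReal_ne_top), integral_smul_measure, integral_smul_measure,
    integral_dirac, ENNReal.toReal_ofReal (by linarith), ENNReal.toReal_ofReal hk0]

lemma sqResolvent_atomMix (hk0 : 0 ≤ k) (hk1 : k ≤ 1) {w : ℂ} (hw : 0 < w.im) :
    sqResolvent (atomMix k ν) w = (1 - k) * ‖w⁻¹‖ ^ 2 + k * sqResolvent ν w := by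
  rw [sqResolvent, integral_atomMix hk0 hk1 (integrable_norm_inv_sq ν hw)]
  simp [sqResolvent]

lemma resolventTransform_atomMix (hk0 : 0 ≤ k) (hk1 : k ≤ 1) {w : ℂ} (hw : 0 < w.im) :
    resolventTransform (atomMix k ν) w = -((1 - k : ℝ) : ℂ) * w⁻¹ + k * resolventTransform ν w := by
  rw [resolventTransform_eq, integral_atomMix hk0 hk1 (integrable_inv_ofReal_sub ν hw),
    resolventTransform_eq]
  simp
  ring

variable {t₀ : ℝ}

lemma norm_inv_le_of_re_le (ht : 0 < t₀) {w : ℂ} (hw : w.re ≤ 3 * t₀ / 4) {t : ℝ} (h : t₀ ≤ t) :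
    ‖((t : ℂ) - w)⁻¹‖ ≤ 4 / t₀ := by
  rw [norm_inv]
  have h1 : t₀ / 4 ≤ ‖(t : ℂ) - w‖ := by
    refine le_trans ?_ (Complex.re_le_norm _)
    rw [Complex.sub_re, Complex.ofReal_re]
    linarith
  calc _ ≤ (t₀ / 4)⁻¹ := inv_anti₀ (by positivity) h1
    _ = _ := by rw [inv_div]

lemma ae_ge_of_supp {ν : Measure ℝ} (hν : ν (Iio t₀) = 0) : ∀ᵐ t ∂ν, t₀ ≤ t := by
  rw [ae_iff]
  convert hν using 2
  ext; simp

lemma sqResolvent_le_of_re_le (ht : 0 < t₀) (hν : ν (Iio t₀) = 0) {w : ℂ} (hw0 : 0 < w.im)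
    (hw : w.re ≤ 3 * t₀ / 4) : sqResolvent ν w ≤ 16 / t₀ ^ 2 := by
  have : ∫ _ : ℝ, (4 / t₀) ^ 2 ∂ν = 16 / t₀ ^ 2 := by
    simp; rw [div_pow]; norm_num
  rw [← this]
  refine integral_mono_ae (integrable_norm_inv_sq ν hw0) (integrable_const _) ?_
  filter_upwards [ae_ge_of_supp hν] with t h
  have := norm_inv_le_of_re_le ht hw h
  gcongr

lemma norm_resolventTransform_le_of_re_le (ht : 0 < t₀) (hν : ν (Iio t₀) = 0) {w : ℂ}
    (hw : w.re ≤ 3 * t₀ / 4) : ‖resolventTransform ν w‖ ≤ 4 / t₀ := by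
  rw [resolventTransform_eq]
  have := norm_integral_le_of_norm_le_const (μ := ν) (C := 4 / t₀)
    (f := fun t : ℝ => ((t : ℂ) - w)⁻¹) (by
      filter_upwards [ae_ge_of_supp hν] with t h using norm_inv_le_of_re_le ht hw h)
  simpa using this

variable {ξ : ℝ}

lemma sqrt_le_of_small (ht : 0 < t₀) (hξ : ξ ≤ t₀ ^ 2 / 64) : √ξ ≤ t₀ / 8 := by
  rw [Real.sqrt_le_left (by positivity)]
  calc ξ ≤ t₀ ^ 2 / 64 := hξ
    _ = _ := by ring

/-- Subordination moves points by at most √ξ ≤ t₀/8, so the image keeps distance t₀/4 from the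
support of ν. -/
lemma re_subord_le {μ : Measure ℝ} [IsProbabilityMeasure μ] (ht : 0 < t₀) (hξ0 : 0 < ξ)
    (hξ : ξ ≤ t₀ ^ 2 / 64) {z : ℂ} (hz : 0 < z.im) (hre : z.re ≤ t₀ / 2) :
    (subord μ ξ z).re ≤ 3 * t₀ / 4 := by
  have h1 := (Complex.re_le_norm _).trans (norm_subord_sub_le μ hξ0 hz)
  have h2 := sqrt_le_of_small ht hξ
  rw [Complex.sub_re] at h1
  linarith

/-- The spectral gap of the free convolution. -/
lemma im_resolventExt_eq_zero (hk0 : 0 ≤ k) (hk1 : k ≤ 1) (ht : 0 < t₀) (hν : ν (Iio t₀) = 0)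
    (hξ0 : 0 < ξ) (hξ : ξ ≤ t₀ ^ 2 / 64) {x : ℝ} (hx : x ≤ t₀ / 2)
    (hx' : k = 1 ∨ 3 * √ξ ≤ |x|) : (resolventExt (atomMix k ν) ξ x).im = 0 := by
  have := isProbabilityMeasure_atomMix (ν := ν) hk0 hk1
  set μ := atomMix k ν with hμ
  have hs : 0 < √ξ := Real.sqrt_pos.2 hξ0
  refine le_antisymm ?_ (im_resolventExt_nonneg μ hξ0 (by simp))
  have hlim : Tendsto (fun ε : ℝ => ξ * (freeResolvent μ ξ (x + ε * Complex.I)).im) (𝓝[>] 0)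
      (𝓝 (ξ * (resolventExt μ ξ x).im)) :=
    ((Complex.continuous_im.tendsto _).comp
      ((tendsto_resolventExt_ofReal μ hξ0 x).comp (tendsto_add_mul_I x))).const_mul _
  have hlim2 : Tendsto (fun ε : ℝ => 3 * ε) (𝓝[>] 0) (𝓝 0) := by
    have : Tendsto (fun ε : ℝ => 3 * ε) (𝓝 0) (𝓝 (3 * 0)) := tendsto_id.const_mul _
    rw [mul_zero] at this
    exact this.mono_left nhdsWithin_le_nhds
  have hle : ξ * (resolventExt μ ξ x).im ≤ 0 := by
    refine le_of_tendsto_of_tendsto hlim hlim2 ?_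
    filter_upwards [self_mem_nhdsWithin] with ε hε
    have hε : 0 < ε := hε
    set z : ℂ := x + ε * Complex.I with hz
    have hzim : z.im = ε := by simp [hz]
    have hzre : z.re = x := by simp [hz]
    have hz0 : 0 < z.im := by rwa [hzim]
    have hw0 := im_subord_pos μ hξ0 hz0
    have hre := re_subord_le (μ := μ) ht hξ0 hξ hz0 (by rwa [hzre])
    -- The atom, at distance at least 2√ξ (or absent), and ν, at distance at least t₀/4, contribute
    -- at most 1/4 each. Any bound strictly below 1 would do.
    have hI : ξ * sqResolvent μ (subord μ ξ z) ≤ 3 / 4 := by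
      rw [hμ, sqResolvent_atomMix hk0 hk1 hw0]
      have h1 : k * sqResolvent ν (subord μ ξ z) ≤ 16 / t₀ ^ 2 :=
        (mul_le_of_le_one_left (sqResolvent_nonneg _ _) hk1).trans
          (sqResolvent_le_of_re_le ht hν hw0 hre)
      have h1' : ξ * (k * sqResolvent ν (subord μ ξ z)) ≤ 1 / 4 := by
        calc _ ≤ t₀ ^ 2 / 64 * (16 / t₀ ^ 2) := by
              have := sqResolvent_nonneg ν (subord μ ξ z)
              gcongr
          _ = 1 / 4 := by field_simp; norm_num
      have h2 : ξ * ((1 - k) * ‖(subord μ ξ z)⁻¹‖ ^ 2) ≤ 1 / 4 := by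
        rcases hx' with rfl | hx'
        · simp
        have h3 : 2 * √ξ ≤ ‖subord μ ξ z‖ := by
          have h4 := norm_subord_sub_le μ hξ0 hz0
          have h5 : |x| ≤ ‖z‖ := by rw [← hzre]; exact Complex.abs_re_le_norm z
          have h6 := norm_sub_norm_le z (subord μ ξ z)
          rw [norm_sub_rev] at h6
          linarith
        rw [norm_inv, inv_pow]
        have h7 : 4 * ξ ≤ ‖subord μ ξ z‖ ^ 2 := by
          calc 4 * ξ = (2 * √ξ) ^ 2 := by rw [mul_pow, Real.sq_sqrt hξ0.le]; norm_num
            _ ≤ _ := by gcongr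
        have h8 : (‖subord μ ξ z‖ ^ 2)⁻¹ ≤ (4 * ξ)⁻¹ := inv_anti₀ (by positivity) h7
        calc _ ≤ ξ * (1 * (4 * ξ)⁻¹) := by gcongr; linarith
          _ = 1 / 4 := by field_simp
      rw [mul_add]
      linarith
    have him : (freeResolvent μ ξ z).im = (subord μ ξ z).im * sqResolvent μ (subord μ ξ z) :=
      im_resolventTransform μ hw0
    have hwim : (subord μ ξ z).im = ε + ξ * (freeResolvent μ ξ z).im := by
      conv_lhs => rw [subord_eq μ hξ0 hz0]
      rw [Complex.add_im, Complex.im_ofReal_mul, hzim]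
    -- Since Im w = ε + ξ Im m, this rearranges to ξ Im m ≤ 3ε.
    have h9 : ξ * (freeResolvent μ ξ z).im ≤ 3 / 4 * (subord μ ξ z).im := by
      calc _ = (ξ * sqResolvent μ (subord μ ξ z)) * (subord μ ξ z).im := by
            rw [him]; ring
        _ ≤ _ := by gcongr
    rw [hwim] at h9
    linarith
  exact (mul_nonpos_iff_pos_imp_nonpos.1 hle).1 hξ0

/-- The point t₀/2 lies in the gap and is moved by at most t₀/8, hence lands strictly between the
atom at 0 and the support of ν; `real_Ici_freeConv` then transports the mass. -/
lemma real_Ici_bulk (hk0 : 0 ≤ k) (hk1 : k ≤ 1) (ht : 0 < t₀) (hν : ν (Iio t₀) = 0)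
    (hmom : Integrable (fun x : ℝ => x ^ 2) ν) (hξ0 : 0 < ξ) (hξ : ξ ≤ t₀ ^ 2 / 64) :
    (freeConv (atomMix k ν) ξ).real (Ici (t₀ / 2)) = k := by
  have := isProbabilityMeasure_atomMix (ν := ν) hk0 hk1
  have hs := sqrt_le_of_small ht hξ
  have him := im_resolventExt_eq_zero hk0 hk1 ht hν hξ0 hξ (x := t₀ / 2) le_rfl
    (Or.inr (by rw [abs_of_pos (by positivity)]; linarith))
  set u := t₀ / 2 + ξ * (resolventExt (atomMix k ν) ξ ((t₀ / 2 : ℝ) : ℂ)).re with hu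
  have hb : |ξ * (resolventExt (atomMix k ν) ξ ((t₀ / 2 : ℝ) : ℂ)).re| ≤ t₀ / 8 := by
    refine le_trans ?_ hs
    rw [abs_mul, abs_of_pos hξ0]
    have h1 := (Complex.abs_re_le_norm _).trans
      (norm_resolventExt_le (atomMix k ν) hξ0 (z := ((t₀ / 2 : ℝ) : ℂ)) (by simp))
    calc _ ≤ ξ * (√ξ)⁻¹ := by gcongr
      _ = √ξ := by
        have : 0 < √ξ := Real.sqrt_pos.2 hξ0
        field_simp
        rw [Real.sq_sqrt hξ0.le]
  rw [abs_le] at hb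
  have hu0 : 0 < u := by rw [hu]; linarith
  have hut : u < t₀ := by rw [hu]; linarith
  have hνu : ν {u} = 0 := measure_mono_null (by simpa using hut) hν
  have hatom : atomMix k ν {u} = 0 := by
    simp only [atomMix, Measure.add_apply, Measure.smul_apply, hνu, smul_eq_mul, mul_zero, add_zero]
    rw [Measure.dirac_apply' _ (measurableSet_singleton u),
      indicator_of_notMem (by simpa using hu0.ne)]
    simp
  rw [real_Ici_freeConv (atomMix k ν) hξ0 (integrable_atomMix hmom) him hatom]
  have hν1 : ν (Ici u) = 1 := by
    rw [prob_compl_eq_zero_iff measurableSet_Ici |>.1]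
    rw [compl_Ici]
    exact measure_mono_null (Iio_subset_Iio hut.le) hν
  rw [← hu, Measure.real]
  simp only [atomMix, Measure.add_apply, Measure.smul_apply, hν1, smul_eq_mul, mul_one]
  rw [Measure.dirac_apply' _ measurableSet_Ici, indicator_of_notMem (by simpa using hu0)]
  simp [hk0]

end Mixture

/-! ### The long-time equations on the lower part of the spectrum. -/

section Equations

variable {μ : Measure ℝ} [IsProbabilityMeasure μ] {ξ q : ℝ}

lemma integrable_sub_mul_hilbert (hξ : 0 < ξ) (hmom : Integrable (fun x : ℝ => x ^ 2) μ) (q : ℝ) :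
    Integrable (fun x => (x - q) * hilbertTransform (freeConv μ ξ) x) (freeConv μ ξ) := by
  have := isProbabilityMeasure_freeConv μ hξ
  have hid := integrable_id_of_sq (secondMoment_freeConv μ hξ hmom).1
  exact (hid.sub (integrable_const q)).mul_bdd (c := (√ξ)⁻¹)
    (continuous_hilbertTransform_freeConv μ hξ).aestronglyMeasurable
    (ae_of_all _ (abs_hilbertTransform_freeConv_le μ hξ))

/-- The integral over the whole line is 1/2 for every q. Passing to the complement leaves out the
bulk near ν, which has no universal shape. -/
lemma setIntegral_Ici_hilbert (hξ : 0 < ξ) (hmom : Integrable (fun x : ℝ => x ^ 2) μ) (q c : ℝ) :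
    ∫ x in Ici c, (x - q) * hilbertTransform (freeConv μ ξ) x ∂(freeConv μ ξ) =
      1 / 2 - ∫ x in Iio c, (x - q) * hilbertTransform (freeConv μ ξ) x ∂(freeConv μ ξ) := by
  have := isProbabilityMeasure_freeConv μ hξ
  have hid := integrable_id_of_sq (secondMoment_freeConv μ hξ hmom).1
  have hbd : Integrable (hilbertTransform (freeConv μ ξ)) (freeConv μ ξ) :=
    Integrable.of_bound (continuous_hilbertTransform_freeConv μ hξ).aestronglyMeasurable (√ξ)⁻¹
      (ae_of_all _ (abs_hilbertTransform_freeConv_le μ hξ))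
  have hxh : Integrable (fun x => x * hilbertTransform (freeConv μ ξ) x) (freeConv μ ξ) := by
    simpa using integrable_sub_mul_hilbert (ξ := ξ) hξ hmom 0
  have htot : ∫ x, (x - q) * hilbertTransform (freeConv μ ξ) x ∂(freeConv μ ξ) = 1 / 2 := by
    simp_rw [sub_mul]
    rw [integral_sub hxh (hbd.const_mul q), integral_const_mul, integral_hilbertTransform μ hξ,
      integral_id_mul_hilbertTransform μ hξ hid]
    simp
  have h := integral_add_compl (measurableSet_Ici (a := c)) (integrable_sub_mul_hilbert hξ hmom q)
  rw [htot, compl_Ici] at h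
  linarith

lemma setIntegral_Ici_sq (hξ : 0 < ξ) (hmom : Integrable (fun x : ℝ => x ^ 2) μ) (q c : ℝ) :
    ∫ x in Ici c, (q ^ 2 - x ^ 2) ∂(freeConv μ ξ) =
      q ^ 2 - (∫ x, x ^ 2 ∂μ) - ξ + ∫ x in Iio c, (x ^ 2 - q ^ 2) ∂(freeConv μ ξ) := by
  have := isProbabilityMeasure_freeConv μ hξ
  obtain ⟨hint, hval⟩ := secondMoment_freeConv μ hξ hmom
  have hi : Integrable (fun x : ℝ => q ^ 2 - x ^ 2) (freeConv μ ξ) := (integrable_const _).sub hint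
  have h := integral_add_compl (measurableSet_Ici (a := c)) hi
  rw [integral_sub (integrable_const _) hint, hval, compl_Ici] at h
  have h2 : ∫ x in Iio c, (x ^ 2 - q ^ 2) ∂(freeConv μ ξ) =
      -∫ x in Iio c, (q ^ 2 - x ^ 2) ∂(freeConv μ ξ) := by
    rw [← integral_neg]
    simp
  simp only [integral_const, probReal_univ, smul_eq_mul, one_mul] at h
  linarith

/-- The long-time equations, written with integrals over the lower part of the spectrum. -/
lemma solvesLongTimeEquations_iff (hmom : Integrable (fun x : ℝ => x ^ 2) μ) {κ α lam : ℝ}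
    (hξ : 0 < ξ) (hq : 0 < q) : SolvesLongTimeEquations μ κ α 0 lam ξ q ↔
      ∃ ω : ℝ, min κ 1 = (freeConv μ ξ).real (Ici ω) ∧
        1 = lam / q + 1 / α * (1 / 2 - ∫ x in Iio (max q ω),
          (x - q) * hilbertTransform (freeConv μ ξ) x ∂(freeConv μ ξ)) ∧
        2 * α * ξ = ξ + q ^ 2 + (∫ x in Iio (max q ω), (x ^ 2 - q ^ 2) ∂(freeConv μ ξ))
          - 4 * ξ * ∫ x in Iio (max q ω),
            (x - q) * hilbertTransform (freeConv μ ξ) x ∂(freeConv μ ξ) := by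
  constructor
  · rintro ⟨-, -, ρ, ω, hρ, h1, h2, h3⟩
    rw [isFreeSemicircleConv_iff μ hξ] at hρ
    subst hρ
    rw [setIntegral_Ici_hilbert hξ hmom] at h2 h3
    rw [setIntegral_Ici_sq hξ hmom] at h3
    exact ⟨ω, h1, h2, by linarith⟩
  · rintro ⟨ω, h1, h2, h3⟩
    refine ⟨hξ, hq, freeConv μ ξ, ω, isFreeSemicircleConv_freeConv μ hξ, h1, ?_, ?_⟩
    · rwa [setIntegral_Ici_hilbert hξ hmom]
    · rw [setIntegral_Ici_hilbert hξ hmom, setIntegral_Ici_sq hξ hmom]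
      linarith

lemma setIntegral_Ici_hilbert_nonneg (hξ : 0 < ξ) (hmom : Integrable (fun x : ℝ => x ^ 2) μ)
    {c : ℝ} (hc : q ≤ c) :
    0 ≤ ∫ x in Ici c, (x - q) * hilbertTransform (freeConv μ ξ) x ∂(freeConv μ ξ) := by
  have := isProbabilityMeasure_freeConv μ hξ
  have hid := integrable_id_of_sq (secondMoment_freeConv μ hξ hmom).1
  have hm : Monotone ((Ici c).indicator fun x => x - q) := by
    intro x y hxy
    by_cases hx : x ∈ Ici c
    · have hy : y ∈ Ici c := le_trans hx hxy
      rw [indicator_of_mem hx, indicator_of_mem hy]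
      linarith
    · rw [indicator_of_notMem hx]
      refine indicator_nonneg (fun z hz => ?_) y
      have : c ≤ z := hz
      linarith
  have hF : Integrable ((Ici c).indicator fun x => x - q) (freeConv μ ξ) :=
    (hid.sub (integrable_const q)).indicator measurableSet_Ici
  have h := integral_monotone_mul_hilbertTransform_nonneg μ hξ hm hF
  rw [← integral_indicator measurableSet_Ici]
  refine h.trans (le_of_eq (integral_congr_ae (ae_of_all _ fun x => ?_)))
  by_cases hx : x ∈ Ici c
  · simp only [indicator_of_mem hx]
  · simp only [indicator_of_notMem hx, zero_mul]

/-- A solution with `q` bounded away from zero has `ξ` bounded away from zero. -/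
lemma SolvesLongTimeEquations.lower_bound (hmom : Integrable (fun x : ℝ => x ^ 2) μ)
    {κ α lam b : ℝ} (h : SolvesLongTimeEquations μ κ α 0 lam ξ q) (hb : 0 ≤ b) (hbq : b ≤ q) :
    b ^ 2 * (freeConv μ ξ).real (Ici b) ≤ (2 * α + 1) * ξ := by
  obtain ⟨hξ, hq, ρ, ω, hρ, -, -, h3⟩ := h
  rw [isFreeSemicircleConv_iff μ hξ] at hρ
  subst hρ
  have := isProbabilityMeasure_freeConv μ hξ
  obtain ⟨hint, hval⟩ := secondMoment_freeConv μ hξ hmom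
  have hB := setIntegral_Ici_hilbert_nonneg hξ hmom (le_max_left q ω)
  have hi : Integrable (fun x : ℝ => q ^ 2 - x ^ 2) (freeConv μ ξ) := (integrable_const _).sub hint
  -- Above max(q, ω) the right side is q² ≥ b²; elsewhere it is x². In the third equation the
  -- Hilbert term is nonnegative, so this comparison bounds ξ from below.
  have hle : ∫ x, (Ici b).indicator (fun _ => b ^ 2) x ∂(freeConv μ ξ) ≤
      ∫ x, (x ^ 2 + (Ici (max q ω)).indicator (fun x => q ^ 2 - x ^ 2) x) ∂(freeConv μ ξ) := by
    refine integral_mono ((integrable_const _).indicator measurableSet_Ici)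
      (hint.add (hi.indicator measurableSet_Ici)) fun x => ?_
    by_cases hx : x ∈ Ici (max q ω)
    · have h1 : q ≤ x := (le_max_left _ _).trans hx
      have h2 : x ∈ Ici b := hbq.trans h1
      simp only [indicator_of_mem hx, indicator_of_mem h2]
      have : b ^ 2 ≤ q ^ 2 := by gcongr
      linarith
    · simp only [indicator_of_notMem hx, add_zero]
      by_cases h2 : x ∈ Ici b
      · rw [indicator_of_mem h2]
        have : b ≤ x := h2
        gcongr
      · rw [indicator_of_notMem h2]; positivity
  rw [integral_add hint (hi.indicator measurableSet_Ici), hval, integral_indicator measurableSet_Ici,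
    integral_indicator measurableSet_Ici] at hle
  simp only [integral_const, smul_eq_mul, measureReal_restrict_apply_univ] at hle
  have := mul_nonneg hξ.le hB
  linarith

end Equations

/-! ### Full-rank teacher: threshold 1/2. -/

section FullRank

variable {ν : Measure ℝ} [IsProbabilityMeasure ν] {t₀ : ℝ}

lemma measure_Iio_eq_zero_of_real_Ici {ρ : Measure ℝ} [IsProbabilityMeasure ρ] {c : ℝ}
    (h : ρ.real (Ici c) = 1) : ρ (Iio c) = 0 := by
  have h1 : ρ (Ici c) = 1 := by
    rw [Measure.real] at h
    rw [← ENNReal.ofReal_toReal (measure_ne_top ρ (Ici c)), h, ENNReal.ofReal_one]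
  have := (prob_compl_eq_zero_iff (μ := ρ) (measurableSet_Ici (a := c))).2 h1
  rwa [compl_Ici] at this

/-- With no spectrum below t₀/2 and q ≤ t₀/2, the equations reduce to 1 = λ/q + 1/(2α) and 2αξ = ξ +
q². These are solved explicitly for α > 1/2 and are contradictory for α < 1/2. -/
lemma isPerfectRecoveryThreshold_fullRank (ht : 0 < t₀) (hν : ν (Iio t₀) = 0)
    (hmom : Integrable (fun x : ℝ => x ^ 2) ν) {κ : ℝ} (hκ : 1 ≤ κ) :
    IsPerfectRecoveryThreshold (atomMix 1 ν) κ 0 (1 / 2) := by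
  have := isProbabilityMeasure_atomMix (ν := ν) (k := 1) zero_le_one le_rfl
  have hmom' : Integrable (fun x : ℝ => x ^ 2) (atomMix 1 ν) := integrable_atomMix hmom
  refine ⟨by norm_num, fun α hα => ?_, fun α hα0 hα => ?_⟩
  · have hα' : 0 < α - 1 / 2 := by linarith
    have hα0 : 0 < α := by linarith
    have hq0 : Tendsto (fun lam : ℝ => lam * α / (α - 1 / 2)) (𝓝[>] 0) (𝓝 0) := by
      have h : Tendsto (fun lam : ℝ => lam * α / (α - 1 / 2)) (𝓝 0) (𝓝 (0 * α / (α - 1 / 2))) :=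
        (tendsto_id.mul_const _).div_const _
      rw [zero_mul, zero_div] at h
      exact h.mono_left nhdsWithin_le_nhds
    have hξ0 : Tendsto (fun lam : ℝ => (lam * α / (α - 1 / 2)) ^ 2 / (2 * α - 1)) (𝓝[>] 0)
        (𝓝 0) := by
      have := (hq0.pow 2).div_const (2 * α - 1)
      simpa using this
    refine ⟨fun lam => (lam * α / (α - 1 / 2)) ^ 2 / (2 * α - 1),
      fun lam => lam * α / (α - 1 / 2), ?_, ?_⟩
    · filter_upwards [self_mem_nhdsWithin, hq0.eventually_le_const (half_pos ht),
        hξ0.eventually_le_const (show 0 < t₀ ^ 2 / 64 by positivity)] with lam hlam hq hξ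
      have hlam : 0 < lam := hlam
      set q := lam * α / (α - 1 / 2) with hqdef
      set ξ := q ^ 2 / (2 * α - 1) with hξdef
      have hqp : 0 < q := by positivity
      have h2α : 0 < 2 * α - 1 := by linarith
      have hξp : 0 < ξ := by positivity
      have := isProbabilityMeasure_freeConv (atomMix 1 ν) hξp
      rw [solvesLongTimeEquations_iff hmom' hξp hqp]
      have hmass := real_Ici_bulk zero_le_one le_rfl ht hν hmom hξp hξ
      have hnull := measure_Iio_eq_zero_of_real_Ici hmass
      refine ⟨t₀ / 2, ?_, ?_, ?_⟩
      · rw [hmass, min_eq_right hκ]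
      · rw [max_eq_right hq, Measure.restrict_zero_set hnull, integral_zero_measure, hqdef]
        field_simp
        ring
      · rw [max_eq_right hq, Measure.restrict_zero_set hnull, integral_zero_measure,
          integral_zero_measure, hξdef]
        field_simp
        ring
    · have := hξ0.const_mul (2 * α)
      simpa [mse] using this
  · refine ⟨2 * α * (t₀ ^ 2 / 64), by positivity, Eventually.of_forall fun lam ξ q hsol => ?_⟩
    have hξ0 := hsol.1
    rw [mse, zero_div, sub_zero]
    have hlt : t₀ ^ 2 / 64 ≤ ξ := by
      by_contra hcon
      have hξ : ξ ≤ t₀ ^ 2 / 64 := (not_le.1 hcon).le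
      have := isProbabilityMeasure_freeConv (atomMix 1 ν) hξ0
      have hmass := real_Ici_bulk zero_le_one le_rfl ht hν hmom hξ0 hξ
      rcases le_total q (t₀ / 2) with hq | hq
      · have hq0 := hsol.2.1
        obtain ⟨ω, h1, -, h3⟩ := (solvesLongTimeEquations_iff hmom' hξ0 hq0).1 hsol
        rw [min_eq_right hκ] at h1
        -- The level ω is not pinned down by the mass condition; it is only known that no mass lies
        -- below it.
        have hnull : freeConv (atomMix 1 ν) ξ (Iio (max q ω)) = 0 := by
          refine measure_mono_null (fun x hx => by simpa using hx) (t := Iio q ∪ Iio ω) ?_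
          exact measure_union_null (measure_mono_null (Iio_subset_Iio hq)
            (measure_Iio_eq_zero_of_real_Ici hmass)) (measure_Iio_eq_zero_of_real_Ici h1.symm)
        rw [Measure.restrict_zero_set hnull, integral_zero_measure, integral_zero_measure] at h3
        nlinarith [sq_nonneg q]
      -- Here q ≥ t₀/2, and the bound gives t₀²/4 ≤ (2α+1)ξ, incompatible with α < 1/2 and ξ ≤
      -- t₀²/64.
      · have h := hsol.lower_bound hmom' (half_pos ht).le hq
        rw [hmass] at h
        nlinarith [sq_nonneg t₀]
    gcongr

end FullRank

/-! ### Rescaling near the origin and convergence to the semicircle. -/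

section Scaled

/-- The scale of the part of the spectrum that comes from the kernel of the teacher. -/
noncomputable def kerScale (k ξ : ℝ) : ℝ := √(ξ * (1 - k))

/-- The boundary Stieltjes transform near the origin, in the scale `kerScale k ξ`. -/
noncomputable def scaledRes (μ : Measure ℝ) (k ξ ζ : ℝ) : ℂ :=
  ((kerScale k ξ / (1 - k) : ℝ) : ℂ) * resolventExt μ ξ ((kerScale k ξ * ζ : ℝ) : ℂ)

noncomputable def scaledDensity (μ : Measure ℝ) (k ξ ζ : ℝ) : ℝ :=
  (scaledRes μ k ξ ζ).im / Real.pi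

/-- Up to a negative constant factor this is the rescaled Hilbert transform times the density, the
combination through which h_ξ enters the equations. -/
noncomputable def scaledFlux (μ : Measure ℝ) (k ξ ζ : ℝ) : ℝ :=
  (scaledRes μ k ξ ζ).re * scaledDensity μ k ξ ζ

variable {k ξ : ℝ}

lemma kerScale_pos (hk1 : k < 1) (hξ : 0 < ξ) : 0 < kerScale k ξ :=
  Real.sqrt_pos.2 (mul_pos hξ (sub_pos.2 hk1))

lemma kerScale_sq (hk1 : k ≤ 1) (hξ : 0 ≤ ξ) : kerScale k ξ ^ 2 = ξ * (1 - k) :=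
  Real.sq_sqrt (mul_nonneg hξ (sub_nonneg.2 hk1))

lemma kerScale_eq (hξ : 0 ≤ ξ) : kerScale k ξ = √ξ * √(1 - k) := Real.sqrt_mul hξ _

lemma tendsto_kerScale (k : ℝ) : Tendsto (kerScale k) (𝓝[>] 0) (𝓝 0) := by
  have : Continuous (kerScale k) := Real.continuous_sqrt.comp (by fun_prop)
  have h := this.tendsto 0
  rw [show kerScale k 0 = 0 by simp [kerScale]] at h
  exact h.mono_left nhdsWithin_le_nhds

lemma kerScale_mul_freeDensity (μ : Measure ℝ) (hk1 : k < 1) (ζ : ℝ) :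
    kerScale k ξ * freeDensity μ ξ (kerScale k ξ * ζ) = (1 - k) * scaledDensity μ k ξ ζ := by
  have h1k : 1 - k ≠ 0 := (sub_pos.2 hk1).ne'
  rw [scaledDensity, scaledRes, Complex.im_ofReal_mul, freeDensity]
  field_simp

section General

variable (μ : Measure ℝ) [IsProbabilityMeasure μ]

lemma norm_scaledRes_le (hk1 : k < 1) (hξ : 0 < ξ) (ζ : ℝ) :
    ‖scaledRes μ k ξ ζ‖ ≤ (√(1 - k))⁻¹ := by
  have h1k : 0 < 1 - k := sub_pos.2 hk1
  rw [scaledRes, norm_mul, Complex.norm_real,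
    Real.norm_of_nonneg (div_nonneg (kerScale_pos hk1 hξ).le h1k.le)]
  have hs : 0 < √ξ := Real.sqrt_pos.2 hξ
  have hk : 0 < √(1 - k) := Real.sqrt_pos.2 h1k
  calc _ ≤ kerScale k ξ / (1 - k) * (√ξ)⁻¹ := by
        have := kerScale_pos hk1 hξ
        gcongr
        exact norm_resolventExt_le μ hξ (by simp)
    _ = (√(1 - k))⁻¹ := by
        rw [kerScale_eq hξ.le]
        field_simp
        rw [Real.sq_sqrt h1k.le]

lemma continuous_scaledRes (hξ : 0 < ξ) : Continuous (scaledRes μ k ξ) :=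
  continuous_const.mul ((continuous_resolventExt_ofReal μ hξ).comp (by fun_prop))

lemma scaledDensity_nonneg (hk1 : k < 1) (hξ : 0 < ξ) (ζ : ℝ) : 0 ≤ scaledDensity μ k ξ ζ := by
  rw [scaledDensity, scaledRes, Complex.im_ofReal_mul]
  exact div_nonneg (mul_nonneg (div_nonneg (kerScale_pos hk1 hξ).le (sub_nonneg.2 hk1.le))
    (im_resolventExt_nonneg μ hξ (by simp))) Real.pi_pos.le

lemma kerScale_mul_hilbert (hk1 : k < 1) (hξ : 0 < ξ) (ζ : ℝ) :
    kerScale k ξ * hilbertTransform (freeConv μ ξ) (kerScale k ξ * ζ) =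
      -((1 - k) * (scaledRes μ k ξ ζ).re) := by
  have h1k : 1 - k ≠ 0 := (sub_pos.2 hk1).ne'
  rw [hilbertTransform_freeConv μ hξ, scaledRes, Complex.re_ofReal_mul]
  field_simp

/-- Boundary form of the joint stability of the subordination function. -/
lemma resolventExt_stability {ξ' T r : ℝ} (hT : 1 / 2 ≤ μ.real (Icc (-T) T)) (hT0 : 0 < T)
    (hξ : 0 < ξ) (hξ' : ξ ≤ ξ') {x x' : ℝ} (hx : |x| + √ξ' < r) (hx' : |x'| + √ξ' < r) :
    ‖(x + ξ * resolventExt μ ξ x) - (x' + ξ' * resolventExt μ ξ' x')‖ ^ 3 ≤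
      4 * (T + r) ^ 4 / ξ * (|x - x'| + (ξ' - ξ) * (√ξ')⁻¹) := by
  have h0 : 0 < ξ' := hξ.trans_le hξ'
  have h1 := (tendsto_subord_ofReal μ hξ x).comp (tendsto_add_mul_I x)
  have h2 := (tendsto_subord_ofReal μ h0 x').comp (tendsto_add_mul_I x')
  have h3 := ((h1.sub h2).norm.pow 3)
  refine le_of_tendsto h3 ?_
  have hb : ∀ y : ℝ, |y| + √ξ' < r →
      ∀ᶠ ε : ℝ in 𝓝[>] 0, ‖(y : ℂ) + ε * Complex.I‖ + √ξ' ≤ r := by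
    intro y hy
    have h4 : Tendsto (fun ε : ℝ => ‖(y : ℂ) + ε * Complex.I‖ + √ξ') (𝓝[>] 0)
        (𝓝 (‖(y : ℂ)‖ + √ξ')) :=
      ((tendsto_add_mul_I y).mono_right nhdsWithin_le_nhds).norm.add_const _
    rw [Complex.norm_real, Real.norm_eq_abs] at h4
    exact h4.eventually_le_const hy
  filter_upwards [hb x hx, hb x' hx', self_mem_nhdsWithin] with ε h5 h6 hε
  have hε : 0 < ε := hε
  have h7 := subord_stability μ hT hT0 hξ hξ' (z := (x : ℂ) + ε * Complex.I)
    (z' := (x' : ℂ) + ε * Complex.I) (by simpa) (by simpa) h5 h6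
  rw [add_sub_add_right_eq_sub, ← Complex.ofReal_sub, Complex.norm_real, Real.norm_eq_abs] at h7
  exact h7

/-- Boundary stability in the point and the variance jointly, since the point `kerScale k ξ * ζ`
moves with ξ. -/
lemma continuousAt_scaledRes (hξ : 0 < ξ) (ζ : ℝ) :
    ContinuousAt (fun ξ => scaledRes μ k ξ ζ) ξ := by
  obtain ⟨T, hT0, hT⟩ := exists_half_le_real_Icc μ
  have hsc : Continuous (kerScale k) := Real.continuous_sqrt.comp (by fun_prop)
  set x : ℝ → ℝ := fun t => kerScale k t * ζ with hx
  have hxc : Continuous x := hsc.mul_const _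
  set W : ℝ → ℂ := fun t => (x t : ℂ) + t * resolventExt μ t (x t) with hW
  have key : ContinuousAt W ξ := by
    set r : ℝ := |x ξ| + √ξ + 1 with hr
    have hbig : ∀ᶠ t in 𝓝 ξ, ‖W t - W ξ‖ ^ 3 ≤
        4 * (T + r) ^ 4 / (ξ / 2) * (|x t - x ξ| + |t - ξ| * (√(ξ / 2))⁻¹) := by
      have e1 : ∀ᶠ t in 𝓝 ξ, |x t| + √t < r := by
        have : Continuous fun t => |x t| + √t := by fun_prop
        exact this.continuousAt.eventually_lt_const (by rw [hr]; linarith)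
      have e2 : ∀ᶠ t in 𝓝 ξ, |x t| + √ξ < r := by
        have : Continuous fun t => |x t| + √ξ := by fun_prop
        exact this.continuousAt.eventually_lt_const (by rw [hr]; linarith)
      have e3 : ∀ᶠ t in 𝓝 ξ, |x ξ| + √t < r := by
        have : Continuous fun t => |x ξ| + √t := by fun_prop
        exact this.continuousAt.eventually_lt_const (by rw [hr]; linarith)
      filter_upwards [e1, e2, e3, lt_mem_nhds (half_lt_self hξ)] with t h1 h2 h3 ht
      have ht0 : 0 < t := (half_pos hξ).trans ht
      have hhalf : 0 < √(ξ / 2) := Real.sqrt_pos.2 (half_pos hξ)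
      have hTr : 0 < T + r := by positivity
      -- The stability estimate requires ordered variances, so the two sides are separate; t > ξ/2
      -- makes the constants uniform.
      rcases le_total t ξ with htx | htx
      · have h := resolventExt_stability μ hT hT0 ht0 htx (x := x t) (x' := x ξ) h2
          (by rw [hr]; linarith)
        refine h.trans ?_
        have : |t - ξ| = ξ - t := by rw [abs_sub_comm, abs_of_nonneg (by linarith)]
        rw [this]
        have : √(ξ / 2) ≤ √ξ := Real.sqrt_le_sqrt (by linarith)
        have : 0 ≤ ξ - t := by linarith
        gcongr
      · have h := resolventExt_stability μ hT hT0 hξ htx (x := x ξ) h3 h1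
        rw [norm_sub_rev, abs_sub_comm] at h
        refine h.trans ?_
        rw [abs_of_nonneg (by linarith : (0 : ℝ) ≤ t - ξ)]
        have : √(ξ / 2) ≤ √t := Real.sqrt_le_sqrt (by linarith)
        have : 0 ≤ t - ξ := by linarith
        have : ξ / 2 ≤ ξ := by linarith
        gcongr
    have hlim : Tendsto (fun t => 4 * (T + r) ^ 4 / (ξ / 2) *
        (|x t - x ξ| + |t - ξ| * (√(ξ / 2))⁻¹)) (𝓝 ξ) (𝓝 0) := by
      have : Continuous fun t => 4 * (T + r) ^ 4 / (ξ / 2) *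
        (|x t - x ξ| + |t - ξ| * (√(ξ / 2))⁻¹) := by fun_prop
      have h := this.tendsto ξ
      simpa using h
    have h3 : Tendsto (fun t => ‖W t - W ξ‖ ^ 3) (𝓝 ξ) (𝓝 0) :=
      squeeze_zero' (Eventually.of_forall fun t => by positivity) hbig hlim
    refine tendsto_iff_norm_sub_tendsto_zero.2 ?_
    have h4 := h3.rpow_const (p := (1 / 3 : ℝ)) (Or.inr (by norm_num))
    rw [Real.zero_rpow (by norm_num)] at h4
    refine h4.congr fun t => ?_
    rw [← Real.rpow_natCast, ← Real.rpow_mul (norm_nonneg _)]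
    norm_num
  have e : (fun t => ((kerScale k t / (1 - k) : ℝ) : ℂ) * ((W t - x t) / t)) =ᶠ[𝓝 ξ]
      fun t => scaledRes μ k t ζ := by
    filter_upwards [lt_mem_nhds hξ] with t ht
    have : (t : ℂ) ≠ 0 := by exact_mod_cast ht.ne'
    simp only [scaledRes, hW, hx]
    field_simp
    ring
  refine ContinuousAt.congr ?_ e
  have hξ' : (ξ : ℂ) ≠ 0 := by exact_mod_cast hξ.ne'
  have c1 : ContinuousAt (fun t : ℝ => ((kerScale k t / (1 - k) : ℝ) : ℂ)) ξ :=
    (Complex.continuous_ofReal.comp (hsc.div_const _)).continuousAt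
  have c2 : ContinuousAt (fun t : ℝ => (x t : ℂ)) ξ :=
    (Complex.continuous_ofReal.comp hxc).continuousAt
  exact c1.mul ((key.sub c2).div Complex.continuous_ofReal.continuousAt hξ')

end General

/-! ### The Joukowski equation η + 1/η = ζ. -/

section SemicircleRoot

/-- The same mechanism as `subInv_stability` with all the mass at 0: |a|, |b| ≥ 1 plays the part of
ξ · `sqResolvent` ≤ 1. -/
lemma joukowski_stability {a b : ℂ} (ha : 1 ≤ ‖a‖) (hb : 1 ≤ ‖b‖) (ha' : 0 ≤ a.im)
    (hb' : 0 ≤ b.im) :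
    ‖a - b‖ ^ 3 ≤ 2 * (‖a‖ ^ 2 * ‖b‖ ^ 2) * ‖(a + a⁻¹) - (b + b⁻¹)‖ := by
  have ha0 : a ≠ 0 := by rintro rfl; simp at ha; linarith
  have hb0 : b ≠ 0 := by rintro rfl; simp at hb; linarith
  have h := re_inv_mul_inv_le ha0 hb0 (norm_sub_le_norm_sub_conj ha' hb')
  have h1 : ∀ c : ℂ, 1 ≤ ‖c‖ → ‖c⁻¹‖ ^ 2 ≤ 1 := by
    intro c hc
    rw [norm_inv]
    exact pow_le_one₀ (by positivity) (inv_le_one_of_one_le₀ hc)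
  have h2 : ‖a - b‖ ^ 2 * (‖a⁻¹‖ ^ 2 * ‖b⁻¹‖ ^ 2) / 2 ≤ ‖1 - a⁻¹ * b⁻¹‖ := by
    refine le_trans ?_ (Complex.re_le_norm _)
    rw [Complex.sub_re, Complex.one_re]
    linarith [h1 a ha, h1 b hb]
  have h3 : (a + a⁻¹) - (b + b⁻¹) = (a - b) * (1 - a⁻¹ * b⁻¹) := by
    field_simp; ring
  have hna : 0 < ‖a‖ := norm_pos_iff.2 ha0
  have hnb : 0 < ‖b‖ := norm_pos_iff.2 hb0
  rw [h3, norm_mul]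
  calc ‖a - b‖ ^ 3 = 2 * (‖a‖ ^ 2 * ‖b‖ ^ 2) *
        (‖a - b‖ * (‖a - b‖ ^ 2 * (‖a⁻¹‖ ^ 2 * ‖b⁻¹‖ ^ 2) / 2)) := by
        rw [norm_inv, norm_inv]; field_simp
    _ ≤ _ := by gcongr

/-- For |ζ| ≤ 2 the root is on the unit circle; beyond, it is real. The formulas agree because
`Real.sqrt` of a negative number is 0. -/
lemma exists_joukowski_root (ζ : ℝ) : ∃ η : ℂ, 1 ≤ ‖η‖ ∧ 0 ≤ η.im ∧ η + η⁻¹ = ζ ∧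
    η.im = √(4 - ζ ^ 2) / 2 ∧ (η.re - ζ) * η.im = -(ζ / 2) * (√(4 - ζ ^ 2) / 2) := by
  rcases le_or_gt (ζ ^ 2) 4 with h | h
  · set r := √(4 - ζ ^ 2) with hr
    have hr2 : r ^ 2 = 4 - ζ ^ 2 := Real.sq_sqrt (by linarith)
    set η : ℂ := ⟨ζ / 2, r / 2⟩ with hη
    have hns : Complex.normSq η = 1 := by
      rw [Complex.normSq_apply, hη]
      dsimp only
      nlinarith
    have hnorm : ‖η‖ = 1 := by
      have := Complex.normSq_eq_norm_sq η
      rw [hns] at this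
      exact (pow_eq_one_iff_of_nonneg (norm_nonneg _) two_ne_zero).1 this.symm
    refine ⟨η, hnorm.ge, by rw [hη]; positivity, ?_, rfl, ?_⟩
    · rw [Complex.inv_def, hns]
      apply Complex.ext <;> simp [hη]
    · rw [hη]; ring
  · have hz : √(4 - ζ ^ 2) = 0 := Real.sqrt_eq_zero_of_nonpos (by linarith)
    have key : ∀ x : ℝ, 0 < x → 4 < x ^ 2 → ∃ r : ℝ, 1 ≤ r ∧ r + r⁻¹ = x := by
      intro x hx hx2
      set d := √(x ^ 2 - 4) with hd
      have hd2 : d ^ 2 = x ^ 2 - 4 := Real.sq_sqrt (by linarith)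
      have hd0 : 0 ≤ d := Real.sqrt_nonneg _
      have hx3 : 2 < x := by nlinarith
      refine ⟨(x + d) / 2, by linarith, ?_⟩
      have : 0 < x + d := by linarith
      field_simp
      nlinarith
    have hζ : ∃ r : ℝ, 1 ≤ |r| ∧ r + r⁻¹ = ζ := by
      rcases lt_trichotomy ζ 0 with h0 | h0 | h0
      · obtain ⟨r, h1, h2⟩ := key (-ζ) (by linarith) (by rwa [neg_sq])
        refine ⟨-r, by rw [abs_neg]; exact h1.trans (le_abs_self r), ?_⟩
        rw [inv_neg]; linarith
      · rw [h0] at h; norm_num at h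
      · obtain ⟨r, h1, h2⟩ := key ζ h0 h
        exact ⟨r, h1.trans (le_abs_self r), h2⟩
    obtain ⟨r, h1, h2⟩ := hζ
    refine ⟨(r : ℂ), by rwa [Complex.norm_real], by simp, ?_, by simp [hz], by simp [hz]⟩
    rw [← h2]; push_cast; rfl

end SemicircleRoot

/-! ### Convergence of the rescaled boundary values. -/

section Limit

variable {ν : Measure ℝ} [IsProbabilityMeasure ν] {t₀ : ℝ}

/-- The boundary value of the scaled subordination function nearly solves the equation of the
semicircle. -/
lemma scaled_boundary (hk0 : 0 ≤ k) (hk1 : k < 1) (ht : 0 < t₀) (hν : ν (Iio t₀) = 0)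
    (hξ0 : 0 < ξ) (hξ : ξ ≤ t₀ ^ 2 / 64) {ζ : ℝ} (hζ : kerScale k ξ * ζ ≤ t₀ / 2) :
    1 ≤ ‖(ζ : ℂ) + scaledRes (atomMix k ν) k ξ ζ‖ ∧
      0 ≤ ((ζ : ℂ) + scaledRes (atomMix k ν) k ξ ζ).im ∧
      ‖((ζ : ℂ) + scaledRes (atomMix k ν) k ξ ζ) + ((ζ : ℂ) + scaledRes (atomMix k ν) k ξ ζ)⁻¹
        - ζ‖ ≤ 4 / (t₀ * (1 - k)) * kerScale k ξ := by
  have := isProbabilityMeasure_atomMix (ν := ν) hk0 hk1.le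
  set μ := atomMix k ν with hμ
  set s := kerScale k ξ with hs
  have hs0 : 0 < s := kerScale_pos hk1 hξ0
  have hs2 : s ^ 2 = ξ * (1 - k) := kerScale_sq hk1.le hξ0.le
  have h1k : 0 < 1 - k := sub_pos.2 hk1
  set x := s * ζ with hx
  set w : ℂ := x + ξ * resolventExt μ ξ x with hw
  have hlim : Tendsto (fun ε : ℝ => subord μ ξ (x + ε * Complex.I)) (𝓝[>] 0) (𝓝 w) :=
    (tendsto_subord_ofReal μ hξ0 x).comp (tendsto_add_mul_I x)
  have hxlim : Tendsto (fun ε : ℝ => (x : ℂ) + ε * Complex.I) (𝓝[>] 0) (𝓝 (x : ℂ)) :=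
    (tendsto_add_mul_I x).mono_right nhdsWithin_le_nhds
  -- Two facts pass to the boundary. The atom's share of ξ · `sqResolvent` < 1 gives |w| ≥ s, and ν
  -- perturbs the equation of the atom only by O(ξ), being far from w.
  have hev : ∀ ε : ℝ, 0 < ε → s ≤ ‖subord μ ξ (x + ε * Complex.I)‖ ∧
      ‖subord μ ξ (x + ε * Complex.I) + (s ^ 2 : ℝ) * (subord μ ξ (x + ε * Complex.I))⁻¹
        - (x + ε * Complex.I)‖ ≤ ξ * (4 / t₀) := by
    intro ε hε
    set z : ℂ := x + ε * Complex.I with hz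
    have hz0 : 0 < z.im := by simpa [hz]
    have hw0 := im_subord_pos μ hξ0 hz0
    have hre := re_subord_le (μ := μ) ht hξ0 hξ hz0 (by simpa [hz] using hζ)
    have hne : subord μ ξ z ≠ 0 := by intro h; rw [h] at hw0; simp at hw0
    constructor
    · have h1 := mul_sqResolvent_subord_lt μ hξ0 hz0
      rw [hμ, sqResolvent_atomMix hk0 hk1.le (hμ ▸ hw0)] at h1
      have h2 : 0 ≤ k * sqResolvent ν (subord (atomMix k ν) ξ z) :=
        mul_nonneg hk0 (sqResolvent_nonneg _ _)
      have h3 : ξ * ((1 - k) * ‖(subord μ ξ z)⁻¹‖ ^ 2) < 1 := by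
        rw [← hμ] at h1 h2
        have := mul_nonneg hξ0.le h2
        linarith
      rw [norm_inv, ← mul_assoc, ← hs2, inv_pow, ← div_eq_mul_inv,
        div_lt_one (by positivity)] at h3
      exact (lt_of_pow_lt_pow_left₀ 2 (norm_nonneg _) h3).le
    · have h1 := (subord_spec μ hξ0 hz0).2
      rw [subInv] at h1
      have h2 := resolventTransform_atomMix (ν := ν) hk0 hk1.le hw0
      rw [← hμ] at h2
      rw [h2] at h1
      have h3 : subord μ ξ z + (s ^ 2 : ℝ) * (subord μ ξ z)⁻¹ - z =
          ξ * (k * resolventTransform ν (subord μ ξ z)) := by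
        rw [hs2]
        push_cast at h1 ⊢
        linear_combination h1
      rw [h3, norm_mul, norm_mul, Complex.norm_real, Complex.norm_real,
        Real.norm_of_nonneg hξ0.le, Real.norm_of_nonneg hk0]
      have h4 := norm_resolventTransform_le_of_re_le ht hν hre
      calc _ ≤ ξ * (1 * (4 / t₀)) := by gcongr
        _ = _ := by ring
  have hw1 : s ≤ ‖w‖ := by
    refine ge_of_tendsto hlim.norm ?_
    filter_upwards [self_mem_nhdsWithin] with ε hε using (hev ε hε).1
  have hwne : w ≠ 0 := norm_pos_iff.1 (hs0.trans_le hw1)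
  have hw2 : ‖w + (s ^ 2 : ℝ) * w⁻¹ - x‖ ≤ ξ * (4 / t₀) := by
    refine le_of_tendsto ((hlim.add ((hlim.inv₀ hwne).const_mul _)).sub hxlim).norm ?_
    filter_upwards [self_mem_nhdsWithin] with ε hε using (hev ε hε).2
  have hsc : (s : ℂ) ≠ 0 := by exact_mod_cast hs0.ne'
  have h1kc : ((1 - k : ℝ) : ℂ) ≠ 0 := by exact_mod_cast h1k.ne'
  have hη : (ζ : ℂ) + scaledRes μ k ξ ζ = w / s := by
    rw [scaledRes, hw, ← hs, ← hx]
    have hξe : (ξ : ℂ) = (s : ℂ) ^ 2 / ((1 - k : ℝ) : ℂ) := by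
      rw [eq_div_iff h1kc]; exact_mod_cast hs2.symm
    rw [hξe, hx]
    push_cast at h1kc ⊢
    field_simp
  rw [hη]
  refine ⟨?_, ?_, ?_⟩
  · rw [norm_div, Complex.norm_real, Real.norm_of_nonneg hs0.le, le_div_iff₀ hs0, one_mul]
    exact hw1
  · rw [← hη, Complex.add_im, Complex.ofReal_im, zero_add, scaledRes, Complex.im_ofReal_mul]
    exact mul_nonneg (div_nonneg hs0.le h1k.le) (im_resolventExt_nonneg μ hξ0 (by simp))
  · have e : w / s + (w / s)⁻¹ - ζ = (w + (s ^ 2 : ℝ) * w⁻¹ - x) / s := by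
      rw [hx]; push_cast; field_simp
    rw [e, norm_div, Complex.norm_real, Real.norm_of_nonneg hs0.le, div_le_iff₀ hs0]
    refine hw2.trans (le_of_eq ?_)
    have : 4 / (t₀ * (1 - k)) * s * s = 4 / (t₀ * (1 - k)) * s ^ 2 := by ring
    rw [this, hs2]
    field_simp

/-- The rescaled boundary value solves the Joukowski equation up to O(`kerScale k ξ`) and lies
outside the open unit disc, so `joukowski_stability` compares it with the exact root. -/
lemma tendsto_scaledRes (hk0 : 0 ≤ k) (hk1 : k < 1) (ht : 0 < t₀) (hν : ν (Iio t₀) = 0) (ζ : ℝ) :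
    Tendsto (fun ξ => scaledDensity (atomMix k ν) k ξ ζ) (𝓝[>] 0)
        (𝓝 (√(4 - ζ ^ 2) / (2 * Real.pi))) ∧
      Tendsto (fun ξ => scaledFlux (atomMix k ν) k ξ ζ) (𝓝[>] 0)
        (𝓝 (-(ζ / 2) * (√(4 - ζ ^ 2) / (2 * Real.pi)))) := by
  have := isProbabilityMeasure_atomMix (ν := ν) hk0 hk1.le
  obtain ⟨η, h1, h2, h3, h4, h5⟩ := exists_joukowski_root ζ
  set B := |ζ| + (√(1 - k))⁻¹ with hB
  have hlim0 : Tendsto (fun ξ => 2 * (B ^ 2 * ‖η‖ ^ 2) * (4 / (t₀ * (1 - k)) * kerScale k ξ))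
      (𝓝[>] 0) (𝓝 0) := by
    have := ((tendsto_kerScale k).const_mul (4 / (t₀ * (1 - k)))).const_mul
      (2 * (B ^ 2 * ‖η‖ ^ 2))
    simpa using this
  have hsmall : ∀ᶠ ξ in 𝓝[>] (0 : ℝ), ξ ≤ t₀ ^ 2 / 64 :=
    mem_nhdsWithin_of_mem_nhds (Iic_mem_nhds (by positivity))
  have hsm : ∀ᶠ ξ in 𝓝[>] (0 : ℝ), kerScale k ξ * ζ ≤ t₀ / 2 := by
    have := (tendsto_kerScale k).mul_const ζ
    rw [zero_mul] at this
    exact this.eventually_le_const (half_pos ht)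
  have hcube : Tendsto (fun ξ => ‖scaledRes (atomMix k ν) k ξ ζ - (η - ζ)‖ ^ 3) (𝓝[>] 0)
      (𝓝 0) := by
    refine squeeze_zero' (Eventually.of_forall fun _ => by positivity) ?_ hlim0
    filter_upwards [hsmall, hsm, self_mem_nhdsWithin] with ξ hξ hζ hξ0
    have hξ0 : 0 < ξ := hξ0
    obtain ⟨g1, g2, g3⟩ := scaled_boundary hk0 hk1 ht hν hξ0 hξ hζ
    have h := joukowski_stability g1 h1 g2 h2
    rw [h3] at h
    have e : scaledRes (atomMix k ν) k ξ ζ - (η - ζ) =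
      (ζ : ℂ) + scaledRes (atomMix k ν) k ξ ζ - η := by ring
    rw [e]
    refine h.trans ?_
    have hn : ‖(ζ : ℂ) + scaledRes (atomMix k ν) k ξ ζ‖ ≤ B := by
      refine (norm_add_le _ _).trans ?_
      rw [Complex.norm_real, Real.norm_eq_abs]
      exact add_le_add le_rfl (norm_scaledRes_le _ hk1 hξ0 ζ)
    gcongr
  have hM : Tendsto (fun ξ => scaledRes (atomMix k ν) k ξ ζ) (𝓝[>] 0) (𝓝 (η - ζ)) := by
    refine tendsto_iff_norm_sub_tendsto_zero.2 ?_
    have h4 := hcube.rpow_const (p := (1 / 3 : ℝ)) (Or.inr (by norm_num))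
    rw [Real.zero_rpow (by norm_num)] at h4
    refine h4.congr fun t => ?_
    rw [← Real.rpow_natCast, ← Real.rpow_mul (norm_nonneg _)]
    norm_num
  have him := ((Complex.continuous_im.tendsto _).comp hM).div_const Real.pi
  have hre := (Complex.continuous_re.tendsto _).comp hM
  have e1 : (η - (ζ : ℂ)).im / Real.pi = √(4 - ζ ^ 2) / (2 * Real.pi) := by
    rw [Complex.sub_im, Complex.ofReal_im, sub_zero, h4, div_div]
  have e2 : (η - (ζ : ℂ)).re * ((η - (ζ : ℂ)).im / Real.pi) =
      -(ζ / 2) * (√(4 - ζ ^ 2) / (2 * Real.pi)) := by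
    rw [Complex.sub_im, Complex.ofReal_im, sub_zero, Complex.sub_re, Complex.ofReal_re,
      ← mul_div_assoc, h5]
    ring
  refine ⟨?_, ?_⟩
  · rw [← e1]; exact him
  · rw [← e2]; exact hre.mul him

end Limit

end Scaled

/-! ### Energy, gap and slope of a density–flux pair, and their stability. -/

section Profile

/-- A density `p` on `[-R, R]` of total mass one, with a flux `P` which it controls. -/
structure IsProfile (B R : ℝ) (p P : ℝ → ℝ) : Prop where
  continuous_density : Continuous p
  continuous_flux : Continuous P
  nonneg : ∀ ζ, 0 ≤ p ζ
  le_bound : ∀ ζ, p ζ ≤ B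
  abs_flux_le : ∀ ζ, |P ζ| ≤ B * p ζ
  total : ∫ ζ in (-R)..R, p ζ = 1

/-- With h = q/s and w the rescaled selection level, this is the right side of the third equation
divided by ξ. -/
noncomputable def profileEnergy (k R : ℝ) (p P : ℝ → ℝ) (w h : ℝ) : ℝ :=
  1 + (1 - k) * h ^ 2 +
    (1 - k) ^ 2 * ∫ ζ in (-R)..(max h w), ((ζ ^ 2 - h ^ 2) * p ζ + 4 * (ζ - h) * P ζ)

/-- The energy minus 1 + 2(1-k)²∫(ζ-h)P. It comes from the second equation once 2α has been replaced
by the energy. -/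
noncomputable def profileGap (k R : ℝ) (p P : ℝ → ℝ) (w h : ℝ) : ℝ :=
  (1 - k) * h ^ 2 +
    (1 - k) ^ 2 * ∫ ζ in (-R)..(max h w), ((ζ ^ 2 - h ^ 2) * p ζ + 2 * (ζ - h) * P ζ)

/-- The h-derivative of the energy is 2(1-k) times this: a moving endpoint contributes nothing, as
the integrand vanishes at ζ = h. -/
noncomputable def profileSlope (k R : ℝ) (p P : ℝ → ℝ) (w h : ℝ) : ℝ :=
  h - (1 - k) * ∫ ζ in (-R)..(max h w), (h * p ζ + 2 * P ζ)

noncomputable def profileDist (R : ℝ) (p P p' P' : ℝ → ℝ) : ℝ :=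
  ∫ ζ in (-R)..R, (|p ζ - p' ζ| + |P ζ - P' ζ|)

variable {k B R : ℝ} {p P p' P' : ℝ → ℝ} {w w' h h' : ℝ}

lemma IsProfile.bound_nonneg (hp : IsProfile B R p P) : 0 ≤ B :=
  (hp.nonneg 0).trans (hp.le_bound 0)

lemma IsProfile.exists_mass_eq (hp : IsProfile B R p P) (hR : 0 ≤ R) {τ : ℝ} (h0 : 0 ≤ τ)
    (h1 : τ ≤ 1) : ∃ w ∈ Icc (-R) R, ∫ ζ in (-R)..w, p ζ = τ := by
  have hc : Continuous fun w => ∫ ζ in (-R)..w, p ζ :=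
    intervalIntegral.continuous_primitive (fun _ _ => hp.continuous_density.intervalIntegrable _ _) _
  have := intermediate_value_Icc (a := -R) (b := R) (by linarith) hc.continuousOn
  obtain ⟨w, hw, he⟩ := this ⟨by simpa using h0, by rw [hp.total]; exact h1⟩
  exact ⟨w, hw, he⟩

lemma IsProfile.integral_le_one (hp : IsProfile B R p P) {a b : ℝ} (ha : -R ≤ a) (hab : a ≤ b)
    (hb : b ≤ R) : ∫ ζ in a..b, p ζ ≤ 1 := by
  rw [← hp.total]
  exact intervalIntegral.integral_mono_interval ha hab hb
    (ae_of_all _ hp.nonneg) (hp.continuous_density.intervalIntegrable _ _)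

lemma IsProfile.abs_integral_le (hp : IsProfile B R p P) {a b U : ℝ} (hab : a ≤ b)
    {u v : ℝ → ℝ} (hu : ∀ ζ ∈ Icc a b, |u ζ| ≤ U) (hv : ∀ ζ ∈ Icc a b, |v ζ| ≤ U) :
    |∫ ζ in a..b, (u ζ * p ζ + v ζ * P ζ)| ≤ U * (1 + B) * ∫ ζ in a..b, p ζ := by
  rw [← intervalIntegral.integral_const_mul, ← Real.norm_eq_abs]
  refine intervalIntegral.norm_integral_le_of_norm_le hab (ae_of_all _ fun ζ hζ => ?_)
    ((hp.continuous_density.const_mul _).intervalIntegrable _ _)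
  have hζ : ζ ∈ Icc a b := ⟨hζ.1.le, hζ.2⟩
  have h1 := hu ζ hζ
  have hU : 0 ≤ U := (abs_nonneg _).trans h1
  rw [Real.norm_eq_abs]
  calc _ ≤ |u ζ| * p ζ + |v ζ| * |P ζ| := by
        refine (abs_add_le _ _).trans ?_
        rw [abs_mul, abs_mul, abs_of_nonneg (hp.nonneg ζ)]
    _ ≤ U * p ζ + U * (B * p ζ) := by
        have := hp.nonneg ζ
        have := hv ζ hζ
        have := hp.abs_flux_le ζ
        gcongr
    _ = _ := by ring

lemma continuous_integrand (hp : IsProfile B R p P) {u v : ℝ → ℝ} (hu : Continuous u)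
    (hv : Continuous v) : Continuous fun ζ => u ζ * p ζ + v ζ * P ζ :=
  (hu.mul hp.continuous_density).add (hv.mul hp.continuous_flux)

/-- Profiles which are close have close integrals up to levels of equal mass. -/
lemma IsProfile.abs_integral_sub_le (hp : IsProfile B R p P) (hp' : IsProfile B R p' P')
    (hw : w ∈ Icc (-R) R) (hw' : w' ∈ Icc (-R) R)
    (hm : ∫ ζ in (-R)..w, p ζ = ∫ ζ in (-R)..w', p' ζ) (hh : h ∈ Icc (-R) R) {U : ℝ}
    {u v : ℝ → ℝ} (huc : Continuous u) (hvc : Continuous v)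
    (hu : ∀ ζ ∈ Icc (-R) R, |u ζ| ≤ U) (hv : ∀ ζ ∈ Icc (-R) R, |v ζ| ≤ U) :
    |(∫ ζ in (-R)..(max h w), (u ζ * p ζ + v ζ * P ζ)) -
      ∫ ζ in (-R)..(max h w'), (u ζ * p' ζ + v ζ * P' ζ)| ≤
      U * (2 + B) * profileDist R p P p' P' := by
  have hU : 0 ≤ U := (abs_nonneg _).trans (hu h hh)
  have hB := hp.bound_nonneg
  have hc1 := continuous_integrand hp huc hvc
  have hc2 := continuous_integrand hp' huc hvc
  have hcd : Continuous fun ζ => |p ζ - p' ζ| + |P ζ - P' ζ| :=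
    ((hp.continuous_density.sub hp'.continuous_density).abs).add
      ((hp.continuous_flux.sub hp'.continuous_flux).abs)
  set δ := profileDist R p P p' P' with hδ
  have hmono : ∀ c ∈ Icc (-R) R, ∫ ζ in (-R)..c, (|p ζ - p' ζ| + |P ζ - P' ζ|) ≤ δ := by
    intro c hc
    exact intervalIntegral.integral_mono_interval le_rfl hc.1 hc.2
      (ae_of_all _ fun ζ => by positivity) (hcd.intervalIntegrable _ _)
  have hmw : max h w ∈ Icc (-R) R := ⟨hh.1.trans (le_max_left _ _), max_le hh.2 hw.2⟩
  have hmw' : max h w' ∈ Icc (-R) R := ⟨hh.1.trans (le_max_left _ _), max_le hh.2 hw'.2⟩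
  have first : |(∫ ζ in (-R)..(max h w), (u ζ * p ζ + v ζ * P ζ)) -
      ∫ ζ in (-R)..(max h w), (u ζ * p' ζ + v ζ * P' ζ)| ≤ U * δ := by
    rw [← intervalIntegral.integral_sub (hc1.intervalIntegrable _ _) (hc2.intervalIntegrable _ _)]
    refine le_trans ?_ (mul_le_mul_of_nonneg_left (hmono _ hmw) hU)
    rw [← intervalIntegral.integral_const_mul, ← Real.norm_eq_abs]
    refine intervalIntegral.norm_integral_le_of_norm_le hmw.1 (ae_of_all _ fun ζ hζ => ?_)
      ((hcd.const_mul U).intervalIntegrable _ _)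
    have hζ : ζ ∈ Icc (-R) R := ⟨hζ.1.le, hζ.2.trans hmw.2⟩
    rw [Real.norm_eq_abs, show u ζ * p ζ + v ζ * P ζ - (u ζ * p' ζ + v ζ * P' ζ) =
      u ζ * (p ζ - p' ζ) + v ζ * (P ζ - P' ζ) by ring, mul_add]
    refine (abs_add_le _ _).trans ?_
    rw [abs_mul, abs_mul]
    have := hu ζ hζ
    have := hv ζ hζ
    gcongr
  -- The levels need not be close as points, since the density may vanish between them. Equality of
  -- the masses makes the p'-mass between them small, and p' controls the integrand.
  have hmass : |∫ ζ in w'..w, p' ζ| ≤ δ := by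
    have e : ∫ ζ in w'..w, p' ζ = ∫ ζ in (-R)..w, (p' ζ - p ζ) := by
      rw [intervalIntegral.integral_sub (hp'.continuous_density.intervalIntegrable _ _)
        (hp.continuous_density.intervalIntegrable _ _), hm,
        intervalIntegral.integral_interval_sub_left
          (hp'.continuous_density.intervalIntegrable _ _)
          (hp'.continuous_density.intervalIntegrable _ _)]
    rw [e, ← Real.norm_eq_abs]
    refine le_trans ?_ (hmono w hw)
    refine intervalIntegral.norm_integral_le_of_norm_le hw.1 (ae_of_all _ fun ζ _ => ?_)
      (hcd.intervalIntegrable _ _)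
    rw [Real.norm_eq_abs, abs_sub_comm]
    linarith [abs_nonneg (P ζ - P' ζ)]
  have hsub : ∀ a b : ℝ, a ∈ Icc (-R) R → b ∈ Icc (-R) R → a ≤ b →
      |∫ ζ in (max h a)..(max h b), (u ζ * p' ζ + v ζ * P' ζ)| ≤
        U * (1 + B) * ∫ ζ in a..b, p' ζ := by
    intro a b ha hb hab
    have hle : max h a ≤ max h b := max_le_max le_rfl hab
    have hsubset : Icc (max h a) (max h b) ⊆ Icc (-R) R :=
      Icc_subset_Icc (hh.1.trans (le_max_left _ _)) (max_le hh.2 hb.2)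
    refine (hp'.abs_integral_le hle (fun ζ hζ => hu ζ (hsubset hζ))
      fun ζ hζ => hv ζ (hsubset hζ)).trans ?_
    refine mul_le_mul_of_nonneg_left ?_ (by positivity)
    rcases le_total h b with hb' | hb'
    · rw [max_eq_right hb']
      exact intervalIntegral.integral_mono_interval (le_max_right _ _) (by
        rw [max_eq_right hb'] at hle; exact hle) le_rfl
        (ae_of_all _ hp'.nonneg) (hp'.continuous_density.intervalIntegrable _ _)
    · rw [max_eq_left hb', max_eq_left (hab.trans hb'), intervalIntegral.integral_same]
      exact intervalIntegral.integral_nonneg hab fun ζ _ => hp'.nonneg ζ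
  have second : |(∫ ζ in (-R)..(max h w), (u ζ * p' ζ + v ζ * P' ζ)) -
      ∫ ζ in (-R)..(max h w'), (u ζ * p' ζ + v ζ * P' ζ)| ≤ U * (1 + B) * δ := by
    rw [intervalIntegral.integral_interval_sub_left (hc2.intervalIntegrable _ _)
      (hc2.intervalIntegrable _ _)]
    have hUB : 0 ≤ U * (1 + B) := by positivity
    rcases le_total w' w with hle | hle
    · refine (hsub w' w hw' hw hle).trans (mul_le_mul_of_nonneg_left ?_ hUB)
      exact (le_abs_self _).trans hmass
    · rw [intervalIntegral.integral_symm, abs_neg]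
      refine (hsub w w' hw hw' hle).trans (mul_le_mul_of_nonneg_left ?_ hUB)
      rw [intervalIntegral.integral_symm, abs_neg] at hmass
      exact (le_abs_self _).trans hmass
  have h3 := _root_.abs_sub_le (∫ ζ in (-R)..(max h w), (u ζ * p ζ + v ζ * P ζ))
    (∫ ζ in (-R)..(max h w), (u ζ * p' ζ + v ζ * P' ζ))
    (∫ ζ in (-R)..(max h w'), (u ζ * p' ζ + v ζ * P' ζ))
  linarith

lemma abs_sq_sub_sq_le {ζ : ℝ} (hh : h ∈ Icc 0 R) (hζ : ζ ∈ Icc (-R) R) :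
    |ζ ^ 2 - h ^ 2| ≤ R ^ 2 := by
  have h1 : ζ ^ 2 ≤ R ^ 2 := by nlinarith [hζ.1, hζ.2]
  have h2 : h ^ 2 ≤ R ^ 2 := by nlinarith [hh.1, hh.2]
  rw [abs_le]
  constructor <;> nlinarith [sq_nonneg ζ, sq_nonneg h]

lemma abs_mul_sub_le {ζ c : ℝ} (hc0 : 0 ≤ c) (hh : h ∈ Icc 0 R) (hζ : ζ ∈ Icc (-R) R) :
    |c * (ζ - h)| ≤ c * (2 * R) := by
  rw [abs_mul, abs_of_nonneg hc0]
  refine mul_le_mul_of_nonneg_left ?_ hc0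
  rw [abs_le]
  constructor <;> linarith [hζ.1, hζ.2, hh.1, hh.2]

lemma IsProfile.abs_sub_le_dist (hp : IsProfile B R p P) (hp' : IsProfile B R p' P')
    (hk0 : 0 ≤ k) (hk1 : k ≤ 1) (hR : 1 ≤ R)
    (hw : w ∈ Icc (-R) R) (hw' : w' ∈ Icc (-R) R)
    (hm : ∫ ζ in (-R)..w, p ζ = ∫ ζ in (-R)..w', p' ζ) (hh : h ∈ Icc 0 R) :
    |profileEnergy k R p P w h - profileEnergy k R p' P' w' h| ≤
        (R ^ 2 + 8 * R) * (2 + B) * profileDist R p P p' P' ∧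
      |profileGap k R p P w h - profileGap k R p' P' w' h| ≤
        (R ^ 2 + 8 * R) * (2 + B) * profileDist R p P p' P' ∧
      |profileSlope k R p P w h - profileSlope k R p' P' w' h| ≤
        (R ^ 2 + 8 * R) * (2 + B) * profileDist R p P p' P' := by
  have hh' : h ∈ Icc (-R) R := ⟨by linarith [hh.1], hh.2⟩
  have h1k : (1 - k) ^ 2 ≤ 1 := pow_le_one₀ (by linarith) (by linarith)
  have hscale : ∀ {c x y z : ℝ}, 0 ≤ c → c ≤ 1 → |x - y| ≤ z → |c * x - c * y| ≤ z := by
    intro c x y z h0 h1 h2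
    rw [← mul_sub, abs_mul, abs_of_nonneg h0]
    exact (mul_le_of_le_one_left (abs_nonneg _) h1).trans h2
  refine ⟨?_, ?_, ?_⟩
  · rw [profileEnergy, profileEnergy, add_sub_add_left_eq_sub]
    refine hscale (sq_nonneg _) h1k (hp.abs_integral_sub_le hp' hw hw' hm hh' (by fun_prop)
      (by fun_prop) (fun ζ hζ => ?_) fun ζ hζ => ?_)
    · linarith [abs_sq_sub_sq_le hh hζ]
    · nlinarith [abs_mul_sub_le (by norm_num : (0 : ℝ) ≤ 4) hh hζ]
  · rw [profileGap, profileGap, add_sub_add_left_eq_sub]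
    refine hscale (sq_nonneg _) h1k (hp.abs_integral_sub_le hp' hw hw' hm hh' (by fun_prop)
      (by fun_prop) (fun ζ hζ => ?_) fun ζ hζ => ?_)
    · linarith [abs_sq_sub_sq_le hh hζ]
    · nlinarith [abs_mul_sub_le (by norm_num : (0 : ℝ) ≤ 2) hh hζ]
  · rw [profileSlope, profileSlope, sub_sub_sub_cancel_left, abs_sub_comm]
    refine hscale (by linarith) (by linarith) (hp.abs_integral_sub_le hp' hw hw' hm hh' continuous_const
      continuous_const (fun ζ hζ => ?_) fun ζ hζ => ?_)
    · rw [abs_of_nonneg hh.1]; nlinarith [hh.2]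
    · rw [abs_of_nonneg zero_le_two]; nlinarith

lemma IsProfile.continuous_energy (hp : IsProfile B R p P) :
    Continuous (profileEnergy k R p P w) ∧ Continuous (profileGap k R p P w) := by
  have hprim : ∀ f : ℝ → ℝ, Continuous f → Continuous fun h => ∫ ζ in (-R)..(max h w), f ζ := by
    intro f hf
    exact (intervalIntegral.continuous_primitive (fun _ _ => hf.intervalIntegrable _ _) _).comp
      (continuous_id.max continuous_const)
  have hpc := hp.continuous_density
  have hPc := hp.continuous_flux
  have key : ∀ c : ℝ, Continuous fun h =>
      ∫ ζ in (-R)..(max h w), ((ζ ^ 2 - h ^ 2) * p ζ + c * (ζ - h) * P ζ) := by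
    intro c
    have e : (fun h => ∫ ζ in (-R)..(max h w), ((ζ ^ 2 - h ^ 2) * p ζ + c * (ζ - h) * P ζ)) =
        fun h => (∫ ζ in (-R)..(max h w), (ζ ^ 2 * p ζ + c * ζ * P ζ)) -
          h ^ 2 * (∫ ζ in (-R)..(max h w), p ζ) - c * h * ∫ ζ in (-R)..(max h w), P ζ := by
      funext h
      rw [← intervalIntegral.integral_const_mul, ← intervalIntegral.integral_const_mul,
        ← intervalIntegral.integral_sub, ← intervalIntegral.integral_sub]
      · congr 1; funext ζ; ring
      all_goals exact Continuous.intervalIntegrable (by fun_prop) _ _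
    rw [e]
    have h1 := hprim (fun ζ => ζ ^ 2 * p ζ + c * ζ * P ζ) (by fun_prop)
    have h2 := hprim p hpc
    have h3 := hprim P hPc
    fun_prop
  constructor
  · exact (by fun_prop : Continuous fun h : ℝ => 1 + (1 - k) * h ^ 2).add ((key 4).const_mul _)
  · exact (by fun_prop : Continuous fun h : ℝ => (1 - k) * h ^ 2).add ((key 2).const_mul _)

/-- Lower bound for the increments of the energy. -/
lemma IsProfile.energy_increment (hp : IsProfile B R p P) (hk0 : 0 ≤ k) (hk1 : k ≤ 1)
    (hw : w ∈ Icc (-R) R) (hh0 : 0 ≤ h) (hhh : h ≤ h') (hh' : h' ≤ R) :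
    (h' - h) * (2 * (1 - k) * profileSlope k R p P w h - (2 * R + 4) * (1 + B) * B * (h' - h)) ≤
      profileEnergy k R p P w h' - profileEnergy k R p P w h := by
  have hpc := hp.continuous_density
  have hPc := hp.continuous_flux
  have hB := hp.bound_nonneg
  have hR : 0 ≤ R := hh0.trans (hhh.trans hh')
  set c := max h w with hc
  set c' := max h' w with hc'
  have hcc : c ≤ c' := max_le_max hhh le_rfl
  have hcR : -R ≤ c := hw.1.trans (le_max_right _ _)
  have hcR' : c' ≤ R := max_le hh' hw.2
  -- The strip swept by the endpoint has length at most h' - h and the coefficients vanish at ζ =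
  -- h', so its contribution is quadratic.
  have hlast : |∫ ζ in c..c', ((ζ ^ 2 - h' ^ 2) * p ζ + 4 * (ζ - h') * P ζ)| ≤
      (2 * R + 4) * (1 + B) * B * (h' - h) ^ 2 := by
    rcases le_total h' w with h1 | h1
    · have e : c = c' := by rw [hc, hc', max_eq_right h1, max_eq_right (hhh.trans h1)]
      rw [e, intervalIntegral.integral_same, abs_zero]; positivity
    · have e : c' = h' := max_eq_left h1
      have hhc : h ≤ c := le_max_left _ _
      have hb : ∀ ζ ∈ Icc c c', |ζ - h'| ≤ h' - h := by
        intro ζ hζ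
        rw [e] at hζ
        rw [abs_sub_comm, abs_of_nonneg (by linarith [hζ.2])]
        linarith [hζ.1]
      have h2 := hp.abs_integral_le (U := (2 * R + 4) * (h' - h)) hcc
        (u := fun ζ => ζ ^ 2 - h' ^ 2) (v := fun ζ => 4 * (ζ - h')) (fun ζ hζ => ?_) fun ζ hζ => ?_
      · refine h2.trans ?_
        have h3 : ∫ ζ in c..c', p ζ ≤ B * (h' - h) := by
          have h4 : ∫ ζ in c..c', p ζ ≤ ∫ _ in c..c', B :=
            intervalIntegral.integral_mono_on hcc (hpc.intervalIntegrable _ _)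
              (by simp) fun ζ _ => hp.le_bound ζ
          rw [intervalIntegral.integral_const, smul_eq_mul] at h4
          have : (c' - c) * B ≤ (h' - h) * B :=
            mul_le_mul_of_nonneg_right (by rw [e]; linarith) hB
          linarith
        have h5 : 0 ≤ (2 * R + 4) * (h' - h) * (1 + B) := by
          have := sub_nonneg.2 hhh
          positivity
        calc _ ≤ (2 * R + 4) * (h' - h) * (1 + B) * (B * (h' - h)) :=
              mul_le_mul_of_nonneg_left h3 h5
          _ = _ := by ring
      · have h3 : ζ ^ 2 - h' ^ 2 = (ζ + h') * (ζ - h') := by ring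
        rw [h3, abs_mul]
        have h4 : |ζ + h'| ≤ 2 * R + 4 := by
          rw [abs_le]
          constructor <;> linarith [hζ.1, hζ.2]
        exact mul_le_mul h4 (hb ζ hζ) (abs_nonneg _) (by positivity)
      · rw [abs_mul, abs_of_nonneg (by norm_num : (0 : ℝ) ≤ 4)]
        have := hb ζ hζ
        have := abs_nonneg (ζ - h')
        nlinarith
  have hmass : ∫ ζ in (-R)..c, p ζ ≤ 1 := hp.integral_le_one le_rfl hcR (hcc.trans hcR')
  have hsplit : ∫ ζ in (-R)..c', ((ζ ^ 2 - h' ^ 2) * p ζ + 4 * (ζ - h') * P ζ) =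
      (∫ ζ in (-R)..c, ((ζ ^ 2 - h' ^ 2) * p ζ + 4 * (ζ - h') * P ζ)) +
        ∫ ζ in c..c', ((ζ ^ 2 - h' ^ 2) * p ζ + 4 * (ζ - h') * P ζ) :=
    (intervalIntegral.integral_add_adjacent_intervals
      (Continuous.intervalIntegrable (by fun_prop) _ _)
      (Continuous.intervalIntegrable (by fun_prop) _ _)).symm
  have hlin : ∫ ζ in (-R)..c, ((ζ ^ 2 - h' ^ 2) * p ζ + 4 * (ζ - h') * P ζ) =
      (∫ ζ in (-R)..c, ((ζ ^ 2 - h ^ 2) * p ζ + 4 * (ζ - h) * P ζ)) -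
        2 * (h' - h) * (∫ ζ in (-R)..c, (h * p ζ + 2 * P ζ)) -
        (h' - h) ^ 2 * ∫ ζ in (-R)..c, p ζ := by
    rw [← intervalIntegral.integral_const_mul, ← intervalIntegral.integral_const_mul,
      ← intervalIntegral.integral_sub, ← intervalIntegral.integral_sub]
    · congr 1; funext ζ; ring
    all_goals exact Continuous.intervalIntegrable (by fun_prop) _ _
  rw [profileEnergy, profileEnergy, profileSlope, ← hc, ← hc', hsplit, hlin]
  set I := ∫ ζ in (-R)..c, (h * p ζ + 2 * P ζ)
  set J := ∫ ζ in c..c', ((ζ ^ 2 - h' ^ 2) * p ζ + 4 * (ζ - h') * P ζ)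
  set m := ∫ ζ in (-R)..c, p ζ
  set L := (2 * R + 4) * (1 + B) * B * (h' - h) ^ 2 with hL
  have hL0 : 0 ≤ L := by positivity
  have h1k : (1 - k) ^ 2 ≤ 1 := pow_le_one₀ (by linarith) (by linarith)
  have hJ : -L ≤ (1 - k) ^ 2 * J := by
    have h6 : -L ≤ J := (abs_le.1 hlast).1
    nlinarith [sq_nonneg (1 - k)]
  have hm : 0 ≤ (1 - k) * (1 - (1 - k) * m) * (h' - h) ^ 2 := by
    have : (1 - k) * m ≤ 1 := by nlinarith
    have h7 : 0 ≤ 1 - k := by linarith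
    have h8 : 0 ≤ 1 - (1 - k) * m := by linarith
    positivity
  nlinarith

end Profile

/-! ### The semicircle profile and its moments. -/

section Semicircle

noncomputable def semiDensity (ζ : ℝ) : ℝ := √(4 - ζ ^ 2) / (2 * Real.pi)

/-- The real part of η - ζ is -ζ/2 on the support, where η is the Joukowski root. -/
noncomputable def semiFlux (ζ : ℝ) : ℝ := -(ζ / 2) * semiDensity ζ

lemma continuous_semiDensity : Continuous semiDensity :=
  (Real.continuous_sqrt.comp (by fun_prop)).div_const _

lemma continuous_semiFlux : Continuous semiFlux :=
  (by fun_prop : Continuous fun ζ : ℝ => -(ζ / 2)).mul continuous_semiDensity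

lemma semiDensity_nonneg (ζ : ℝ) : 0 ≤ semiDensity ζ := by
  have := Real.pi_pos
  rw [semiDensity]; positivity

lemma semiDensity_eq_zero {ζ : ℝ} (h : 2 ≤ |ζ|) : semiDensity ζ = 0 := by
  have : 4 ≤ ζ ^ 2 := by rw [← sq_abs]; nlinarith
  rw [semiDensity, Real.sqrt_eq_zero_of_nonpos (by linarith), zero_div]

lemma semiDensity_le_one (ζ : ℝ) : semiDensity ζ ≤ 1 := by
  have h1 : √(4 - ζ ^ 2) ≤ 2 := by
    rw [Real.sqrt_le_left (by norm_num)]; nlinarith [sq_nonneg ζ]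
  rw [semiDensity, div_le_one (by positivity)]
  linarith [Real.pi_gt_three]

lemma hasDerivAt_sqrt_four {ζ : ℝ} (h : ζ ∈ Ioo (-2 : ℝ) 2) :
    HasDerivAt (fun ζ : ℝ => √(4 - ζ ^ 2)) (-ζ / √(4 - ζ ^ 2)) ζ := by
  have h0 : 4 - ζ ^ 2 ≠ 0 := by nlinarith [h.1, h.2]
  have h1 : HasDerivAt (fun ζ : ℝ => 4 - ζ ^ 2) (-(2 * ζ)) ζ := by
    simpa using (hasDerivAt_pow 2 ζ).const_sub 4
  have h2 := h1.sqrt h0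
  have e : -(2 * ζ) / (2 * √(4 - ζ ^ 2)) = -ζ / √(4 - ζ ^ 2) := by
    rw [← mul_neg, mul_div_mul_left _ _ two_ne_zero]
  rwa [e] at h2

lemma integral_sqrt_four : ∫ ζ in (-2 : ℝ)..2, √(4 - ζ ^ 2) = 2 * Real.pi := by
  have h := intervalIntegral.smul_integral_comp_mul_left (a := -1) (b := 1)
    (fun ζ : ℝ => √(4 - ζ ^ 2)) 2
  rw [smul_eq_mul] at h
  norm_num at h
  rw [← h]
  have e : ∀ x : ℝ, √(4 - (2 * x) ^ 2) = 2 * √(1 - x ^ 2) := by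
    intro x
    rw [show 4 - (2 * x) ^ 2 = 2 ^ 2 * (1 - x ^ 2) by ring, Real.sqrt_mul (by norm_num),
      Real.sqrt_sq zero_le_two]
  simp_rw [e]
  rw [intervalIntegral.integral_const_mul, integral_sqrt_one_sub_sq]
  ring

lemma integral_mul_sqrt_four : ∫ ζ in (-2 : ℝ)..2, ζ * √(4 - ζ ^ 2) = 0 := by
  have hc : Continuous fun ζ : ℝ => √(4 - ζ ^ 2) := Real.continuous_sqrt.comp (by fun_prop)
  have h := intervalIntegral.integral_eq_sub_of_hasDerivAt_of_le (a := -2) (b := 2)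
    (f := fun ζ : ℝ => -(√(4 - ζ ^ 2) ^ 3 / 3)) (f' := fun ζ => ζ * √(4 - ζ ^ 2)) (by norm_num)
    (by fun_prop) (fun ζ hζ => ?_) (Continuous.intervalIntegrable (by fun_prop) _ _)
  · rw [h]; norm_num
  · have h0 : 0 < √(4 - ζ ^ 2) := Real.sqrt_pos.2 (by nlinarith [hζ.1, hζ.2])
    have h1 := (((hasDerivAt_sqrt_four hζ).pow 3).div_const 3).neg
    refine h1.congr_deriv ?_
    field_simp
    push_cast
    ring

lemma integral_sq_mul_sqrt_four :
    ∫ ζ in (-2 : ℝ)..2, ζ ^ 2 * √(4 - ζ ^ 2) = 2 * Real.pi := by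
  have hc : Continuous fun ζ : ℝ => √(4 - ζ ^ 2) := Real.continuous_sqrt.comp (by fun_prop)
  -- The derivative of ζ(4-ζ²)^{3/2}/4 is (1-ζ²)√(4-ζ²), so the second moment equals the zeroth.
  have h := intervalIntegral.integral_eq_sub_of_hasDerivAt_of_le (a := -2) (b := 2)
    (f := fun ζ : ℝ => ζ * √(4 - ζ ^ 2) ^ 3 / 4)
    (f' := fun ζ => √(4 - ζ ^ 2) - ζ ^ 2 * √(4 - ζ ^ 2)) (by norm_num)
    (by fun_prop) (fun ζ hζ => ?_) (Continuous.intervalIntegrable (by fun_prop) _ _)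
  · rw [intervalIntegral.integral_sub (hc.intervalIntegrable _ _)
      (Continuous.intervalIntegrable (by fun_prop) _ _), integral_sqrt_four] at h
    norm_num at h
    linarith
  · have h0 : 0 < √(4 - ζ ^ 2) := Real.sqrt_pos.2 (by nlinarith [hζ.1, hζ.2])
    have hs : √(4 - ζ ^ 2) ^ 2 = 4 - ζ ^ 2 := Real.sq_sqrt (by nlinarith [hζ.1, hζ.2])
    have h1 := ((hasDerivAt_id ζ).mul ((hasDerivAt_sqrt_four hζ).pow 3)).div_const 4
    refine h1.congr_deriv ?_
    simp only [id]
    have e : √(4 - ζ ^ 2) ^ 3 = √(4 - ζ ^ 2) * (4 - ζ ^ 2) := by rw [pow_succ, hs]; ring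
    rw [Pi.pow_apply, e, show (3 - 1 : ℕ) = 2 from rfl, hs]
    field_simp
    rw [hs]
    push_cast
    ring

variable {R : ℝ}

lemma integral_semiDensity_extend (hR : 2 ≤ R) {u : ℝ → ℝ} (hu : Continuous u) :
    ∫ ζ in (-R)..R, u ζ * semiDensity ζ = (∫ ζ in (-2 : ℝ)..2, u ζ * √(4 - ζ ^ 2)) /
      (2 * Real.pi) := by
  have hc : Continuous fun ζ => u ζ * semiDensity ζ := hu.mul continuous_semiDensity
  have hz : ∀ a b : ℝ, (∀ ζ ∈ uIcc a b, 2 ≤ |ζ|) → ∫ ζ in a..b, u ζ * semiDensity ζ = 0 := by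
    intro a b hab
    rw [intervalIntegral.integral_congr (g := fun _ => 0) fun ζ hζ => ?_]
    · simp
    · simp [semiDensity_eq_zero (hab ζ hζ)]
  rw [← intervalIntegral.integral_add_adjacent_intervals (b := -2) (hc.intervalIntegrable _ _)
    (hc.intervalIntegrable _ _), ← intervalIntegral.integral_add_adjacent_intervals (b := 2)
    (hc.intervalIntegrable (-2) 2) (hc.intervalIntegrable 2 R),
    hz (-R) (-2) ?_, hz 2 R ?_, zero_add, add_zero, ← intervalIntegral.integral_div]
  · congr 1; funext ζ; rw [semiDensity, mul_div_assoc]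
  · intro ζ hζ
    rw [uIcc_of_le hR] at hζ
    exact hζ.1.trans (le_abs_self _)
  · intro ζ hζ
    rw [uIcc_of_le (by linarith)] at hζ
    exact le_abs.2 (Or.inr (by linarith [hζ.2]))

lemma semiDensity_moments (hR : 2 ≤ R) : ∫ ζ in (-R)..R, semiDensity ζ = 1 ∧
    ∫ ζ in (-R)..R, ζ * semiDensity ζ = 0 ∧ ∫ ζ in (-R)..R, ζ ^ 2 * semiDensity ζ = 1 := by
  have hpi := Real.pi_pos
  refine ⟨?_, ?_, ?_⟩
  · have := integral_semiDensity_extend hR (u := fun _ => 1) continuous_const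
    simp only [one_mul, integral_sqrt_four] at this
    rw [this]; field_simp
  · rw [integral_semiDensity_extend hR continuous_id', integral_mul_sqrt_four, zero_div]
  · rw [integral_semiDensity_extend hR (by fun_prop : Continuous fun ζ : ℝ => ζ ^ 2),
      integral_sq_mul_sqrt_four]
    field_simp

lemma isProfile_semicircle {B : ℝ} (hB : 1 ≤ B) (hR : 2 ≤ R) :
    IsProfile B R semiDensity semiFlux where
  continuous_density := continuous_semiDensity
  continuous_flux := continuous_semiFlux
  nonneg := semiDensity_nonneg
  le_bound ζ := (semiDensity_le_one ζ).trans hB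
  abs_flux_le ζ := by
    rw [semiFlux, abs_mul, abs_of_nonneg (semiDensity_nonneg ζ)]
    rcases le_total 2 |ζ| with h | h
    · simp [semiDensity_eq_zero h]
    · refine mul_le_mul_of_nonneg_right ?_ (semiDensity_nonneg ζ)
      rw [abs_neg, abs_div, abs_two]; linarith
  total := (semiDensity_moments hR).1

lemma setIntegral_Ici_semicircle (hR : 2 ≤ R) (c : ℝ) (F : ℝ → ℝ) :
    ∫ x in Ici c, F x ∂semicircle =
      ∫ ζ in (max (-R) (min c R))..R, F ζ * semiDensity ζ := by
  have hd : Measurable fun x : ℝ => ENNReal.ofReal (√(4 - x ^ 2) / (2 * Real.pi)) :=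
    continuous_semiDensity.measurable.ennreal_ofReal
  rw [semicircle, setIntegral_withDensity_eq_setIntegral_toReal_smul hd
    (ae_of_all _ fun _ => ENNReal.ofReal_lt_top) _ measurableSet_Ici]
  have e : ∀ x, (ENNReal.ofReal (√(4 - x ^ 2) / (2 * Real.pi))).toReal • F x =
      F x * semiDensity x := by
    intro x
    rw [← semiDensity, ENNReal.toReal_ofReal (semiDensity_nonneg x), smul_eq_mul, mul_comm]
  simp_rw [e]
  rw [intervalIntegral.integral_of_le (max_le (by linarith) (min_le_right _ _)),
    ← integral_Icc_eq_integral_Ioc]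
  rcases le_total c R with hc | hc
  · rw [min_eq_left hc]
    refine setIntegral_eq_of_subset_of_forall_sdiff_eq_zero measurableSet_Ici
      (fun x hx => (le_max_right _ _).trans hx.1) fun x hx => ?_
    have h1 : x < -R ∨ R < x := by
      by_contra! h
      exact hx.2 ⟨max_le h.1 hx.1, h.2⟩
    rw [semiDensity_eq_zero, mul_zero]
    rcases h1 with h1 | h1
    · exact le_abs.2 (Or.inr (by linarith))
    · exact le_abs.2 (Or.inl (by linarith))
  · rw [min_eq_right hc, max_eq_right (by linarith), Icc_self,
      show ∫ ζ in ({R} : Set ℝ), F ζ * semiDensity ζ = 0 by simp]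
    refine setIntegral_eq_zero_of_forall_eq_zero fun x hx => ?_
    rw [semiDensity_eq_zero, mul_zero]
    exact le_abs.2 (Or.inl (by linarith [mem_Ici.1 hx]))

end Semicircle

/-! ### The limiting energy: convexity, minimiser and minimal value. -/

section SemicircleProfile

variable {k R w h h' : ℝ}

lemma slope_semicircle : profileSlope k R semiDensity semiFlux w h =
    h - (1 - k) * ∫ ζ in (-R)..(max h w), (h - ζ) * semiDensity ζ := by
  rw [profileSlope]
  congr 3; funext ζ; rw [semiFlux]; ring

/-- With P = -(ζ/2)p the integrand becomes the perfect square -(ζ-h)²p. -/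
lemma energy_semicircle : profileEnergy k R semiDensity semiFlux w h =
    1 + (1 - k) * h ^ 2 - (1 - k) ^ 2 * ∫ ζ in (-R)..(max h w), (ζ - h) ^ 2 * semiDensity ζ := by
  have e : ∫ ζ in (-R)..(max h w), ((ζ ^ 2 - h ^ 2) * semiDensity ζ + 4 * (ζ - h) * semiFlux ζ) =
      -∫ ζ in (-R)..(max h w), (ζ - h) ^ 2 * semiDensity ζ := by
    rw [← intervalIntegral.integral_neg]
    congr 1; funext ζ; rw [semiFlux]; ring
  rw [profileEnergy, e]; ring

/-- For h > 0 the gap has the sign of the slope, so positive λ selects the branch to the right of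
the minimiser of the energy. -/
lemma gap_semicircle : profileGap k R semiDensity semiFlux w h =
    (1 - k) * h * profileSlope k R semiDensity semiFlux w h := by
  rw [profileGap, slope_semicircle]
  have e : ∫ ζ in (-R)..(max h w), ((ζ ^ 2 - h ^ 2) * semiDensity ζ + 2 * (ζ - h) * semiFlux ζ) =
      -(h * ∫ ζ in (-R)..(max h w), (h - ζ) * semiDensity ζ) := by
    rw [← intervalIntegral.integral_const_mul, ← intervalIntegral.integral_neg]
    congr 1; funext ζ; rw [semiFlux]; ring
  rw [e]; ring

/-- The subtracted integral grows at rate at most 1, the total mass, which leaves 1 - (1-k) = k. -/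
lemma slope_semicircle_increment (hk1 : k ≤ 1) (hR : 2 ≤ R) (hw : w ∈ Icc (-R) R)
    (hhh : h ≤ h') (hh' : h' ≤ R) :
    k * (h' - h) ≤ profileSlope k R semiDensity semiFlux w h' -
      profileSlope k R semiDensity semiFlux w h := by
  have hc := continuous_semiDensity
  have hp := isProfile_semicircle le_rfl hR
  rw [slope_semicircle, slope_semicircle]
  set c := max h w with hcdef
  set c' := max h' w with hcdef'
  have hcc : c ≤ c' := max_le_max hhh le_rfl
  have hcR : -R ≤ c := hw.1.trans (le_max_right _ _)
  have hcR' : c' ≤ R := max_le hh' hw.2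
  have hsplit : ∀ u : ℝ → ℝ, Continuous u → ∫ ζ in (-R)..c', u ζ =
      (∫ ζ in (-R)..c, u ζ) + ∫ ζ in c..c', u ζ := fun u hu =>
    (intervalIntegral.integral_add_adjacent_intervals (hu.intervalIntegrable _ _)
      (hu.intervalIntegrable _ _)).symm
  have h1 : ∫ ζ in (-R)..c, (h' - ζ) * semiDensity ζ =
      (∫ ζ in (-R)..c, (h - ζ) * semiDensity ζ) + (h' - h) * ∫ ζ in (-R)..c, semiDensity ζ := by
    rw [← intervalIntegral.integral_const_mul, ← intervalIntegral.integral_add]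
    · congr 1; funext ζ; ring
    all_goals exact Continuous.intervalIntegrable (by fun_prop) _ _
  have h2 : ∫ ζ in c..c', (h' - ζ) * semiDensity ζ ≤ (h' - h) * ∫ ζ in c..c', semiDensity ζ := by
    rw [← intervalIntegral.integral_const_mul]
    refine intervalIntegral.integral_mono_on hcc
      (Continuous.intervalIntegrable (by fun_prop) _ _)
      (Continuous.intervalIntegrable (by fun_prop) _ _) fun ζ hζ => ?_
    refine mul_le_mul_of_nonneg_right ?_ (semiDensity_nonneg ζ)
    linarith [hζ.1, le_max_left h w]
  have h3 := hp.integral_le_one le_rfl (hcR.trans hcc) hcR'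
  rw [hsplit _ hc] at h3
  rw [hsplit _ (by fun_prop), h1]
  set a := ∫ ζ in (-R)..c, semiDensity ζ
  set b := ∫ ζ in c..c', semiDensity ζ
  have h4 : (h' - h) * (a + b) ≤ h' - h := mul_le_of_le_one_right (by linarith) h3
  have h5 : (1 - k) * ((h' - h) * a + ∫ ζ in c..c', (h' - ζ) * semiDensity ζ) ≤
      (1 - k) * (h' - h) := mul_le_mul_of_nonneg_left (by linarith) (by linarith)
  linarith

/-- The limiting energy lies above its tangents. -/
lemma energy_semicircle_increment (hR : 2 ≤ R) (hw : w ∈ Icc (-R) R)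
    (hh : h ∈ Icc (-R) R) (hh' : h' ∈ Icc (-R) R) :
    2 * (1 - k) * (h' - h) * profileSlope k R semiDensity semiFlux w h +
        k * (1 - k) * (h' - h) ^ 2 ≤
      profileEnergy k R semiDensity semiFlux w h' -
        profileEnergy k R semiDensity semiFlux w h := by
  have hc := continuous_semiDensity
  have hp := isProfile_semicircle le_rfl hR
  rw [slope_semicircle, energy_semicircle, energy_semicircle]
  set c := max h w with hcdef
  set c' := max h' w with hcdef'
  have hcR : -R ≤ c := hw.1.trans (le_max_right _ _)
  have hcR' : c ≤ R := max_le hh.2 hw.2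
  have hcR2 : -R ≤ c' := hw.1.trans (le_max_right _ _)
  have hcR2' : c' ≤ R := max_le hh'.2 hw.2
  have hsplit : ∀ u : ℝ → ℝ, Continuous u → ∀ a b : ℝ, ∫ ζ in (-R)..b, u ζ =
      (∫ ζ in (-R)..a, u ζ) + ∫ ζ in a..b, u ζ := fun u hu a b =>
    (intervalIntegral.integral_add_adjacent_intervals (hu.intervalIntegrable _ _)
      (hu.intervalIntegrable _ _)).symm
  have h1 : ∫ ζ in (-R)..c, (ζ - h') ^ 2 * semiDensity ζ =
      (∫ ζ in (-R)..c, (ζ - h) ^ 2 * semiDensity ζ) +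
        2 * (h' - h) * (∫ ζ in (-R)..c, (h - ζ) * semiDensity ζ) +
        (h' - h) ^ 2 * ∫ ζ in (-R)..c, semiDensity ζ := by
    rw [← intervalIntegral.integral_const_mul, ← intervalIntegral.integral_const_mul,
      ← intervalIntegral.integral_add, ← intervalIntegral.integral_add]
    · congr 1; funext ζ; ring
    all_goals exact Continuous.intervalIntegrable (by fun_prop) _ _
  have h2 : ∫ ζ in (-R)..c', (ζ - h') ^ 2 * semiDensity ζ ≤
      (∫ ζ in (-R)..c, (ζ - h) ^ 2 * semiDensity ζ) +
        2 * (h' - h) * (∫ ζ in (-R)..c, (h - ζ) * semiDensity ζ) + (h' - h) ^ 2 := by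
    rcases le_total h h' with hle | hle
    · have hcc : c ≤ c' := max_le_max hle le_rfl
      have h3 : ∫ ζ in c..c', (ζ - h') ^ 2 * semiDensity ζ ≤
          (h' - h) ^ 2 * ∫ ζ in c..c', semiDensity ζ := by
        rcases le_total h' w with h4 | h4
        · have e : c = c' := by
            rw [hcdef, hcdef', max_eq_right (hle.trans h4), max_eq_right h4]
          simp [e]
        rw [← intervalIntegral.integral_const_mul]
        refine intervalIntegral.integral_mono_on hcc
          (Continuous.intervalIntegrable (by fun_prop) _ _)
          (Continuous.intervalIntegrable (by fun_prop) _ _) fun ζ hζ => ?_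
        refine mul_le_mul_of_nonneg_right ?_ (semiDensity_nonneg ζ)
        have h6 := hζ.2
        rw [hcdef', max_eq_left h4] at h6
        have h7 := hζ.1
        have := le_max_left h w
        nlinarith
      have h4 := hp.integral_le_one le_rfl hcR2 hcR2'
      rw [hsplit _ hc c] at h4
      rw [hsplit _ (by fun_prop) c, h1]
      nlinarith [sq_nonneg (h' - h)]
    -- Moving left only shrinks the domain of a nonnegative integrand.
    · have hcc : c' ≤ c := max_le_max hle le_rfl
      have h3 : 0 ≤ ∫ ζ in c'..c, (ζ - h') ^ 2 * semiDensity ζ :=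
        intervalIntegral.integral_nonneg hcc fun ζ _ =>
          mul_nonneg (sq_nonneg _) (semiDensity_nonneg ζ)
      have h5 : ∫ ζ in (-R)..c', (ζ - h') ^ 2 * semiDensity ζ ≤
          ∫ ζ in (-R)..c, (ζ - h') ^ 2 * semiDensity ζ := by
        rw [hsplit (fun ζ => (ζ - h') ^ 2 * semiDensity ζ) (by fun_prop) c' c]; linarith
      have h4 := hp.integral_le_one le_rfl hcR hcR'
      rw [h1] at h5
      nlinarith [sq_nonneg (h' - h)]
  have h6 := mul_le_mul_of_nonneg_left h2 (sq_nonneg (1 - k))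
  nlinarith

/-- The threshold equations in terms of the limiting profile. -/
lemma ThresholdEquations.profile {κ : ℝ} (hk0 : 0 < k) (hk1 : k < 1) (hR : 2 ≤ R)
    (h0 : ThresholdEquations κ k h w) :
    h ∈ Icc 0 2 ∧ ∃ w' ∈ Icc (-R) R,
      ∫ ζ in (-R)..w', semiDensity ζ = (1 - min κ 1) / (1 - k) ∧
      profileSlope k R semiDensity semiFlux w' h = 0 ∧
      profileEnergy k R semiDensity semiFlux w' h =
        2 * (k - k ^ 2 / 2 + (1 - k) ^ 2 / 2 *
          ∫ x in Ici (max h w), x * (x - h) ∂semicircle) := by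
  have h1k : 0 < 1 - k := sub_pos.2 hk1
  have hc := continuous_semiDensity
  obtain ⟨hm1, hm2⟩ := h0
  have hh0 : 0 ≤ h := by
    have h1 : 0 ≤ ∫ x in Ici (max h w), (x - h) ∂semicircle :=
      setIntegral_nonneg measurableSet_Ici fun x hx =>
        sub_nonneg.2 ((le_max_left _ _).trans hx)
    rw [← hm2] at h1
    exact nonneg_of_mul_nonneg_right h1 (div_pos hk0 h1k)
  -- For h > 2 the tail integral vanishes while the left side of the threshold equation is positive.
  have hh2 : h ≤ 2 := by
    by_contra! hlt
    have h1 := setIntegral_Ici_semicircle le_rfl (max h w) (fun x => x - h)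
    rw [min_eq_right (hlt.le.trans (le_max_left h w)), max_eq_right (by norm_num : (-2 : ℝ) ≤ 2),
      intervalIntegral.integral_same, ← hm2] at h1
    have : 0 < k / (1 - k) * h := by positivity
    linarith
  -- The level ω̃ may lie outside the window; clamping it crosses no mass.
  set w' := max (-R) (min w R) with hw'
  have hw'm : w' ∈ Icc (-R) R := ⟨le_max_left _ _, max_le (by linarith) (min_le_right _ _)⟩
  have hcl : max (-R) (min (max h w) R) = max h w' := by
    rw [hw']
    have e1 : min h R = h := min_eq_left (hh2.trans hR)
    have e2 : max (-R) h = h := max_eq_right (by linarith)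
    rw [min_max_distrib_right, e1, ← max_assoc, e2, ← max_assoc, max_comm h (-R), e2]
  set c := max h w' with hcdef
  have hsplit : ∀ u : ℝ → ℝ, Continuous u → ∀ a : ℝ, ∫ ζ in (-R)..a, u ζ * semiDensity ζ =
      (∫ ζ in (-R)..R, u ζ * semiDensity ζ) - ∫ ζ in a..R, u ζ * semiDensity ζ := by
    intro u hu a
    rw [eq_sub_iff_add_eq, intervalIntegral.integral_add_adjacent_intervals] <;>
    exact Continuous.intervalIntegrable (by fun_prop) _ _
  obtain ⟨m0, m1, m2⟩ := semiDensity_moments hR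
  have hI := setIntegral_Ici_semicircle hR (max h w) (fun x => x - h)
  rw [hcl, ← hm2] at hI
  have hX := setIntegral_Ici_semicircle hR (max h w) (fun x => x * (x - h))
  rw [hcl] at hX
  have hfull1 : ∫ ζ in (-R)..R, (h - ζ) * semiDensity ζ = h := by
    have : ∫ ζ in (-R)..R, (h - ζ) * semiDensity ζ =
        h * (∫ ζ in (-R)..R, semiDensity ζ) - ∫ ζ in (-R)..R, ζ * semiDensity ζ := by
      rw [← intervalIntegral.integral_const_mul, ← intervalIntegral.integral_sub]
      · congr 1; funext ζ; ring
      all_goals exact Continuous.intervalIntegrable (by fun_prop) _ _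
    rw [this, m0, m1]; ring
  have hfull2 : ∫ ζ in (-R)..R, (ζ - h) ^ 2 * semiDensity ζ = 1 + h ^ 2 := by
    have : ∫ ζ in (-R)..R, (ζ - h) ^ 2 * semiDensity ζ =
        (∫ ζ in (-R)..R, ζ ^ 2 * semiDensity ζ) - 2 * h * (∫ ζ in (-R)..R, ζ * semiDensity ζ) +
          h ^ 2 * ∫ ζ in (-R)..R, semiDensity ζ := by
      rw [← intervalIntegral.integral_const_mul, ← intervalIntegral.integral_const_mul,
        ← intervalIntegral.integral_sub, ← intervalIntegral.integral_add]
      · congr 1; funext ζ; ring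
      all_goals exact Continuous.intervalIntegrable (by fun_prop) _ _
    rw [this, m0, m1, m2]; ring
  have htail1 : ∫ ζ in c..R, (h - ζ) * semiDensity ζ = -(k / (1 - k) * h) := by
    rw [hI, ← intervalIntegral.integral_neg]
    congr 1; funext ζ; ring
  have htail2 : ∫ ζ in c..R, (ζ - h) ^ 2 * semiDensity ζ =
      (∫ x in Ici (max h w), x * (x - h) ∂semicircle) - h * (k / (1 - k) * h) := by
    rw [hI, hX, ← intervalIntegral.integral_const_mul, ← intervalIntegral.integral_sub]
    · congr 1; funext ζ; ring
    all_goals exact Continuous.intervalIntegrable (by fun_prop) _ _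
  refine ⟨⟨hh0, hh2⟩, w', hw'm, ?_, ?_, ?_⟩
  · have h1 := setIntegral_Ici_semicircle hR w (fun _ => 1)
    simp only [one_mul, integral_const, smul_eq_mul, mul_one, measureReal_restrict_apply_univ] at h1
    have h2 := hsplit (fun _ => 1) continuous_const w'
    simp only [one_mul] at h2
    rw [h2, m0, ← h1, ← hm1]
    field_simp
    ring
  · rw [slope_semicircle, hsplit _ (by fun_prop), hfull1, htail1]
    field_simp
    ring
  · rw [energy_semicircle, hsplit _ (by fun_prop), hfull2, htail2]
    field_simp
    ring

/-- The intermediate value theorem, first for the mass, then on [0, 2] for the difference of the two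
sides of the second equation, which is ≤ 0 at 0 and ≥ 0 at 2. -/
lemma exists_thresholdEquations {κ : ℝ} (hk0 : 0 < k) (hk1 : k < 1) (hκ : k ≤ κ) :
    ∃ h w : ℝ, ThresholdEquations κ k h w := by
  have h1k : 0 < 1 - k := sub_pos.2 hk1
  have hc := continuous_semiDensity
  have hK : k ≤ min κ 1 := le_min hκ hk1.le
  have hp := isProfile_semicircle (le_refl 1) (le_refl 2)
  obtain ⟨w, hw, hmass⟩ := hp.exists_mass_eq zero_le_two (τ := (1 - min κ 1) / (1 - k))
    (div_nonneg (sub_nonneg.2 (min_le_right _ _)) h1k.le)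
    ((div_le_one h1k).2 (by linarith))
  have hclip : ∀ x ∈ Icc (-2 : ℝ) 2, max (-2) (min x 2) = x := fun x hx => by
    rw [min_eq_left hx.2, max_eq_right hx.1]
  obtain ⟨m0, m1, m2⟩ := semiDensity_moments (le_refl 2)
  set f : ℝ → ℝ := fun h => ∫ ζ in (max h w)..2, (ζ - h) * semiDensity ζ with hf
  have hfc : Continuous f := by
    have hprim : ∀ u : ℝ → ℝ, Continuous u → Continuous fun h => ∫ ζ in (max h w)..2, u ζ := by
      intro u hu
      simp_rw [fun h => intervalIntegral.integral_symm (f := u) (μ := volume) 2 (max h w)]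
      exact ((intervalIntegral.continuous_primitive (fun _ _ => hu.intervalIntegrable _ _) _).comp
        (continuous_id.max continuous_const)).neg
    have e : f = fun h => (∫ ζ in (max h w)..2, ζ * semiDensity ζ) -
        h * ∫ ζ in (max h w)..2, semiDensity ζ := by
      funext h
      simp only [hf]
      rw [← intervalIntegral.integral_const_mul, ← intervalIntegral.integral_sub]
      · congr 1; funext ζ; ring
      all_goals exact Continuous.intervalIntegrable (by fun_prop) _ _
    rw [e]
    exact (hprim _ (by fun_prop)).sub (continuous_id.mul (hprim _ hc))
  have hgc : Continuous fun h => k / (1 - k) * h - f h := by fun_prop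
  have hiv := intermediate_value_Icc (a := (0 : ℝ)) (b := 2) zero_le_two hgc.continuousOn
  have hf0 : 0 ≤ f 0 := by
    refine intervalIntegral.integral_nonneg (max_le zero_le_two hw.2) fun ζ hζ => ?_
    exact mul_nonneg (by linarith [(le_max_left 0 w).trans hζ.1]) (semiDensity_nonneg ζ)
  have hf2 : f 2 = 0 := by
    rw [hf]; dsimp only; rw [max_eq_left hw.2, intervalIntegral.integral_same]
  obtain ⟨h, hh, he⟩ := hiv (show (0 : ℝ) ∈ _ from
    ⟨by simpa using hf0, by rw [hf2, sub_zero]; positivity⟩)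
  refine ⟨h, w, ?_, ?_⟩
  · have h1 := setIntegral_Ici_semicircle (le_refl 2) w (fun _ => 1)
    simp only [one_mul, integral_const, smul_eq_mul, mul_one, measureReal_restrict_apply_univ] at h1
    have h2 := intervalIntegral.integral_add_adjacent_intervals (a := -2) (b := w) (c := 2)
      (hc.intervalIntegrable _ _) (hc.intervalIntegrable _ _) (μ := volume)
    rw [h1, hclip w hw]
    rw [hmass, m0] at h2
    rw [← eq_sub_iff_add_eq'] at h2
    rw [h2]
    field_simp
    ring
  · rw [setIntegral_Ici_semicircle (le_refl 2),
      hclip _ ⟨hw.1.trans (le_max_right _ _), max_le hh.2 hw.2⟩]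
    exact sub_eq_zero.1 he

end SemicircleProfile

/-! ### The long-time equations in the rescaled variables. -/

section ScaledEquations

variable {k ξ t₀ R : ℝ} {ν : Measure ℝ} [IsProbabilityMeasure ν]

/-- The gap condition 3√ξ ≤ |x| reads 3/√(1-k) ≤ |ζ| in the scale s, which is why R is required to
be that large. -/
lemma scaledDensity_eq_zero (hk0 : 0 ≤ k) (hk1 : k < 1) (ht : 0 < t₀) (hν : ν (Iio t₀) = 0)
    (hξ0 : 0 < ξ) (hξ : ξ ≤ t₀ ^ 2 / 64) (hR : 3 / √(1 - k) ≤ R) {ζ : ℝ}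
    (hζ : kerScale k ξ * ζ ≤ t₀ / 2) (hζR : R ≤ |ζ|) :
    scaledDensity (atomMix k ν) k ξ ζ = 0 := by
  have hs := kerScale_pos hk1 hξ0
  have hk : 0 < √(1 - k) := Real.sqrt_pos.2 (sub_pos.2 hk1)
  have h := im_resolventExt_eq_zero hk0 hk1.le ht hν hξ0 hξ hζ (Or.inr ?_)
  · rw [scaledDensity, scaledRes, Complex.im_ofReal_mul, h]; simp
  · rw [abs_mul, abs_of_pos hs, kerScale_eq hξ0.le, mul_assoc, mul_comm 3]
    refine mul_le_mul_of_nonneg_left ?_ (Real.sqrt_nonneg _)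
    have := hR.trans hζR
    rwa [div_le_iff₀ hk, mul_comm] at this

lemma setIntegral_Iio_scaled (hk0 : 0 ≤ k) (hk1 : k < 1) (ht : 0 < t₀) (hν : ν (Iio t₀) = 0)
    (hξ0 : 0 < ξ) (hξ : ξ ≤ t₀ ^ 2 / 64) (hR : 3 / √(1 - k) ≤ R) {c : ℝ} (hcR : -R ≤ c)
    (hc : kerScale k ξ * c ≤ t₀ / 2) (F : ℝ → ℝ) :
    ∫ x in Iio (kerScale k ξ * c), F x ∂(freeConv (atomMix k ν) ξ) =
      (1 - k) * ∫ ζ in (-R)..c, scaledDensity (atomMix k ν) k ξ ζ * F (kerScale k ξ * ζ) := by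
  have := isProbabilityMeasure_atomMix (ν := ν) hk0 hk1.le
  set μ := atomMix k ν with hμ
  have hs := kerScale_pos hk1 hξ0
  set s := kerScale k ξ with hsdef
  have h1 : ∫ x in Iio (s * c), F x ∂(freeConv μ ξ) =
      ∫ x in (s * (-R))..(s * c), freeDensity μ ξ x • F x := by
    rw [setIntegral_freeConv μ hξ0 F measurableSet_Iio, ← integral_Iic_eq_integral_Iio,
      intervalIntegral.integral_of_le (mul_le_mul_of_nonneg_left hcR hs.le),
      ← integral_Icc_eq_integral_Ioc]
    refine setIntegral_eq_of_subset_of_forall_sdiff_eq_zero measurableSet_Iic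
      (fun x hx => hx.2) fun x hx => ?_
    have hx1 : x ≤ s * c := hx.1
    have hx2 : x < s * (-R) := by
      by_contra! h
      exact hx.2 ⟨h, hx1⟩
    have e : s * (x / s) = x := by field_simp
    have h0 := scaledDensity_eq_zero (ν := ν) (ζ := x / s) hk0 hk1 ht hν hξ0 hξ hR
      (by rw [← hsdef, e]; exact hx1.trans hc) (by
        refine le_abs.2 (Or.inr ?_)
        rw [le_neg, div_le_iff₀ hs]; linarith)
    have h2 := kerScale_mul_freeDensity (ξ := ξ) μ hk1 (x / s)
    rw [h0, mul_zero, ← hsdef, e] at h2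
    rw [(mul_eq_zero.1 h2).resolve_left hs.ne', zero_smul]
  rw [h1, ← intervalIntegral.smul_integral_comp_mul_left, smul_eq_mul,
    ← intervalIntegral.integral_const_mul, ← intervalIntegral.integral_const_mul]
  congr 1
  funext ζ
  rw [smul_eq_mul, ← mul_assoc, kerScale_mul_freeDensity μ hk1, mul_assoc]

lemma isProfile_scaled (hk0 : 0 ≤ k) (hk1 : k < 1) (ht : 0 < t₀) (hν : ν (Iio t₀) = 0)
    (hmom : Integrable (fun x : ℝ => x ^ 2) ν)
    (hξ0 : 0 < ξ) (hξ : ξ ≤ t₀ ^ 2 / 64) (hR : 3 / √(1 - k) ≤ R)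
    (hRs : kerScale k ξ * R ≤ t₀ / 2) :
    IsProfile (√(1 - k))⁻¹ R (scaledDensity (atomMix k ν) k ξ)
      (scaledFlux (atomMix k ν) k ξ) := by
  have := isProbabilityMeasure_atomMix (ν := ν) hk0 hk1.le
  have hs := kerScale_pos hk1 hξ0
  have hR0 : 0 ≤ R := le_trans (by positivity) hR
  have hMc := continuous_scaledRes (k := k) (atomMix k ν) hξ0
  have hpc : Continuous (scaledDensity (atomMix k ν) k ξ) :=
    (Complex.continuous_im.comp hMc).div_const _
  refine ⟨hpc, (Complex.continuous_re.comp hMc).mul hpc,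
    scaledDensity_nonneg _ hk1 hξ0, fun ζ => ?_, fun ζ => ?_, ?_⟩
  · rw [scaledDensity, div_le_iff₀ Real.pi_pos]
    have h1 := (Complex.im_le_norm _).trans (norm_scaledRes_le (atomMix k ν) hk1 hξ0 ζ)
    have h2 : 0 ≤ (√(1 - k))⁻¹ := by positivity
    nlinarith [Real.pi_gt_three]
  · rw [scaledFlux, abs_mul, abs_of_nonneg (scaledDensity_nonneg _ hk1 hξ0 ζ)]
    exact mul_le_mul_of_nonneg_right
      ((Complex.abs_re_le_norm _).trans (norm_scaledRes_le (atomMix k ν) hk1 hξ0 ζ))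
      (scaledDensity_nonneg _ hk1 hξ0 ζ)
  -- This c corresponds to x = t₀/2. The mass below it is 1 - k, and the stretch from R to c carries
  -- none.
  · set c := t₀ / (2 * kerScale k ξ) with hc
    have hsc : kerScale k ξ * c = t₀ / 2 := by rw [hc]; field_simp
    have hRc : R ≤ c := by
      rw [hc, le_div_iff₀ (by positivity)]; linarith
    have hprob := isProbabilityMeasure_freeConv (atomMix k ν) hξ0
    have h1 := real_Ici_bulk hk0 hk1.le ht hν hmom hξ0 hξ
    have h2 := setIntegral_Iio_scaled hk0 hk1 ht hν hξ0 hξ hR (c := c) (by linarith)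
      hsc.le (fun _ => 1)
    simp only [integral_const, smul_eq_mul, mul_one, measureReal_restrict_apply_univ] at h2
    have h3 := probReal_compl_eq_one_sub (μ := freeConv (atomMix k ν) ξ)
      (measurableSet_Ici (a := t₀ / 2))
    rw [compl_Ici, h1, ← hsc, h2] at h3
    have h4 : ∫ ζ in R..c, scaledDensity (atomMix k ν) k ξ ζ = 0 := by
      rw [intervalIntegral.integral_congr (g := fun _ => 0) fun ζ hζ => ?_]
      · simp
      · rw [uIcc_of_le hRc] at hζ
        refine scaledDensity_eq_zero hk0 hk1 ht hν hξ0 hξ hR ?_ (hζ.1.trans (le_abs_self _))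
        rw [← hsc]
        exact mul_le_mul_of_nonneg_left hζ.2 hs.le
    have h5 := intervalIntegral.integral_add_adjacent_intervals (a := -R) (b := R) (c := c)
      (hpc.intervalIntegrable _ _) (hpc.intervalIntegrable _ _) (μ := volume)
    rw [h4, add_zero] at h5
    rw [h5]
    exact mul_left_cancel₀ (sub_pos.2 hk1).ne' (h3.trans (mul_one _).symm)

lemma real_Ici_scaled (hk0 : 0 ≤ k) (hk1 : k < 1) (ht : 0 < t₀) (hν : ν (Iio t₀) = 0)
    (hξ0 : 0 < ξ) (hξ : ξ ≤ t₀ ^ 2 / 64) (hR : 3 / √(1 - k) ≤ R)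
    (hRs : kerScale k ξ * R ≤ t₀ / 2) {w : ℝ} (hw : w ∈ Icc (-R) R) :
    (freeConv (atomMix k ν) ξ).real (Ici (kerScale k ξ * w)) =
      1 - (1 - k) * ∫ ζ in (-R)..w, scaledDensity (atomMix k ν) k ξ ζ := by
  have := isProbabilityMeasure_atomMix (ν := ν) hk0 hk1.le
  have hs := kerScale_pos hk1 hξ0
  have hprob := isProbabilityMeasure_freeConv (atomMix k ν) hξ0
  have h2 := setIntegral_Iio_scaled hk0 hk1 ht hν hξ0 hξ hR hw.1
    ((mul_le_mul_of_nonneg_left hw.2 hs.le).trans hRs) (fun _ => 1)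
  simp only [integral_const, smul_eq_mul, mul_one, measureReal_restrict_apply_univ] at h2
  rw [← h2, ← compl_Ici, probReal_compl_eq_one_sub measurableSet_Ici]
  ring

/-- The selection level may be moved into the scaling window. -/
lemma exists_scaled_level (hk0 : 0 ≤ k) (hk1 : k < 1) (ht : 0 < t₀) (hν : ν (Iio t₀) = 0)
    (hmom : Integrable (fun x : ℝ => x ^ 2) ν)
    (hξ0 : 0 < ξ) (hξ : ξ ≤ t₀ ^ 2 / 64) (hR : 3 / √(1 - k) ≤ R)
    (hRs : kerScale k ξ * R ≤ t₀ / 2) {ω : ℝ}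
    (hω : k ≤ (freeConv (atomMix k ν) ξ).real (Ici ω)) :
    ∃ w ∈ Icc (-R) R, (freeConv (atomMix k ν) ξ).real (Ici ω) =
        (freeConv (atomMix k ν) ξ).real (Ici (kerScale k ξ * w)) ∧
      ∀ h ∈ Ioc 0 R, ∀ F : ℝ → ℝ,
        ∫ x in Iio (max (kerScale k ξ * h) ω), F x ∂(freeConv (atomMix k ν) ξ) =
          ∫ x in Iio (kerScale k ξ * max h w), F x ∂(freeConv (atomMix k ν) ξ) := by
  have := isProbabilityMeasure_atomMix (ν := ν) hk0 hk1.le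
  have hprob := isProbabilityMeasure_freeConv (atomMix k ν) hξ0
  have hs := kerScale_pos hk1 hξ0
  have hR0 : 0 ≤ R := le_trans (by positivity) hR
  have hprof := isProfile_scaled hk0 hk1 ht hν hmom hξ0 hξ hR hRs
  set s := kerScale k ξ with hsdef
  set ρ := freeConv (atomMix k ν) ξ with hρ
  -- To the left of the window there is no mass, and max(sh, ω) = sh anyway because h > 0.
  rcases lt_or_ge ω (s * (-R)) with h1 | h1
  · refine ⟨-R, ⟨le_rfl, by linarith⟩, ?_, fun h hh F => ?_⟩
    · have h2 := real_Ici_scaled hk0 hk1 ht hν hξ0 hξ hR hRs (w := -R) ⟨le_rfl, by linarith⟩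
      rw [intervalIntegral.integral_same, mul_zero, sub_zero] at h2
      have h3 : ρ.real (Ici (s * (-R))) ≤ ρ.real (Ici ω) := measureReal_mono (Ici_subset_Ici.2 h1.le)
      exact le_antisymm (measureReal_le_one.trans h2.ge) h3
    · have h4 : ω ≤ s * h := h1.le.trans (mul_le_mul_of_nonneg_left (by linarith [hh.1]) hs.le)
      rw [max_eq_left h4, max_eq_left (by linarith [hh.1])]
  rcases le_or_gt ω (s * R) with h2 | h2
  · have e : s * (ω / s) = ω := by field_simp
    refine ⟨ω / s, ⟨?_, ?_⟩, by rw [e], fun h hh F => ?_⟩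
    · rw [le_div_iff₀ hs]; linarith
    · rw [div_le_iff₀ hs]; linarith
    · rw [mul_max_of_nonneg _ _ hs.le, e]
  -- To the right of the window the mass is already down to k, so the lower bound on the mass above
  -- ω makes the stretch between sR and ω null.
  · have h3 := real_Ici_scaled hk0 hk1 ht hν hξ0 hξ hR hRs (w := R) ⟨by linarith, le_rfl⟩
    rw [hprof.total, mul_one, sub_sub_cancel] at h3
    have h4 : ρ.real (Ici ω) ≤ ρ.real (Ici (s * R)) := measureReal_mono (Ici_subset_Ici.2 h2.le)
    have h5 : ρ.real (Ici ω) = ρ.real (Ici (s * R)) :=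
      le_antisymm h4 (h3.le.trans hω)
    refine ⟨R, ⟨by linarith, le_rfl⟩, h5, fun h hh F => ?_⟩
    rw [max_eq_right hh.2, max_eq_right ((mul_le_mul_of_nonneg_left hh.2 hs.le).trans h2.le)]
    have h6 : ρ.real (Iio ω) = ρ.real (Iio (s * R)) := by
      rw [← compl_Ici, ← compl_Ici, probReal_compl_eq_one_sub measurableSet_Ici,
        probReal_compl_eq_one_sub measurableSet_Ici, h5]
    refine setIntegral_congr_set (EventuallyEq.symm ?_)
    exact ae_eq_of_subset_of_measure_ge (Iio_subset_Iio h2.le)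
      ((ENNReal.toReal_le_toReal (measure_ne_top _ _) (measure_ne_top _ _)).1 h6.le) measurableSet_Iio.nullMeasurableSet
      (measure_ne_top _ _)

/-- The long-time equations in the scale of the kernel of the teacher. -/
lemma solvesLongTimeEquations_scaled (hk0 : 0 ≤ k) (hk1 : k < 1) (ht : 0 < t₀)
    (hν : ν (Iio t₀) = 0) (hmom : Integrable (fun x : ℝ => x ^ 2) ν)
    (hξ0 : 0 < ξ) (hξ : ξ ≤ t₀ ^ 2 / 64) (hR : 3 / √(1 - k) ≤ R)
    (hRs : kerScale k ξ * R ≤ t₀ / 2) {κ α lam h : ℝ} (hκ : k ≤ κ) (hα : 0 < α)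
    (hh : h ∈ Ioc 0 R) :
    SolvesLongTimeEquations (atomMix k ν) κ α 0 lam ξ (kerScale k ξ * h) ↔
      ∃ w ∈ Icc (-R) R,
        ∫ ζ in (-R)..w, scaledDensity (atomMix k ν) k ξ ζ = (1 - min κ 1) / (1 - k) ∧
        profileEnergy k R (scaledDensity (atomMix k ν) k ξ) (scaledFlux (atomMix k ν) k ξ) w h =
          2 * α ∧
        kerScale k ξ * h * profileGap k R (scaledDensity (atomMix k ν) k ξ)
          (scaledFlux (atomMix k ν) k ξ) w h = 2 * α * lam := by
  have := isProbabilityMeasure_atomMix (ν := ν) hk0 hk1.le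
  have hs := kerScale_pos hk1 hξ0
  have h1k : 0 < 1 - k := sub_pos.2 hk1
  have hprof := isProfile_scaled hk0 hk1 ht hν hmom hξ0 hξ hR hRs
  have hpc := hprof.continuous_density
  have hPc := hprof.continuous_flux
  have hmom' : Integrable (fun x : ℝ => x ^ 2) (atomMix k ν) := integrable_atomMix hmom
  have hs2 : kerScale k ξ ^ 2 = ξ * (1 - k) := kerScale_sq hk1.le hξ0.le
  have hhil := fun ζ => kerScale_mul_hilbert (k := k) (ξ := ξ) (atomMix k ν) hk1 hξ0 ζ
  rw [solvesLongTimeEquations_iff hmom' hξ0 (mul_pos hs hh.1)]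
  set s := kerScale k ξ with hsdef
  set p := scaledDensity (atomMix k ν) k ξ with hpdef
  set P := scaledFlux (atomMix k ν) k ξ with hPdef
  set ρ := freeConv (atomMix k ν) ξ with hρ
  have hmass : ∀ w ∈ Icc (-R) R, (min κ 1 = ρ.real (Ici (s * w)) ↔
      ∫ ζ in (-R)..w, p ζ = (1 - min κ 1) / (1 - k)) := by
    intro w hw
    rw [real_Ici_scaled hk0 hk1 ht hν hξ0 hξ hR hRs hw, eq_div_iff h1k.ne']
    constructor <;> intro h0 <;> linarith
  have heq : ∀ w ∈ Icc (-R) R,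
      ((1 = lam / (s * h) + 1 / α * (1 / 2 - ∫ x in Iio (s * max h w),
          (x - s * h) * hilbertTransform ρ x ∂ρ) ∧
        2 * α * ξ = ξ + (s * h) ^ 2 + (∫ x in Iio (s * max h w), (x ^ 2 - (s * h) ^ 2) ∂ρ)
          - 4 * ξ * ∫ x in Iio (s * max h w), (x - s * h) * hilbertTransform ρ x ∂ρ) ↔
      (profileEnergy k R p P w h = 2 * α ∧ s * h * profileGap k R p P w h = 2 * α * lam)) := by
    intro w hw
    have hc1 : -R ≤ max h w := hw.1.trans (le_max_right _ _)
    have hc2 : s * max h w ≤ t₀ / 2 :=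
      (mul_le_mul_of_nonneg_left (max_le hh.2 hw.2) hs.le).trans hRs
    have hI := fun F => setIntegral_Iio_scaled hk0 hk1 ht hν hξ0 hξ hR hc1 hc2 F
    rw [hI, hI]
    have e1 : ∫ ζ in (-R)..(max h w), p ζ * ((s * ζ) ^ 2 - (s * h) ^ 2) =
        s ^ 2 * ∫ ζ in (-R)..(max h w), (ζ ^ 2 - h ^ 2) * p ζ := by
      rw [← intervalIntegral.integral_const_mul]
      congr 1; funext ζ; ring
    have e2 : ∫ ζ in (-R)..(max h w), p ζ * ((s * ζ - s * h) * hilbertTransform ρ (s * ζ)) =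
        -((1 - k) * ∫ ζ in (-R)..(max h w), (ζ - h) * P ζ) := by
      rw [← intervalIntegral.integral_const_mul, ← intervalIntegral.integral_neg]
      congr 1; funext ζ
      have h3 := hhil ζ
      have h4 : P ζ = (scaledRes (atomMix k ν) k ξ ζ).re * p ζ := rfl
      rw [h4]
      linear_combination p ζ * (ζ - h) * h3
    have e3 : ∀ c : ℝ, ∫ ζ in (-R)..(max h w), ((ζ ^ 2 - h ^ 2) * p ζ + c * (ζ - h) * P ζ) =
        (∫ ζ in (-R)..(max h w), (ζ ^ 2 - h ^ 2) * p ζ) +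
          c * ∫ ζ in (-R)..(max h w), (ζ - h) * P ζ := by
      intro c
      rw [← intervalIntegral.integral_const_mul, ← intervalIntegral.integral_add]
      · congr 1; funext ζ; ring
      all_goals exact Continuous.intervalIntegrable (by fun_prop) _ _
    rw [e1, e2, profileEnergy, profileGap, e3, e3]
    set I := ∫ ζ in (-R)..(max h w), (ζ ^ 2 - h ^ 2) * p ζ
    set J := ∫ ζ in (-R)..(max h w), (ζ - h) * P ζ
    have hsh : s * h ≠ 0 := (mul_pos hs hh.1).ne'
    have a1 : (1 = lam / (s * h) + 1 / α * (1 / 2 - (1 - k) * -((1 - k) * J)) ↔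
        s * h * (2 * α - 1 - 2 * (1 - k) ^ 2 * J) = 2 * α * lam) := by
      have : lam / (s * h) + 1 / α * (1 / 2 - (1 - k) * -((1 - k) * J)) - 1 =
          (2 * α * lam - s * h * (2 * α - 1 - 2 * (1 - k) ^ 2 * J)) / (2 * α * (s * h)) := by
        have := hh.1.ne'
        field_simp
        ring
      rw [eq_comm, ← sub_eq_zero, this, div_eq_zero_iff, or_iff_left (by positivity), sub_eq_zero,
        eq_comm]
    have a2 : (2 * α * ξ = ξ + (s * h) ^ 2 + (1 - k) * (s ^ 2 * I) -
        4 * ξ * ((1 - k) * -((1 - k) * J)) ↔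
        1 + (1 - k) * h ^ 2 + (1 - k) ^ 2 * (I + 4 * J) = 2 * α) := by
      rw [mul_pow, hs2]
      constructor
      · intro h0
        refine mul_left_cancel₀ hξ0.ne' ?_
        linear_combination -h0
      · intro h0
        linear_combination -ξ * h0
    rw [a1, a2]
    -- Replacing 2α by the energy turns the first equation into the gap equation, and conversely.
    constructor
    · rintro ⟨b1, b2⟩
      exact ⟨b2, by linear_combination b1 + s * h * b2⟩
    · rintro ⟨b1, b2⟩
      exact ⟨by linear_combination b2 - s * h * b1, b1⟩
  constructor
  · rintro ⟨ω, h1, h2, h3⟩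
    obtain ⟨w, hw, h4, h5⟩ := exists_scaled_level hk0 hk1 ht hν hmom hξ0 hξ hR hRs (ω := ω)
      (by rw [← h1]; exact le_min hκ hk1.le)
    rw [h5 h hh] at h2 h3
    rw [h5 h hh] at h3
    exact ⟨w, hw, (hmass w hw).1 (h1.trans h4), (heq w hw).1 ⟨h2, h3⟩⟩
  · rintro ⟨w, hw, h1, h2⟩
    refine ⟨s * w, (hmass w hw).2 h1, ?_⟩
    rw [← mul_max_of_nonneg _ _ hs.le]
    exact (heq w hw).2 h2

end ScaledEquations

/-! ### Convergence of profiles in L¹. -/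

section ProfileLimit

lemma tendsto_profileDist {ι : Type*} {l : Filter ι} [l.IsCountablyGenerated] {B R : ℝ}
    {p P : ι → ℝ → ℝ} {p₀ P₀ : ℝ → ℝ}
    (hp : ∀ᶠ i in l, IsProfile B R (p i) (P i)) (hp₀ : IsProfile B R p₀ P₀)
    (h1 : ∀ ζ, Tendsto (fun i => p i ζ) l (𝓝 (p₀ ζ)))
    (h2 : ∀ ζ, Tendsto (fun i => P i ζ) l (𝓝 (P₀ ζ))) :
    Tendsto (fun i => profileDist R (p i) (P i) p₀ P₀) l (𝓝 0) := by
  have h := intervalIntegral.tendsto_integral_filter_of_dominated_convergence (μ := volume)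
    (a := -R) (b := R) (l := l) (F := fun i ζ => |p i ζ - p₀ ζ| + |P i ζ - P₀ ζ|)
    (f := fun _ => (0 : ℝ)) (fun _ => B + (B * B + B * B)) ?_ ?_ (by simp) ?_
  · rw [intervalIntegral.integral_zero] at h
    exact h
  · filter_upwards [hp] with i hi
    have c1 := hi.continuous_density
    have c2 := hi.continuous_flux
    have c3 := hp₀.continuous_density
    have c4 := hp₀.continuous_flux
    exact Continuous.aestronglyMeasurable (by fun_prop)
  · filter_upwards [hp] with i hi
    refine ae_of_all _ fun ζ _ => ?_
    have hB := hi.bound_nonneg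
    rw [Real.norm_of_nonneg (by positivity)]
    have b1 : |p i ζ - p₀ ζ| ≤ B := by
      rw [abs_le]
      constructor <;> linarith [hi.nonneg ζ, hi.le_bound ζ, hp₀.nonneg ζ, hp₀.le_bound ζ]
    have b2 : |P i ζ| ≤ B * B :=
      (hi.abs_flux_le ζ).trans (mul_le_mul_of_nonneg_left (hi.le_bound ζ) hB)
    have b3 : |P₀ ζ| ≤ B * B :=
      (hp₀.abs_flux_le ζ).trans (mul_le_mul_of_nonneg_left (hp₀.le_bound ζ) hB)
    have b4 := abs_sub (P i ζ) (P₀ ζ)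
    linarith
  · refine ae_of_all _ fun ζ _ => ?_
    have a1 := ((h1 ζ).sub_const (p₀ ζ)).abs
    have a2 := ((h2 ζ).sub_const (P₀ ζ)).abs
    simpa using a1.add a2

variable {k t₀ R : ℝ} {ν : Measure ℝ} [IsProbabilityMeasure ν]

lemma one_le_inv_sqrt_one_sub (hk0 : 0 ≤ k) (hk1 : k < 1) : 1 ≤ (√(1 - k))⁻¹ := by
  refine (one_le_inv₀ (Real.sqrt_pos.2 (sub_pos.2 hk1))).2 ?_
  exact Real.sqrt_le_one.2 (by linarith)

lemma eventually_scaling_window (k R : ℝ) (ht : 0 < t₀) :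
    ∀ᶠ ξ in 𝓝[>] (0 : ℝ), 0 < ξ ∧ ξ ≤ t₀ ^ 2 / 64 ∧ kerScale k ξ * R ≤ t₀ / 2 := by
  have h1 : ∀ᶠ ξ in 𝓝[>] (0 : ℝ), ξ ≤ t₀ ^ 2 / 64 :=
    mem_nhdsWithin_of_mem_nhds (Iic_mem_nhds (by positivity))
  have h2 : ∀ᶠ ξ in 𝓝[>] (0 : ℝ), kerScale k ξ * R ≤ t₀ / 2 := by
    have := (tendsto_kerScale k).mul_const R
    rw [zero_mul] at this
    exact this.eventually_le_const (half_pos ht)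
  filter_upwards [self_mem_nhdsWithin, h1, h2] with ξ a b c using ⟨a, b, c⟩

lemma tendsto_profileDist_scaled_semicircle (hk0 : 0 ≤ k) (hk1 : k < 1) (ht : 0 < t₀)
    (hν : ν (Iio t₀) = 0) (hmom : Integrable (fun x : ℝ => x ^ 2) ν)
    (hR : 3 / √(1 - k) ≤ R) (hR2 : 2 ≤ R) :
    Tendsto (fun ξ => profileDist R (scaledDensity (atomMix k ν) k ξ)
      (scaledFlux (atomMix k ν) k ξ) semiDensity semiFlux) (𝓝[>] 0) (𝓝 0) := by
  refine tendsto_profileDist (B := (√(1 - k))⁻¹) ?_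
    (isProfile_semicircle (one_le_inv_sqrt_one_sub hk0 hk1) hR2)
    (fun ζ => (tendsto_scaledRes hk0 hk1 ht hν ζ).1) fun ζ => (tendsto_scaledRes hk0 hk1 ht hν ζ).2
  filter_upwards [eventually_scaling_window k R ht] with ξ h
  exact isProfile_scaled hk0 hk1 ht hν hmom h.1 h.2.1 hR h.2.2

/-- Continuity in ξ away from 0, needed to follow the solution branch. -/
lemma tendsto_profileDist_scaled {ξ : ℝ} (hξ : 0 < ξ) {s : Set ℝ} {B : ℝ}
    (hk0 : 0 ≤ k) (hk1 : k ≤ 1) (hξs : ξ ∈ s)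
    (hp : ∀ ξ' ∈ s, IsProfile B R (scaledDensity (atomMix k ν) k ξ')
      (scaledFlux (atomMix k ν) k ξ')) :
    Tendsto (fun ξ' => profileDist R (scaledDensity (atomMix k ν) k ξ')
      (scaledFlux (atomMix k ν) k ξ') (scaledDensity (atomMix k ν) k ξ)
      (scaledFlux (atomMix k ν) k ξ)) (𝓝[s] ξ) (𝓝 0) := by
  have := isProbabilityMeasure_atomMix (ν := ν) hk0 hk1
  have hc : ∀ ζ, Tendsto (fun ξ' => scaledRes (atomMix k ν) k ξ' ζ) (𝓝[s] ξ)
      (𝓝 (scaledRes (atomMix k ν) k ξ ζ)) := fun ζ =>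
    (continuousAt_scaledRes (atomMix k ν) hξ ζ).tendsto.mono_left nhdsWithin_le_nhds
  have h1 : ∀ ζ, Tendsto (fun ξ' => scaledDensity (atomMix k ν) k ξ' ζ) (𝓝[s] ξ)
      (𝓝 (scaledDensity (atomMix k ν) k ξ ζ)) := fun ζ =>
    ((Complex.continuous_im.tendsto _).comp (hc ζ)).div_const _
  exact tendsto_profileDist (eventually_mem_nhdsWithin.mono hp) (hp ξ hξs) h1 fun ζ =>
    ((Complex.continuous_re.tendsto _).comp (hc ζ)).mul (h1 ζ)

end ProfileLimit

/-! ### Following a root along ξ and then solving for ξ. -/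

section Branch

/-- Solving `A = T` for the second variable along a curve, then `√ξ G = lam` for the first. -/
lemma exists_solution_branch {A G : ℝ → ℝ → ℝ} {ξ₁ h₁ h₂ T c d d' : ℝ} (hξ₁ : 0 < ξ₁)
    (hh : h₁ ≤ h₂) (hc : 0 < c) (hd : 0 < d)
    (hslope : ∀ ξ ∈ Ioc 0 ξ₁, ∀ h ∈ Icc h₁ h₂, ∀ h' ∈ Icc h₁ h₂, h ≤ h' →
      c * (h' - h) ≤ A ξ h' - A ξ h)
    (hA : ∀ ξ ∈ Ioc 0 ξ₁, A ξ h₁ ≤ T ∧ T ≤ A ξ h₂)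
    (hG : ∀ ξ ∈ Ioc 0 ξ₁, ∀ h ∈ Icc h₁ h₂, d ≤ G ξ h ∧ G ξ h ≤ d')
    (hAc : ∀ ξ ∈ Ioc 0 ξ₁, ContinuousOn (A ξ) (Icc h₁ h₂))
    (hGc : ∀ ξ ∈ Ioc 0 ξ₁, ContinuousOn (G ξ) (Icc h₁ h₂))
    (hunif : ∀ ξ ∈ Ioc 0 ξ₁, ∃ e : ℝ → ℝ, Tendsto e (𝓝[Ioc 0 ξ₁] ξ) (𝓝 0) ∧
      ∀ ξ' ∈ Ioc 0 ξ₁, ∀ h ∈ Icc h₁ h₂, |A ξ' h - A ξ h| ≤ e ξ' ∧ |G ξ' h - G ξ h| ≤ e ξ') :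
    ∃ ξ h : ℝ → ℝ, Tendsto ξ (𝓝[>] 0) (𝓝 0) ∧ ∀ᶠ lam in 𝓝[>] (0 : ℝ),
      ξ lam ∈ Ioc 0 ξ₁ ∧ h lam ∈ Icc h₁ h₂ ∧ A (ξ lam) (h lam) = T ∧
        √(ξ lam) * G (ξ lam) (h lam) = lam := by
  have hex : ∀ ξ, ∃ h, ξ ∈ Ioc 0 ξ₁ → h ∈ Icc h₁ h₂ ∧ A ξ h = T := by
    intro ξ
    by_cases hξ : ξ ∈ Ioc 0 ξ₁
    · obtain ⟨h, h1, h2⟩ := intermediate_value_Icc hh (hAc ξ hξ) (hA ξ hξ)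
      exact ⟨h, fun _ => ⟨h1, h2⟩⟩
    · exact ⟨0, fun h => absurd h hξ⟩
  choose η hη using hex
  have habs : ∀ ξ ∈ Ioc 0 ξ₁, ∀ h ∈ Icc h₁ h₂, ∀ h' ∈ Icc h₁ h₂,
      |h' - h| ≤ |A ξ h' - A ξ h| / c := by
    intro ξ hξ h h1 h' h2
    rw [le_div_iff₀ hc]
    rcases le_total h h' with hle | hle
    · rw [abs_of_nonneg (sub_nonneg.2 hle), mul_comm]
      exact (hslope ξ hξ h h1 h' h2 hle).trans (le_abs_self _)
    · rw [abs_sub_comm, abs_sub_comm (A ξ h'), abs_of_nonneg (sub_nonneg.2 hle), mul_comm]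
      exact (hslope ξ hξ h' h2 h h1 hle).trans (le_abs_self _)
  -- The uniform slope c makes the root move by at most the perturbation of A divided by c.
  have hηc : ContinuousOn η (Ioc 0 ξ₁) := by
    intro ξ hξ
    obtain ⟨e, he, hb⟩ := hunif ξ hξ
    refine tendsto_iff_norm_sub_tendsto_zero.2
      (squeeze_zero' (Eventually.of_forall fun _ => norm_nonneg _) ?_
        (by simpa using he.div_const c))
    filter_upwards [self_mem_nhdsWithin] with ξ' hξ'
    refine (habs ξ' hξ' _ (hη ξ hξ).1 _ (hη ξ' hξ').1).trans ?_
    rw [(hη ξ' hξ').2, ← (hη ξ hξ).2, abs_sub_comm]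
    exact div_le_div_of_nonneg_right (hb ξ' hξ' _ (hη ξ hξ).1).1 hc.le
  set Λ : ℝ → ℝ := fun ξ => √ξ * G ξ (η ξ) with hΛ
  have hGη : ContinuousOn (fun ξ => G ξ (η ξ)) (Ioc 0 ξ₁) := by
    intro ξ hξ
    obtain ⟨e, he, hb⟩ := hunif ξ hξ
    have h1 : Tendsto (fun ξ' => G ξ (η ξ')) (𝓝[Ioc 0 ξ₁] ξ) (𝓝 (G ξ (η ξ))) := by
      refine (hGc ξ hξ (η ξ) (hη ξ hξ).1).tendsto.comp (tendsto_nhdsWithin_iff.2 ⟨hηc ξ hξ, ?_⟩)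
      filter_upwards [self_mem_nhdsWithin] with ξ' hξ' using (hη ξ' hξ').1
    have h2 : Tendsto (fun ξ' => G ξ' (η ξ') - G ξ (η ξ')) (𝓝[Ioc 0 ξ₁] ξ) (𝓝 0) := by
      refine squeeze_zero_norm' ?_ he
      filter_upwards [self_mem_nhdsWithin] with ξ' hξ' using (hb ξ' hξ' _ (hη ξ' hξ').1).2
    have h3 := h2.add h1
    simp only [sub_add_cancel, zero_add] at h3
    exact h3
  have hΛc : ContinuousOn Λ (Ioc 0 ξ₁) := Real.continuous_sqrt.continuousOn.mul hGη
  have hbd : ∀ ξ ∈ Ioc 0 ξ₁, √ξ * d ≤ Λ ξ ∧ Λ ξ ≤ √ξ * d' := by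
    intro ξ hξ
    have h1 := hG ξ hξ _ (hη ξ hξ).1
    exact ⟨mul_le_mul_of_nonneg_left h1.1 (Real.sqrt_nonneg _),
      mul_le_mul_of_nonneg_left h1.2 (Real.sqrt_nonneg _)⟩
  have hd' : 0 < d' := by
    have h1 := hG ξ₁ ⟨hξ₁, le_rfl⟩ h₁ ⟨le_rfl, hh⟩
    linarith
  have hsol : ∀ lam ∈ Ioo 0 (√ξ₁ * d), ∃ ξ ∈ Ioc 0 ξ₁, Λ ξ = lam := by
    intro lam hlam
    -- Chosen so that √b · d' ≤ lam, which puts lam between the values of Λ at b and at ξ₁.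
    set b := min ξ₁ ((lam / d') ^ 2) with hb
    have hb0 : 0 < b := lt_min hξ₁ (by have := hlam.1; positivity)
    have hb1 : b ≤ ξ₁ := min_le_left _ _
    have hlow : Λ b ≤ lam := by
      refine (hbd b ⟨hb0, hb1⟩).2.trans ?_
      have h1 : √b ≤ lam / d' := by
        rw [Real.sqrt_le_left (div_nonneg hlam.1.le hd'.le)]
        exact min_le_right _ _
      calc √b * d' ≤ lam / d' * d' := by gcongr
        _ = lam := by field_simp
    have hsub : Icc b ξ₁ ⊆ Ioc 0 ξ₁ := fun x hx => ⟨hb0.trans_le hx.1, hx.2⟩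
    obtain ⟨ξ, h1, h2⟩ := intermediate_value_Icc hb1 (hΛc.mono hsub)
      ⟨hlow, hlam.2.le.trans (hbd ξ₁ ⟨hξ₁, le_rfl⟩).1⟩
    exact ⟨ξ, hsub h1, h2⟩
  have hsol' : ∀ lam, ∃ ξ, lam ∈ Ioo 0 (√ξ₁ * d) → ξ ∈ Ioc 0 ξ₁ ∧ Λ ξ = lam := by
    intro lam
    by_cases hlam : lam ∈ Ioo 0 (√ξ₁ * d)
    · obtain ⟨ξ, h1, h2⟩ := hsol lam hlam
      exact ⟨ξ, fun _ => ⟨h1, h2⟩⟩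
    · exact ⟨0, fun h => absurd h hlam⟩
  choose X hX using hsol'
  have hev : ∀ᶠ lam in 𝓝[>] (0 : ℝ), lam ∈ Ioo 0 (√ξ₁ * d) :=
    Ioo_mem_nhdsGT (mul_pos (Real.sqrt_pos.2 hξ₁) hd)
  refine ⟨X, fun lam => η (X lam), ?_, ?_⟩
  · have hlim : Tendsto (fun lam : ℝ => (lam / d) ^ 2) (𝓝[>] 0) (𝓝 0) := by
      have h1 : Continuous fun lam : ℝ => (lam / d) ^ 2 := by fun_prop
      have h2 := h1.tendsto 0
      simp only [zero_div, ne_eq, OfNat.ofNat_ne_zero, not_false_eq_true, zero_pow] at h2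
      exact h2.mono_left nhdsWithin_le_nhds
    refine squeeze_zero' ?_ ?_ hlim
    · filter_upwards [hev] with lam hlam using (hX lam hlam).1.1.le
    · filter_upwards [hev] with lam hlam
      obtain ⟨h1, h2⟩ := hX lam hlam
      have h3 := (hbd _ h1).1
      rw [h2] at h3
      have h4 : √(X lam) ≤ lam / d := by rwa [le_div_iff₀ hd]
      calc X lam = √(X lam) ^ 2 := (Real.sq_sqrt h1.1.le).symm
        _ ≤ _ := by gcongr
  · filter_upwards [hev] with lam hlam
    obtain ⟨h1, h2⟩ := hX lam hlam
    exact ⟨h1, (hη _ h1).1, (hη _ h1).2, h2⟩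

end Branch

/-! ### Rank-deficient teacher: both sides of the threshold. -/

section LowRank

variable {k t₀ κ h w : ℝ} {ν : Measure ℝ} [IsProbabilityMeasure ν]

lemma threshold_pos (hk0 : 0 < k) (hk1 : k < 1) (hh : 0 ≤ h) :
    0 < k - k ^ 2 / 2 + (1 - k) ^ 2 / 2 * ∫ x in Ici (max h w), x * (x - h) ∂semicircle := by
  have h1 : 0 ≤ ∫ x in Ici (max h w), x * (x - h) ∂semicircle := by
    refine setIntegral_nonneg measurableSet_Ici fun x hx => ?_
    have : h ≤ x := (le_max_left _ _).trans hx
    exact mul_nonneg (hh.trans this) (sub_nonneg.2 this)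
  have h2 : 0 < k - k ^ 2 / 2 := by nlinarith
  positivity

/-- A solution with small ξ would have energy 2α, but every value of the energy is close to a value
of its limit, which is at least twice the threshold. -/
lemma mseBoundedBelow_lowRank (hk0 : 0 < k) (hk1 : k < 1) (ht : 0 < t₀) (hν : ν (Iio t₀) = 0)
    (hmom : Integrable (fun x : ℝ => x ^ 2) ν) (hκ : k ≤ κ) (hthr : ThresholdEquations κ k h w)
    {α : ℝ} (hα0 : 0 < α)
    (hα : α < k - k ^ 2 / 2 + (1 - k) ^ 2 / 2 *
      ∫ x in Ici (max h w), x * (x - h) ∂semicircle) :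
    MSEBoundedBelow (atomMix k ν) κ 0 α := by
  have := isProbabilityMeasure_atomMix (ν := ν) hk0.le hk1.le
  have h1k : 0 < 1 - k := sub_pos.2 hk1
  -- The last entry yields 2α + 1 < R²(1-k)k, with which `SolvesLongTimeEquations.lower_bound`
  -- excludes q > sR.
  set R := max (max 2 (3 / √(1 - k))) ((2 * α + 1) / (k * (1 - k)) + 1) with hRdef
  have hR2 : 2 ≤ R := (le_max_left _ _).trans (le_max_left _ _)
  have hR3 : 3 / √(1 - k) ≤ R := (le_max_right _ _).trans (le_max_left _ _)
  have hRk : 2 * α + 1 < R ^ 2 * (1 - k) * k := by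
    have h1 : (2 * α + 1) / (k * (1 - k)) < R :=
      (lt_add_one _).trans_le (le_max_right _ _)
    rw [div_lt_iff₀ (by positivity)] at h1
    have h2 : R * (k * (1 - k)) ≤ R ^ 2 * (k * (1 - k)) := by
      refine mul_le_mul_of_nonneg_right ?_ (by positivity)
      nlinarith
    linarith
  obtain ⟨hh, w', hw', hm, hs0, hE⟩ := hthr.profile hk0 hk1 hR2
  set a := k - k ^ 2 / 2 + (1 - k) ^ 2 / 2 * ∫ x in Ici (max h w), x * (x - h) ∂semicircle
  have hlim := ((tendsto_profileDist_scaled_semicircle hk0.le hk1 ht hν hmom hR3 hR2).const_mul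
    ((R ^ 2 + 8 * R) * (2 + (√(1 - k))⁻¹)))
  rw [mul_zero] at hlim
  have hev := (eventually_scaling_window k R ht).and
    (hlim.eventually_lt_const (show 0 < 2 * a - 2 * α by linarith))
  obtain ⟨ξ₁, hξ₁, hsub⟩ := mem_nhdsGT_iff_exists_Ioc_subset.1 hev
  have hξ₁ : 0 < ξ₁ := hξ₁
  refine ⟨2 * α * ξ₁, by positivity, Eventually.of_forall fun lam ξ q hsol => ?_⟩
  rw [mse, zero_div, sub_zero]
  by_contra! hlt
  have hξ0 : 0 < ξ := hsol.1
  have hξ : ξ < ξ₁ := lt_of_mul_lt_mul_left hlt (by positivity)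
  obtain ⟨⟨-, hξs, hRs⟩, hdist⟩ := hsub ⟨hξ0, hξ.le⟩
  have hs := kerScale_pos hk1 hξ0
  have hprof := isProfile_scaled hk0.le hk1 ht hν hmom hξ0 hξs hR3 hRs
  rcases le_or_gt q (kerScale k ξ * R) with hq | hq
  · have e : kerScale k ξ * (q / kerScale k ξ) = q := by field_simp
    have hqR : q / kerScale k ξ ∈ Ioc 0 R :=
      ⟨div_pos hsol.2.1 hs, by rw [div_le_iff₀ hs]; linarith⟩
    rw [← e, solvesLongTimeEquations_scaled hk0.le hk1 ht hν hmom hξ0 hξs hR3 hRs hκ hα0 hqR]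
      at hsol
    obtain ⟨w₁, hw₁, hm₁, hE₁, -⟩ := hsol
    set η := q / kerScale k ξ
    have h1 := (hprof.abs_sub_le_dist
      (isProfile_semicircle (one_le_inv_sqrt_one_sub hk0.le hk1) hR2)
      hk0.le hk1.le (by linarith) hw₁ hw' (hm₁.trans hm.symm) ⟨hqR.1.le, hqR.2⟩).1
    -- Tangent inequality at the minimiser h, where the slope vanishes.
    have h2 := energy_semicircle_increment (k := k) (h := h) (h' := η) hR2 hw'
      ⟨by linarith [hh.1], hh.2.trans hR2⟩ ⟨by linarith [hqR.1], hqR.2⟩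
    rw [hs0, hE, mul_zero, zero_add] at h2
    have h3 : 0 ≤ k * (1 - k) * (η - h) ^ 2 := by positivity
    have h4 := (abs_le.1 h1).1
    rw [hE₁] at h4
    linarith
  · have h1 := hsol.lower_bound (integrable_atomMix hmom) (b := kerScale k ξ * R) (by positivity)
      hq.le
    rw [real_Ici_scaled hk0.le hk1 ht hν hξ0 hξs hR3 hRs ⟨by linarith, le_rfl⟩, hprof.total,
      mul_one, sub_sub_cancel, mul_pow, kerScale_sq hk1.le hξ0.le] at h1
    nlinarith

set_option maxHeartbeats 1000000 in
-- Works in a small window around the root h₀ of E = 2α to the right of the minimiser. Slope and gap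
-- are bounded below there, and this survives for small ξ.
lemma perfectRecovery_lowRank (hk0 : 0 < k) (hk1 : k < 1) (ht : 0 < t₀) (hν : ν (Iio t₀) = 0)
    (hmom : Integrable (fun x : ℝ => x ^ 2) ν) (hκ : k ≤ κ) (hthr : ThresholdEquations κ k h w)
    {α : ℝ} (hα0 : 0 < α)
    (hα : k - k ^ 2 / 2 + (1 - k) ^ 2 / 2 *
      (∫ x in Ici (max h w), x * (x - h) ∂semicircle) < α) :
    PerfectRecovery (atomMix k ν) κ 0 α := by
  have := isProbabilityMeasure_atomMix (ν := ν) hk0.le hk1.le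
  have h1k : 0 < 1 - k := sub_pos.2 hk1
  have hkk : 0 < k * (1 - k) := mul_pos hk0 h1k
  -- The last entry makes k(1-k)(R-2)² ≥ 2α, so by quadratic growth the limiting energy exceeds 2α
  -- at R.
  set R := max (max 3 (3 / √(1 - k))) (2 * α / (k * (1 - k)) + 3) with hRdef
  have hR' : 3 ≤ R := (le_max_left _ _).trans (le_max_left _ _)
  have hR2 : 2 ≤ R := by linarith
  have hR3 : 3 / √(1 - k) ≤ R := (le_max_right _ _).trans (le_max_left _ _)
  have hRk : 2 * α ≤ k * (1 - k) * (R - 2) ^ 2 := by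
    have h1 : 2 * α / (k * (1 - k)) ≤ R - 3 := by
      linarith [le_max_right (max 3 (3 / √(1 - k))) (2 * α / (k * (1 - k)) + 3)]
    rw [div_le_iff₀ hkk] at h1
    nlinarith
  obtain ⟨hh, w', hw', hm, hs0, hE⟩ := hthr.profile hk0 hk1 hR2
  have hapos := threshold_pos (w := w) hk0 hk1 hh.1
  set a := k - k ^ 2 / 2 + (1 - k) ^ 2 / 2 * ∫ x in Ici (max h w), x * (x - h) ∂semicircle
  set B := (√(1 - k))⁻¹ with hB
  have hB1 : 1 ≤ B := one_le_inv_sqrt_one_sub hk0.le hk1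
  have hσ := isProfile_semicircle hB1 hR2
  obtain ⟨hEc, hGc⟩ := hσ.continuous_energy (k := k) (w := w')
  set E := profileEnergy k R semiDensity semiFlux w' with hEdef
  set Φ := profileSlope k R semiDensity semiFlux w' with hΦdef
  have hslopeσ : ∀ x, h ≤ x → x ≤ R → k * (x - h) ≤ Φ x := by
    intro x hx hxR
    have h1 := slope_semicircle_increment hk1.le hR2 hw' hx hxR
    rwa [← hΦdef, hs0, sub_zero] at h1
  have hincσ : ∀ x y, h ≤ x → x ≤ y → y ≤ R → k * (1 - k) * (y - x) ^ 2 ≤ E y - E x := by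
    intro x y hx hxy hy
    have h1 := energy_semicircle_increment (k := k) (h := x) (h' := y) hR2 hw'
      ⟨by linarith [hh.1], hxy.trans hy⟩ ⟨by linarith [hh.1], hy⟩
    have h2 : 0 ≤ Φ x :=
      (mul_nonneg hk0.le (sub_nonneg.2 hx)).trans (hslopeσ x hx (hxy.trans hy))
    have h3 : 0 ≤ 2 * (1 - k) * (y - x) * Φ x :=
      mul_nonneg (mul_nonneg (by linarith) (sub_nonneg.2 hxy)) h2
    linarith
  have hhR : h ≤ R := hh.2.trans hR2
  have hER : 2 * α < E R := by
    have h1 := hincσ h R le_rfl hhR le_rfl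
    rw [hE] at h1
    have h2 : (R - 2) ^ 2 ≤ (R - h) ^ 2 :=
      pow_le_pow_left₀ (by linarith) (by linarith [hh.2]) 2
    have h3 := mul_le_mul_of_nonneg_left h2 hkk.le
    linarith
  obtain ⟨h₀, hh₀, hE₀⟩ := intermediate_value_Ioo hhR hEc.continuousOn
    (show 2 * α ∈ Ioo (E h) (E R) from ⟨by rw [hE]; linarith, hER⟩)
  -- A lower bound for the slope on the window, whose points are at distance at least (h₀-h)/2 from
  -- the minimiser.
  set φ := k * ((h₀ - h) / 2) with hφ
  have hφ0 : 0 < φ := by have := hh₀.1; have : 0 < h₀ - h := by linarith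
                         positivity
  set C := (2 * R + 4) * (1 + B) * B with hC
  have hC0 : 0 ≤ C := by positivity
  -- The three entries keep the window away from the minimiser, inside [0, R], and narrow enough for
  -- the quadratic error in `IsProfile.energy_increment` to stay below the slope term.
  set ε := min ((h₀ - h) / 2) (min (R - h₀) ((1 - k) * φ / (4 * (C + 1)))) with hε
  have hε0 : 0 < ε := by
    refine lt_min (by linarith [hh₀.1]) (lt_min (by linarith [hh₀.2]) (by positivity))
  have hε1 : ε ≤ (h₀ - h) / 2 := min_le_left _ _
  have hε2 : ε ≤ R - h₀ := (min_le_right _ _).trans (min_le_left _ _)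
  have hε3 : C * (2 * ε) ≤ (1 - k) * φ / 2 := by
    have h1 : ε ≤ (1 - k) * φ / (4 * (C + 1)) := (min_le_right _ _).trans (min_le_right _ _)
    rw [le_div_iff₀ (by positivity)] at h1
    nlinarith
  set h₁ := h₀ - ε with hh₁
  set h₂ := h₀ + ε with hh₂
  have hwin : ∀ x ∈ Icc h₁ h₂, x ∈ Icc 0 R ∧ φ ≤ Φ x := by
    intro x hx
    have h1 : h + (h₀ - h) / 2 ≤ x := by linarith [hx.1]
    have h2 : x ≤ R := by linarith [hx.2]
    refine ⟨⟨by linarith [hh.1, hh₀.1], h2⟩, ?_⟩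
    refine le_trans ?_ (hslopeσ x (by linarith [hh₀.1]) h2)
    exact mul_le_mul_of_nonneg_left (by linarith) hk0.le
  have hh₁0 : 0 < h₁ := by linarith [hh.1, hh₀.1]
  have hh12 : h₁ ≤ h₂ := by linarith
  set g := (1 - k) * h₁ * φ with hg
  have hg0 : 0 < g := by positivity
  have hgapσ : ∀ x ∈ Icc h₁ h₂, g ≤ profileGap k R semiDensity semiFlux w' x := by
    intro x hx
    rw [gap_semicircle]
    have h1 := (hwin x hx).2
    have h2 := hx.1
    calc g ≤ (1 - k) * x * φ := by rw [hg]; gcongr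
      _ ≤ _ := mul_le_mul_of_nonneg_left h1 (mul_nonneg h1k.le (hh₁0.le.trans h2))
  obtain ⟨D, hD⟩ := isCompact_Icc.exists_bound_of_continuousOn (s := Icc h₁ h₂) hGc.continuousOn
  -- Admissible error of the limit: it preserves in turn the sign of A - 2α at the window's ends,
  -- half of the slope and half of the gap.
  set δ := min (k * (1 - k) * ε ^ 2) (min (φ / 2) (g / 2)) with hδ
  have hδ0 : 0 < δ := by positivity
  have hδ1 : δ ≤ k * (1 - k) * ε ^ 2 := min_le_left _ _
  have hδ2 : δ ≤ φ / 2 := (min_le_right _ _).trans (min_le_left _ _)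
  have hδ3 : δ ≤ g / 2 := (min_le_right _ _).trans (min_le_right _ _)
  have hlim := ((tendsto_profileDist_scaled_semicircle hk0.le hk1 ht hν hmom hR3 hR2).const_mul
    ((R ^ 2 + 8 * R) * (2 + B)))
  rw [mul_zero] at hlim
  have hev := (eventually_scaling_window k R ht).and (hlim.eventually_lt_const hδ0)
  obtain ⟨ξ₁, hξ₁, hsub⟩ := mem_nhdsGT_iff_exists_Ioc_subset.1 hev
  have hξ₁ : 0 < ξ₁ := hξ₁
  have hprof : ∀ ξ ∈ Ioc 0 ξ₁, IsProfile B R (scaledDensity (atomMix k ν) k ξ)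
      (scaledFlux (atomMix k ν) k ξ) := fun ξ hξ =>
    isProfile_scaled hk0.le hk1 ht hν hmom hξ.1 (hsub hξ).1.2.1 hR3 (hsub hξ).1.2.2
  have hlev : ∀ ξ, ∃ w, ξ ∈ Ioc 0 ξ₁ → w ∈ Icc (-R) R ∧
      ∫ ζ in (-R)..w, scaledDensity (atomMix k ν) k ξ ζ = (1 - min κ 1) / (1 - k) := by
    intro ξ
    by_cases hξ : ξ ∈ Ioc 0 ξ₁
    · have hK : k ≤ min κ 1 := le_min hκ hk1.le
      obtain ⟨w, h1, h2⟩ := (hprof ξ hξ).exists_mass_eq (by linarith)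
        (τ := (1 - min κ 1) / (1 - k))
        (div_nonneg (sub_nonneg.2 (min_le_right _ _)) h1k.le) ((div_le_one h1k).2 (by linarith))
      exact ⟨w, fun _ => ⟨h1, h2⟩⟩
    · exact ⟨0, fun h => absurd h hξ⟩
  choose W hW using hlev
  set A : ℝ → ℝ → ℝ := fun ξ => profileEnergy k R (scaledDensity (atomMix k ν) k ξ)
    (scaledFlux (atomMix k ν) k ξ) (W ξ) with hA
  set Γ : ℝ → ℝ → ℝ := fun ξ => profileGap k R (scaledDensity (atomMix k ν) k ξ)
    (scaledFlux (atomMix k ν) k ξ) (W ξ) with hΓ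
  set S : ℝ → ℝ → ℝ := fun ξ => profileSlope k R (scaledDensity (atomMix k ν) k ξ)
    (scaledFlux (atomMix k ν) k ξ) (W ξ) with hS
  have hclose : ∀ ξ ∈ Ioc 0 ξ₁, ∀ x ∈ Icc h₁ h₂, |A ξ x - E x| ≤ δ ∧
      |Γ ξ x - profileGap k R semiDensity semiFlux w' x| ≤ δ ∧ |S ξ x - Φ x| ≤ δ := by
    intro ξ hξ x hx
    have h1 := (hprof ξ hξ).abs_sub_le_dist hσ hk0.le hk1.le (by linarith) (hW ξ hξ).1 hw'
      ((hW ξ hξ).2.trans hm.symm) (hwin x hx).1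
    have h2 : _ < δ := (hsub hξ).2
    exact ⟨h1.1.trans h2.le, h1.2.1.trans h2.le, h1.2.2.trans h2.le⟩
  -- Since s = √ξ √(1-k), the equation s h Γ = 2αλ reads √ξ · m h Γ = λ, the form required by
  -- `exists_solution_branch`.
  set m := √(1 - k) / (2 * α) with hm0
  have hmpos : 0 < m := div_pos (Real.sqrt_pos.2 h1k) (by positivity)
  have hbranch : ∃ X H : ℝ → ℝ, Tendsto X (𝓝[>] 0) (𝓝 0) ∧ ∀ᶠ lam in 𝓝[>] (0 : ℝ),
      X lam ∈ Ioc 0 ξ₁ ∧ H lam ∈ Icc h₁ h₂ ∧ A (X lam) (H lam) = 2 * α ∧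
        √(X lam) * (m * (H lam * Γ (X lam) (H lam))) = lam := by
    refine exists_solution_branch (A := A) (G := fun ξ x => m * (x * Γ ξ x))
      (T := 2 * α) (c := (1 - k) * φ / 2) (d := m * (h₁ * (g / 2))) (d' := m * (R * (D + δ)))
      hξ₁ hh12 (by positivity) (by positivity) ?_ ?_ ?_ ?_ ?_ ?_
    · intro ξ hξ x hx y hy hxy
      have h1 := (hprof ξ hξ).energy_increment hk0.le hk1.le (hW ξ hξ).1 (hwin x hx).1.1 hxy
        (hwin y hy).1.2
      refine le_trans ?_ h1
      rw [mul_comm]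
      refine mul_le_mul_of_nonneg_left ?_ (sub_nonneg.2 hxy)
      have h2 : φ / 2 ≤ S ξ x := by
        have := (abs_le.1 (hclose ξ hξ x hx).2.2).1
        linarith [(hwin x hx).2]
      have h3 : (1 - k) * (φ / 2) ≤ (1 - k) * S ξ x := mul_le_mul_of_nonneg_left h2 h1k.le
      have h4 : C * (y - x) ≤ C * (2 * ε) :=
        mul_le_mul_of_nonneg_left (by linarith [hx.1, hy.2]) hC0
      change _ ≤ 2 * (1 - k) * S ξ x - C * (y - x)
      linarith
    · intro ξ hξ
      have h1 := (abs_le.1 (hclose ξ hξ h₁ ⟨le_rfl, hh12⟩).1).2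
      have h2 := (abs_le.1 (hclose ξ hξ h₂ ⟨hh12, le_rfl⟩).1).1
      have h3 := hincσ h₁ h₀ (by linarith [hh₀.1]) (by linarith) hh₀.2.le
      have h4 := hincσ h₀ h₂ hh₀.1.le (by linarith) (by linarith)
      rw [hE₀, hh₁, sub_sub_cancel] at h3
      rw [hE₀, hh₂, add_sub_cancel_left] at h4
      exact ⟨by linarith, by linarith⟩
    · intro ξ hξ x hx
      obtain ⟨-, h1, -⟩ := hclose ξ hξ x hx
      have h2 := hgapσ x hx
      have h3 := (le_abs_self _).trans (hD x hx)
      have h4 := abs_le.1 h1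
      have h5 : g / 2 ≤ Γ ξ x := by linarith [h4.1]
      have h6 : Γ ξ x ≤ D + δ := by linarith [h4.2]
      have h7 := (hwin x hx).1
      have h8 : 0 ≤ Γ ξ x := by linarith
      exact ⟨mul_le_mul_of_nonneg_left (mul_le_mul hx.1 h5 (by positivity) h7.1) hmpos.le,
        mul_le_mul_of_nonneg_left (mul_le_mul h7.2 h6 h8 (by linarith)) hmpos.le⟩
    · intro ξ hξ
      exact ((hprof ξ hξ).continuous_energy (k := k) (w := W ξ)).1.continuousOn
    · intro ξ hξ
      have := ((hprof ξ hξ).continuous_energy (k := k) (w := W ξ)).2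
      exact (continuous_const.mul (continuous_id.mul this)).continuousOn
    · intro ξ hξ
      set δ' : ℝ → ℝ := fun ξ' => (R ^ 2 + 8 * R) * (2 + B) *
        profileDist R (scaledDensity (atomMix k ν) k ξ') (scaledFlux (atomMix k ν) k ξ')
          (scaledDensity (atomMix k ν) k ξ) (scaledFlux (atomMix k ν) k ξ) with hδ'
      have hlim' := (tendsto_profileDist_scaled hξ.1 hk0.le hk1.le hξ hprof).const_mul
        ((R ^ 2 + 8 * R) * (2 + B))
      rw [mul_zero] at hlim'
      have hlim2 := hlim'.const_mul (1 + m * R)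
      rw [mul_zero] at hlim2
      refine ⟨fun ξ' => (1 + m * R) * δ' ξ', hlim2, fun ξ' hξ' x hx => ?_⟩
      have h1 := (hprof ξ' hξ').abs_sub_le_dist (hprof ξ hξ) hk0.le hk1.le (by linarith)
        (hW ξ' hξ').1 (hW ξ hξ).1 ((hW ξ' hξ').2.trans (hW ξ hξ).2.symm) (hwin x hx).1
      have h2 : |A ξ' x - A ξ x| ≤ δ' ξ' := h1.1
      have h3 : |Γ ξ' x - Γ ξ x| ≤ δ' ξ' := h1.2.1
      have h4 : 0 ≤ δ' ξ' := (abs_nonneg _).trans h2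
      have hmR : 0 ≤ m * R := by positivity
      have h6 : (1 + m * R) * δ' ξ' = δ' ξ' + m * (R * δ' ξ') := by ring
      have h7 : 0 ≤ m * (R * δ' ξ') := by positivity
      constructor
      · linarith
      · rw [← mul_sub, ← mul_sub, abs_mul, abs_mul, abs_of_pos hmpos,
          abs_of_nonneg (hwin x hx).1.1]
        have h5 : m * (x * |Γ ξ' x - Γ ξ x|) ≤ m * (R * δ' ξ') := by
          have := (hwin x hx).1.2
          gcongr
        linarith
  obtain ⟨X, H, hX, hsol⟩ := hbranch
  refine ⟨X, fun lam => kerScale k (X lam) * H lam, ?_, ?_⟩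
  · filter_upwards [hsol] with lam hlam
    obtain ⟨h1, h2, h3, h4⟩ := hlam
    have h5 := (hwin _ h2).1
    have h6 : H lam ∈ Ioc 0 R := ⟨hh₁0.trans_le h2.1, h5.2⟩
    rw [solvesLongTimeEquations_scaled hk0.le hk1 ht hν hmom h1.1 (hsub h1).1.2.1 hR3
      (hsub h1).1.2.2 hκ hα0 h6]
    refine ⟨W (X lam), (hW _ h1).1, (hW _ h1).2, h3, ?_⟩
    rw [kerScale_eq h1.1.le]
    have h7 : 2 * α * m = √(1 - k) := by rw [hm0]; field_simp
    calc _ = √(X lam) * (√(1 - k) * (H lam * Γ (X lam) (H lam))) := by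
          simp only [hΓ]; ring
      _ = 2 * α * (√(X lam) * (m * (H lam * Γ (X lam) (H lam)))) := by rw [← h7]; ring
      _ = _ := by rw [h4]
  · have h1 := hX.const_mul (2 * α)
    rw [mul_zero] at h1
    simpa [mse] using h1

theorem isPerfectRecoveryThreshold_lowRank (hk0 : 0 < k) (hk1 : k < 1) (ht : 0 < t₀)
    (hν : ν (Iio t₀) = 0) (hmom : Integrable (fun x : ℝ => x ^ 2) ν) (hκ : k ≤ κ)
    (hthr : ThresholdEquations κ k h w) :
    IsPerfectRecoveryThreshold (atomMix k ν) κ 0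
      (k - k ^ 2 / 2 + (1 - k) ^ 2 / 2 *
        ∫ x in Ici (max h w), x * (x - h) ∂semicircle) := by
  have hpos := threshold_pos (w := w) hk0 hk1 (hthr.profile hk0 hk1 le_rfl).1.1
  exact ⟨hpos, fun α hα =>
    perfectRecovery_lowRank hk0 hk1 ht hν hmom hκ hthr (hpos.trans hα) hα,
    fun α hα0 hα => mseBoundedBelow_lowRank hk0 hk1 ht hν hmom hκ hthr hα0 hα⟩

end LowRank

end MatrixSensing
theorem mainTheorem1 (κ κs : ℝ) (hκs : 0 < κs) (hκ : min κs 1 ≤ κ)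
    (ν : MeasureTheory.Measure ℝ) [MeasureTheory.IsProbabilityMeasure ν]
    (hsupp : ∃ t : ℝ, 0 < t ∧ ν (Set.Iio t) = 0)
    (hmom : MeasureTheory.Integrable (fun x : ℝ => x ^ 2) ν) :
    (κs < 1 →
      (∃ h w : ℝ, MatrixSensing.ThresholdEquations κ κs h w) ∧
      ∀ h w : ℝ, MatrixSensing.ThresholdEquations κ κs h w →
        MatrixSensing.IsPerfectRecoveryThreshold (MatrixSensing.teacherLaw κs ν) κ 0
          (κs - κs ^ 2 / 2 + (1 - κs) ^ 2 / 2 *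
            ∫ x in Set.Ici (max h w), x * (x - h) ∂MatrixSensing.semicircle)) ∧
    (1 ≤ κs →
      MatrixSensing.IsPerfectRecoveryThreshold (MatrixSensing.teacherLaw κs ν) κ 0 (1 / 2)) := by
  obtain ⟨t₀, ht, hν⟩ := hsupp
  constructor
  · intro h1
    rw [min_eq_left h1.le] at hκ
    refine ⟨MatrixSensing.exists_thresholdEquations hκs h1 hκ, fun h w hthr => ?_⟩
    have e : MatrixSensing.teacherLaw κs ν = MatrixSensing.atomMix κs ν := by
      rw [MatrixSensing.teacherLaw, min_eq_left h1.le]; rfl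
    rw [e]
    exact MatrixSensing.isPerfectRecoveryThreshold_lowRank hκs h1 ht hν hmom hκ hthr
  · intro h1
    rw [min_eq_right h1] at hκ
    have e : MatrixSensing.teacherLaw κs ν = MatrixSensing.atomMix 1 ν := by
      rw [MatrixSensing.teacherLaw, min_eq_right h1]; rfl
    rw [e]
    exact MatrixSensing.isPerfectRecoveryThreshold_fullRank ht hν hmom hκ
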